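/- Let $a_1,a_2\ge 1$ and $d\ge 1$ be integers, let $A=\mathbb{C}[x_1,x_2]$ be graded by $\deg x_i=a_i$, and for a graded $A$-module $M$ write $M(k)$ for the shifted module, $M(k)_i=M_{i+k}$. Let $W\in A$ be homogeneous of degree $d$ such that $(W=0)\subset\mathbb{C}^2$ has no singular point other than possibly the origin, and put $\varepsilon=a_1+a_2-d$. Let $\mathrm{HMF}^{\mathrm{gr}}(W)$ be the triangulated category of graded matrix factorizations $P^\bullet=(P^0\xrightarrow{p^0}P^1\xrightarrow{p^1}P^0(d))$ of $W$: here $P^0,P^1$ are graded free $A$-modules of finite rank and $p^0,p^1$ are degree-preserving maps with $p^1p^0=W$ and $p^0(d)p^1=W$; the morphisms are pairs of degree-preserving maps commuting with the $p^i$, modulo null-homotopic ones; the shift $[1]$ sends $P^\bullet$ to $(P^1\xrightarrow{-p^1}P^0(d)\xrightarrow{-p^0(d)}P^1(d))$; and the distinguished triangles are those given by mapping cones. Let $\tau$ be the autoequivalence $P^\bullet\mapsto P^\bullet(1)$. For $P^0\cong\bigoplus_j A(n_{0,j})$ and $P^1\cong\bigoplus_j A(n_{1,j})$ put $$Z_G(P^\bullet)=\sum_j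 e^{2\pi i\,n_{0,j}/d}-\sum_j e^{2\pi i\,n_{1,j}/d}.$$ A stability condition on a triangulated category $\mathcal{D}$ is a pair $\sigma=(Z,\{\mathcal{P}(\phi)\}_{\phi\in\mathbb{R}})$ of a group homomorphism $Z\colon K(\mathcal{D})\to\mathbb{C}$ and full additive subcategories $\mathcal{P}(\phi)\subset\mathcal{D}$, closed under isomorphism, such that (i) $Z(E)\in\mathbb{R}_{>0}e^{i\pi\phi}$ for $0\ne E\in\mathcal{P}(\phi)$; (ii) $\mathcal{P}(\phi+1)=\mathcal{P}(\phi)[1]$; (iii) $\mathrm{Hom}(E_1,E_2)=0$ for $E_i\in\mathcal{P}(\phi_i)$ with $\phi_1>\phi_2$; (iv) every $0\ne E\in\mathcal{D}$ admits distinguished triangles $E_{i-1}\to E_i\to F_i\to E_{i-1}[1]$, $1\le i\le N$, with $E_0=0$, $E_N\cong E$, $F_i\in\mathcal{P}(\phi_i)$ and $\phi_1>\dots>\phi_N$. It is of Gepner type with respect to $(\Phi,\lambda)$, where $\Phi$ is an autoequivalence and $\lambda\in\mathbb{C}$, if $Z\circ\Phi^{-1}=e^{-i\pi\lambda}Z$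 and $\Phi(\mathcal{P}(\phi))=\mathcal{P}(\phi+\mathrm{Re}\,\lambda)$ for all $\phi\in\mathbb{R}$. Suppose that $\varepsilon\ge 0$. Then $Z_G$ is the central charge of a stability condition on $\mathrm{HMF}^{\mathrm{gr}}(W)$ which is of Gepner type with respect to $(\tau,2/d)$ (in particular, $Z_G$ descends to $K(\mathrm{HMF}^{\mathrm{gr}}(W))$). More precisely: 1. If $\varepsilon>0$, then $\mathrm{HMF}^{\mathrm{gr}}(W)=0$. 2. If $\varepsilon=0$, then $W=u_1u_2$ for homogeneous elements $u_1,u_2\in A$ of degrees $a_1,a_2$ such that $x_i\mapsto u_i$ defines an automorphism of the algebra $A$ (so that $W=x_1x_2$ after a change of coordinates). For every factorization $W=u_1u_2$ with $u_i$ homogeneous of degree $a_i$, let $L(j)$, $j\in\mathbb{Z}$, be the matrix factorization $$L(j)=\bigl\{A(j-a_1)\xrightarrow{u_1}A(j)\xrightarrow{u_2}A(j-a_1+d)\bigr\}.$$ Then: (a) every object of $\mathrm{HMF}^{\mathrm{gr}}(W)$ is a finite direct sum of objects $L(j)[k]$ with $0\le j\le d-1$, $k\in\mathbb{Z}$, and,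 up to isomorphism, these are exactly the indecomposable objects; (b) they are mutually orthogonal: $\mathrm{Hom}(L(j)[k],L(j')[k'])=0$ if $0\le j,j'\le d-1$ and $(j,k)\ne(j',k')$; (c) there is a $\phi_0\in\mathbb{R}$ with $Z_G(L(0))\in\mathbb{R}_{>0}e^{i\pi\phi_0}$; and for every such $\phi_0$, with the phases $\phi(L(j)[k])=\phi_0+k+\frac{2j}{d}$ for $0\le j\le d-1$, $k\in\mathbb{Z}$, and with $\mathcal{P}_G(\phi)$ the full subcategory of the finite direct sums of objects $L(j)[k]$ of phase $\phi$, the pair $\sigma_G=(Z_G,\{\mathcal{P}_G(\phi)\}_{\phi\in\mathbb{R}})$ is a stability condition of Gepner type with respect to $(\tau,2/d)$. -/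

import Mathlib

open CategoryTheory Limits

noncomputable section

/-! ## Graded matrix factorizations -/

/-- A pair `P⁰, P¹` of graded free modules of finite rank over the graded polynomial ring
`A = ℂ[x₁, …, xₙ]`, given by a homogeneous basis: a basis element `i` belongs to `P^{par i}`
and generates a direct summand `A(deg i)`. -/
structure GrFree : Type 1 where
  ι : Type
  [fintype : Fintype ι]
  [decEq : DecidableEq ι]
  par : ι → ZMod 2
  deg : ι → ℤ

attribute [instance] GrFree.fintype GrFree.decEq

section Homog

variable {n : ℕ} (a : Fin n → ℤ) (d : ℤ)

/-- With the convention `P^{s + 2m} = P^s(m d)`, the matrix `f` has entries in `A` which define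
degree-preserving maps of graded `A`-modules `P^s → Q^{s + k}` for all `s`.
(A map `A(u) → A(v)` preserves degrees if and only if it is the multiplication by an element of
degree `v - u`, where `x_i` has degree `a i`.) -/
def IsHomog (k : ℤ) (P Q : GrFree) (f : Matrix Q.ι P.ι (MvPolynomial (Fin n) ℂ)) : Prop :=
  ∀ (j : Q.ι) (i : P.ι),
    (∀ m : ℤ, ((P.par i).val : ℤ) + k = (Q.par j).val + 2 * m →
      MvPolynomial.IsWeightedHomogeneous a (f j i) (Q.deg j + m * d - P.deg i)) ∧
    ((∀ m : ℤ, ((P.par i).val : ℤ) + k ≠ (Q.par j).val + 2 * m) → f j i = 0)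

end Homog

/-- A graded matrix factorization `P⁰ → P¹ → P⁰(d)` of `W`, as an object of the category
`HMF^gr(W)`: the two maps `p⁰, p¹` are the two blocks of the odd matrix `p`. -/
structure HMF {n : ℕ} (a : Fin n → ℤ) (d : ℤ) (W : MvPolynomial (Fin n) ℂ) : Type 1 extends
    GrFree where
  p : Matrix ι ι (MvPolynomial (Fin n) ℂ)
  p_homog : IsHomog a d 1 toGrFree toGrFree p
  p_mul_p : p * p = W • (1 : Matrix ι ι (MvPolynomial (Fin n) ℂ))

namespace IsHomog

variable {n : ℕ} {a : Fin n → ℤ} {d : ℤ} {k l : ℤ} {P Q R : GrFree}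

theorem zero : IsHomog a d k P Q 0 := fun _ _ =>
  ⟨fun _ _ => MvPolynomial.isWeightedHomogeneous_zero _ _ _, fun _ => rfl⟩

theorem add {f g : Matrix Q.ι P.ι (MvPolynomial (Fin n) ℂ)} (hf : IsHomog a d k P Q f)
    (hg : IsHomog a d k P Q g) : IsHomog a d k P Q (f + g) := fun j i =>
  ⟨fun m hm => ((hf j i).1 m hm).add ((hg j i).1 m hm), fun h => by
    simp [(hf j i).2 h, (hg j i).2 h]⟩

theorem neg {f : Matrix Q.ι P.ι (MvPolynomial (Fin n) ℂ)} (hf : IsHomog a d k P Q f) :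
    IsHomog a d k P Q (-f) := fun j i =>
  ⟨fun m hm => ((hf j i).1 m hm).neg, fun h => by simp [(hf j i).2 h]⟩

theorem sub {f g : Matrix Q.ι P.ι (MvPolynomial (Fin n) ℂ)} (hf : IsHomog a d k P Q f)
    (hg : IsHomog a d k P Q g) : IsHomog a d k P Q (f - g) := by
  rw [sub_eq_add_neg]; exact hf.add hg.neg

theorem mul {f : Matrix Q.ι P.ι (MvPolynomial (Fin n) ℂ)}
    {g : Matrix R.ι Q.ι (MvPolynomial (Fin n) ℂ)} (hg : IsHomog a d l Q R g)
    (hf : IsHomog a d k P Q f) : IsHomog a d (l + k) P R (g * f) := fun r i => by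
  constructor
  · intro m hm
    rw [Matrix.mul_apply]
    refine MvPolynomial.IsWeightedHomogeneous.sum _ _ _ fun j _ => ?_
    by_cases h : ∃ m₁ : ℤ, ((P.par i).val : ℤ) + k = (Q.par j).val + 2 * m₁
    · obtain ⟨m₁, h₁⟩ := h
      have h₂ := (hg r j).1 (m - m₁) (by linarith)
      have h₃ := h₂.mul ((hf j i).1 m₁ h₁)
      convert h₃ using 1
      ring
    · rw [(hf j i).2 (by push Not at h; exact h), mul_zero]
      exact MvPolynomial.isWeightedHomogeneous_zero _ _ _
  · intro hm
    rw [Matrix.mul_apply]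
    refine Finset.sum_eq_zero fun j _ => ?_
    by_cases h : ∃ m₁ : ℤ, ((P.par i).val : ℤ) + k = (Q.par j).val + 2 * m₁
    · obtain ⟨m₁, h₁⟩ := h
      rw [(hg r j).2 (fun m₂ h₂ => hm (m₁ + m₂) (by linarith)), zero_mul]
    · rw [(hf j i).2 (by push Not at h; exact h), mul_zero]

theorem cast {f : Matrix Q.ι P.ι (MvPolynomial (Fin n) ℂ)} (hf : IsHomog a d k P Q f)
    (h : k = l) : IsHomog a d l P Q f := h ▸ hf

theorem mul' {m : ℤ} {f : Matrix Q.ι P.ι (MvPolynomial (Fin n) ℂ)}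
    {g : Matrix R.ι Q.ι (MvPolynomial (Fin n) ℂ)} (hg : IsHomog a d l Q R g)
    (hf : IsHomog a d k P Q f) (h : l + k = m) : IsHomog a d m P R (g * f) :=
  (hg.mul hf).cast h

theorem one_of_eq {ι : Type} [Fintype ι] [DecidableEq ι] {s s' : ι → ZMod 2} {t t' : ι → ℤ}
    (hs : s = s') (ht : t = t') : IsHomog a d 0 ⟨ι, s, t⟩ ⟨ι, s', t'⟩ (1 : Matrix ι ι _) := by
  subst hs ht
  intro j i
  by_cases h : j = i
  · subst h
    refine ⟨fun m hm => ?_, fun hm => (hm 0 (by simp)).elim⟩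
    obtain rfl : m = 0 := by simpa using hm
    simpa using MvPolynomial.isWeightedHomogeneous_one ℂ a
  · rw [Matrix.one_apply_ne h]
    exact ⟨fun _ _ => MvPolynomial.isWeightedHomogeneous_zero _ _ _, fun _ => rfl⟩

theorem one : IsHomog a d 0 P P (1 : Matrix P.ι P.ι _) :=
  one_of_eq (s := P.par) (t := P.deg) rfl rfl

end IsHomog

namespace HMF

variable {n : ℕ} {a : Fin n → ℤ} {d : ℤ} {W : MvPolynomial (Fin n) ℂ}

/-- Morphisms of graded matrix factorizations (before taking homotopy classes): pairs
`(f⁰, f¹)` of maps of graded modules commuting with `p` and `q`. -/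
def cocycles (P Q : HMF a d W) : AddSubgroup (Matrix Q.ι P.ι (MvPolynomial (Fin n) ℂ)) where
  carrier := {f | IsHomog a d 0 P.toGrFree Q.toGrFree f ∧ f * P.p = Q.p * f}
  zero_mem' := ⟨IsHomog.zero, by simp⟩
  add_mem' hf hg := ⟨hf.1.add hg.1, by rw [Matrix.add_mul, Matrix.mul_add, hf.2, hg.2]⟩
  neg_mem' hf := ⟨hf.1.neg, by rw [Matrix.neg_mul, Matrix.mul_neg, hf.2]⟩

/-- The subgroup of null-homotopic morphisms `f = q h + h p`, where `h` consists of maps of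
graded modules `h⁰ : P⁰ → Q¹(-d)` and `h¹ : P¹ → Q⁰`. -/
def nullHomotopic (P Q : HMF a d W) : AddSubgroup (cocycles P Q) where
  carrier := {f | ∃ h, IsHomog a d (-1) P.toGrFree Q.toGrFree h ∧ f.1 = Q.p * h + h * P.p}
  zero_mem' := ⟨0, IsHomog.zero, by simp⟩
  add_mem' := by
    rintro f g ⟨h, hh, hf⟩ ⟨h', hh', hg⟩
    exact ⟨h + h', hh.add hh', by
      rw [AddSubgroup.coe_add, hf, hg, Matrix.add_mul, Matrix.mul_add]; abel⟩
  neg_mem' := by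
    rintro f ⟨h, hh, hf⟩
    exact ⟨-h, hh.neg, by rw [AddSubgroup.coe_neg, hf, Matrix.neg_mul, Matrix.mul_neg]; abel⟩

/-- The composition of morphisms, as a biadditive map on homotopy classes. -/
def compHom (P Q R : HMF a d W) :
    (cocycles P Q ⧸ nullHomotopic P Q) →+ (cocycles Q R ⧸ nullHomotopic Q R) →+
      (cocycles P R ⧸ nullHomotopic P R) :=
  QuotientAddGroup.lift _
    (AddMonoidHom.mk' (fun f : cocycles P Q => QuotientAddGroup.lift _
      (AddMonoidHom.mk' (fun g : cocycles Q R =>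
        (QuotientAddGroup.mk (⟨g.1 * f.1, g.2.1.mul' f.2.1 (by norm_num), by
          rw [Matrix.mul_assoc, f.2.2, ← Matrix.mul_assoc, g.2.2, Matrix.mul_assoc]⟩ :
            cocycles P R) : cocycles P R ⧸ nullHomotopic P R))
        (fun g g' => by
          rw [← QuotientAddGroup.mk_add]
          congr 1
          exact Subtype.ext (by simp [Matrix.add_mul])))
      (by
        rintro g ⟨h, hh, hg⟩
        refine (QuotientAddGroup.eq_zero_iff _).2
          ⟨h * f.1, hh.mul' f.2.1 (by norm_num), ?_⟩
        change g.1 * f.1 = _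
        rw [hg, Matrix.add_mul, Matrix.mul_assoc, Matrix.mul_assoc, Matrix.mul_assoc, f.2.2]))
      (fun f f' => by
        ext g
        refine congrArg QuotientAddGroup.mk (Subtype.ext ?_)
        exact Matrix.mul_add g.1 f.1 f'.1))
    (by
      rintro f ⟨h, hh, hf⟩
      ext g
      refine (QuotientAddGroup.eq_zero_iff _).2
        ⟨g.1 * h, g.2.1.mul' hh (by norm_num), ?_⟩
      change g.1 * f.1 = _
      rw [hf, Matrix.mul_add, ← Matrix.mul_assoc, ← Matrix.mul_assoc, ← Matrix.mul_assoc, g.2.2])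

/-- The category `HMF^gr(W)`: morphisms are homotopy classes of morphisms of graded matrix
factorizations. -/
instance : Category (HMF a d W) where
  Hom P Q := cocycles P Q ⧸ nullHomotopic P Q
  id P := QuotientAddGroup.mk ⟨1, IsHomog.one, by simp⟩
  comp {P Q R} f g := compHom P Q R f g
  id_comp {P Q} f := by
    obtain ⟨f, rfl⟩ := QuotientAddGroup.mk_surjective f
    refine congrArg QuotientAddGroup.mk (Subtype.ext ?_)
    exact Matrix.mul_one f.1
  comp_id {P Q} f := by
    obtain ⟨f, rfl⟩ := QuotientAddGroup.mk_surjective f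
    refine congrArg QuotientAddGroup.mk (Subtype.ext ?_)
    exact Matrix.one_mul f.1
  assoc {P Q R S} f g h := by
    obtain ⟨f, rfl⟩ := QuotientAddGroup.mk_surjective f
    obtain ⟨g, rfl⟩ := QuotientAddGroup.mk_surjective g
    obtain ⟨h, rfl⟩ := QuotientAddGroup.mk_surjective h
    refine congrArg QuotientAddGroup.mk (Subtype.ext ?_)
    exact (Matrix.mul_assoc h.1 g.1 f.1).symm

instance addCommGroupHom (P Q : HMF a d W) : AddCommGroup (P ⟶ Q) :=
  inferInstanceAs (AddCommGroup (cocycles P Q ⧸ nullHomotopic P Q))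

instance : Preadditive (HMF a d W) where
  homGroup P Q := addCommGroupHom P Q
  add_comp P Q R f g h := by
    change compHom P Q R (f + g) h = compHom P Q R f h + compHom P Q R g h
    rw [map_add]; rfl
  comp_add P Q R f g h := by
    change compHom P Q R f (g + h) = compHom P Q R f g + compHom P Q R f h
    rw [map_add]

/-- The homotopy class of a morphism of graded matrix factorizations. -/
def homMk {P Q : HMF a d W} (f : Matrix Q.ι P.ι (MvPolynomial (Fin n) ℂ))
    (hf : IsHomog a d 0 P.toGrFree Q.toGrFree f) (hc : f * P.p = Q.p * f) : P ⟶ Q :=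
  QuotientAddGroup.mk (⟨f, hf, hc⟩ : cocycles P Q)

section mk

variable {P Q R : HMF a d W}

theorem exists_mk (f : P ⟶ Q) : ∃ (m : _) (h₁ : _) (h₂ : _), f = homMk m h₁ h₂ := by
  obtain ⟨f, rfl⟩ := QuotientAddGroup.mk_surjective f
  exact ⟨f.1, f.2.1, f.2.2, rfl⟩

theorem mk_comp_mk {f : Matrix Q.ι P.ι (MvPolynomial (Fin n) ℂ)}
    {g : Matrix R.ι Q.ι (MvPolynomial (Fin n) ℂ)} (hf hf' hg hg') :
    (homMk f hf hf' : P ⟶ Q) ≫ (homMk g hg hg' : Q ⟶ R) =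
      homMk (g * f) (hg.mul' hf (by norm_num)) (by
        rw [Matrix.mul_assoc, hf', ← Matrix.mul_assoc, hg', Matrix.mul_assoc]) := rfl

theorem id_eq_mk : 𝟙 P = homMk 1 IsHomog.one (by simp) := rfl

theorem zero_eq_mk : (0 : P ⟶ Q) = homMk 0 IsHomog.zero (by simp) := rfl

theorem neg_mk {f : Matrix Q.ι P.ι (MvPolynomial (Fin n) ℂ)} (hf hf') :
    -(homMk f hf hf' : P ⟶ Q) = homMk (-f) hf.neg (by rw [Matrix.neg_mul, Matrix.mul_neg, hf']) := rfl

theorem mk_add_mk {f g : Matrix Q.ι P.ι (MvPolynomial (Fin n) ℂ)} (hf hf' hg hg') :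
    (homMk f hf hf' : P ⟶ Q) + homMk g hg hg' = homMk (f + g) (hf.add hg)
      (by rw [Matrix.add_mul, Matrix.mul_add, hf', hg']) := rfl

theorem quot_eq_iff {x y : cocycles P Q} :
    (QuotientAddGroup.mk x : P ⟶ Q) = (QuotientAddGroup.mk y : P ⟶ Q) ↔
      ∃ h, IsHomog a d (-1) P.toGrFree Q.toGrFree h ∧ y.1 - x.1 = Q.p * h + h * P.p := by
  refine QuotientAddGroup.eq.trans ?_
  refine exists_congr fun h => and_congr_right fun _ => ?_
  change -x.1 + y.1 = _ ↔ _
  rw [neg_add_eq_sub]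

theorem eq_of_homotopy {x y : cocycles P Q}
    (h : Matrix Q.ι P.ι (MvPolynomial (Fin n) ℂ))
    (hh : IsHomog a d (-1) P.toGrFree Q.toGrFree h) (e : y.1 - x.1 = Q.p * h + h * P.p) :
    (QuotientAddGroup.mk x : P ⟶ Q) = (QuotientAddGroup.mk y : P ⟶ Q) :=
  quot_eq_iff.2 ⟨h, hh, e⟩

theorem eq_of_val {x y : cocycles P Q} (h : x.1 = y.1) :
    (QuotientAddGroup.mk x : P ⟶ Q) = (QuotientAddGroup.mk y : P ⟶ Q) :=
  congrArg QuotientAddGroup.mk (Subtype.ext h)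

theorem mk_eq_mk_iff {f g : Matrix Q.ι P.ι (MvPolynomial (Fin n) ℂ)} {hf hf' hg hg'} :
    (homMk f hf hf' : P ⟶ Q) = homMk g hg hg' ↔
      ∃ h, IsHomog a d (-1) P.toGrFree Q.toGrFree h ∧ g - f = Q.p * h + h * P.p :=
  quot_eq_iff

end mk

end HMF

/-! ## The shift functors -/

/-- The integer `m` such that `P^{t + k} = P^{s + 2m} = P^s(m d)`, where `t = s + k` in `ZMod 2`
(and `s, t` are represented by `0` or `1`). -/
def shiftIdx (s : ZMod 2) (k : ℤ) : ℤ :=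
  (((s + (k : ZMod 2)).val : ℤ) + k - s.val) / 2

theorem shiftIdx_spec (s : ZMod 2) (k : ℤ) :
    ((s + (k : ZMod 2)).val : ℤ) + k = s.val + 2 * shiftIdx s k := by
  have h : ((s + (k : ZMod 2)).val : ℤ) = ((s.val : ℤ) + k) % 2 := by
    have := ZMod.val_intCast (n := 2) ((s.val : ℤ) + k)
    push_cast at this
    rw [← this, ZMod.natCast_zmod_val]
  rw [shiftIdx, h]
  omega

theorem shiftIdx_zero (s : ZMod 2) : shiftIdx s 0 = 0 := by
  simp [shiftIdx]

theorem shiftIdx_add (s : ZMod 2) (k l : ℤ) :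
    shiftIdx s (k + l) = shiftIdx s k + shiftIdx (s + (k : ZMod 2)) l := by
  have h₁ := shiftIdx_spec s k
  have h₂ := shiftIdx_spec (s + (k : ZMod 2)) l
  have h₃ := shiftIdx_spec s (k + l)
  rw [show s + ((k + l : ℤ) : ZMod 2) = s + (k : ZMod 2) + (l : ZMod 2) by
    rw [Int.cast_add, add_assoc]] at h₃
  linarith

/-- `P[k]^t = P^{t + k}`, where `P^{s + 2m} = P^s(m d)`. -/
def GrFree.shift (d k : ℤ) (P : GrFree) : GrFree where
  ι := P.ι
  par i := P.par i + (k : ZMod 2)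
  deg i := P.deg i + shiftIdx (P.par i) k * d

/-- The grade shift `P(m)`. -/
def GrFree.twist (m : ℤ) (P : GrFree) : GrFree where
  ι := P.ι
  par := P.par
  deg i := P.deg i + m

/-- The direct sum. -/
def GrFree.sum (P Q : GrFree) : GrFree where
  ι := P.ι ⊕ Q.ι
  par := Sum.elim P.par Q.par
  deg := Sum.elim P.deg Q.deg

namespace IsHomog

variable {n : ℕ} {a : Fin n → ℤ} {d : ℤ} {k l : ℤ} {P Q R S : GrFree}

theorem shift_left {f : Matrix Q.ι P.ι (MvPolynomial (Fin n) ℂ)} (r : ℤ) (h : k + r = l) :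
    IsHomog a d l (P.shift d r) Q f ↔ IsHomog a d k P Q f := by
  refine forall_congr' fun j => forall_congr' fun i => ?_
  have hs := shiftIdx_spec (P.par i) r
  have hp : (P.shift d r).par i = P.par i + (r : ZMod 2) := rfl
  have hd : (P.shift d r).deg i = P.deg i + shiftIdx (P.par i) r * d := rfl
  rw [hp, hd]
  refine and_congr ⟨fun H m hm => ?_, fun H m hm => ?_⟩
    (imp_congr_left ⟨fun H m hm => ?_, fun H m hm => ?_⟩)
  · convert H (m + shiftIdx (P.par i) r) (by linarith) using 1; ring
  · convert H (m - shiftIdx (P.par i) r) (by linarith) using 1; ring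
  · exact H (m + shiftIdx (P.par i) r) (by linarith)
  · exact H (m - shiftIdx (P.par i) r) (by linarith)

theorem shift_right {f : Matrix Q.ι P.ι (MvPolynomial (Fin n) ℂ)} (r : ℤ) (h : l + r = k) :
    IsHomog a d l P (Q.shift d r) f ↔ IsHomog a d k P Q f := by
  refine forall_congr' fun j => forall_congr' fun i => ?_
  have hs := shiftIdx_spec (Q.par j) r
  have hp : (Q.shift d r).par j = Q.par j + (r : ZMod 2) := rfl
  have hd : (Q.shift d r).deg j = Q.deg j + shiftIdx (Q.par j) r * d := rfl
  rw [hp, hd]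
  refine and_congr ⟨fun H m hm => ?_, fun H m hm => ?_⟩
    (imp_congr_left ⟨fun H m hm => ?_, fun H m hm => ?_⟩)
  · convert H (m - shiftIdx (Q.par j) r) (by linarith) using 1; ring
  · convert H (m + shiftIdx (Q.par j) r) (by linarith) using 1; ring
  · exact H (m - shiftIdx (Q.par j) r) (by linarith)
  · exact H (m + shiftIdx (Q.par j) r) (by linarith)

theorem shift_shift {f : Matrix Q.ι P.ι (MvPolynomial (Fin n) ℂ)} (r : ℤ)
    (hf : IsHomog a d k P Q f) : IsHomog a d k (P.shift d r) (Q.shift d r) f :=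
  (shift_left r (k := k - r) (by ring)).2 ((shift_right r (by ring)).2 hf)

theorem twist_twist {f : Matrix Q.ι P.ι (MvPolynomial (Fin n) ℂ)} (r : ℤ)
    (hf : IsHomog a d k P Q f) : IsHomog a d k (P.twist r) (Q.twist r) f := fun j i =>
  ⟨fun m hm => by
    convert (hf j i).1 m hm using 1
    change (Q.deg j + r) + m * d - (P.deg i + r) = _
    ring, fun hm => (hf j i).2 hm⟩

theorem units_smul {f : Matrix Q.ι P.ι (MvPolynomial (Fin n) ℂ)} (u : ℤˣ)
    (hf : IsHomog a d k P Q f) : IsHomog a d k P Q (u • f) := by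
  rcases Int.units_eq_one_or u with rfl | rfl
  · rwa [one_smul]
  · rw [Units.neg_smul, one_smul]; exact hf.neg

theorem fromBlocks {A : Matrix R.ι P.ι (MvPolynomial (Fin n) ℂ)}
    {B : Matrix R.ι Q.ι (MvPolynomial (Fin n) ℂ)} {C : Matrix S.ι P.ι (MvPolynomial (Fin n) ℂ)}
    {D : Matrix S.ι Q.ι (MvPolynomial (Fin n) ℂ)}
    (hA : IsHomog a d k P R A) (hB : IsHomog a d k Q R B) (hC : IsHomog a d k P S C)
    (hD : IsHomog a d k Q S D) :
    IsHomog a d k (P.sum Q) (R.sum S) (Matrix.fromBlocks A B C D) := by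
  rintro (j | j) (i | i)
  exacts [hA j i, hB j i, hC j i, hD j i]

theorem fromRows {A : Matrix R.ι P.ι (MvPolynomial (Fin n) ℂ)}
    {C : Matrix S.ι P.ι (MvPolynomial (Fin n) ℂ)}
    (hA : IsHomog a d k P R A) (hC : IsHomog a d k P S C) :
    IsHomog a d k P (R.sum S) (Matrix.fromRows A C) := by
  rintro (j | j) i
  exacts [hA j i, hC j i]

theorem fromCols {A : Matrix R.ι P.ι (MvPolynomial (Fin n) ℂ)}
    {B : Matrix R.ι Q.ι (MvPolynomial (Fin n) ℂ)}
    (hA : IsHomog a d k P R A) (hB : IsHomog a d k Q R B) :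
    IsHomog a d k (P.sum Q) R (Matrix.fromCols A B) := by
  rintro j (i | i)
  exacts [hA j i, hB j i]

end IsHomog

namespace HMF

variable {n : ℕ} {a : Fin n → ℤ} {d : ℤ} {W : MvPolynomial (Fin n) ℂ}

/-- The object `P[k]`; for `k = 1` this is `P¹ → P⁰(d) → P¹(d)` with maps `-p¹` and `-p⁰(d)`. -/
def shiftObj (k : ℤ) (P : HMF a d W) : HMF a d W where
  toGrFree := P.toGrFree.shift d k
  p := (k.negOnePow • P.p : Matrix P.ι P.ι (MvPolynomial (Fin n) ℂ))
  p_homog := (P.p_homog.units_smul k.negOnePow).shift_shift k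
  p_mul_p := by
    refine Eq.trans ?_ P.p_mul_p
    change k.negOnePow • P.p * k.negOnePow • P.p = _
    rcases Int.units_eq_one_or k.negOnePow with h | h <;> rw [h] <;> simp

/-- The functor `P ↦ P[k]`. -/
def shiftFun (k : ℤ) : HMF a d W ⥤ HMF a d W where
  obj := shiftObj k
  map {P Q} := QuotientAddGroup.map (nullHomotopic P Q)
    (nullHomotopic (shiftObj k P) (shiftObj k Q))
    (AddMonoidHom.mk' (fun f : cocycles P Q => (⟨f.1, f.2.1.shift_shift k, by
        change f.1 * k.negOnePow • P.p = k.negOnePow • Q.p * f.1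
        rw [Matrix.mul_smul, Matrix.smul_mul, f.2.2]⟩ :
          cocycles (shiftObj k P) (shiftObj k Q))) fun _ _ => rfl)
    (by
      rintro f ⟨h, hh, hf⟩
      refine ⟨(k.negOnePow • h : Matrix Q.ι P.ι (MvPolynomial (Fin n) ℂ)),
        (hh.units_smul _).shift_shift k, ?_⟩
      change f.1 = k.negOnePow • Q.p * k.negOnePow • h + k.negOnePow • h * k.negOnePow • P.p
      rcases Int.units_eq_one_or k.negOnePow with h | h <;> rw [h] <;> simp [hf])
  map_id P := rfl
  map_comp f g := by
    obtain ⟨f, _, _, rfl⟩ := exists_mk f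
    obtain ⟨g, _, _, rfl⟩ := exists_mk g
    rfl

theorem shiftFun_map_mk {P Q : HMF a d W} (k : ℤ)
    {f : Matrix Q.ι P.ι (MvPolynomial (Fin n) ℂ)} (hf hf') :
    (shiftFun k).map (homMk f hf hf' : P ⟶ Q) = (homMk (P := shiftObj k P) (Q := shiftObj k Q) f
      (hf.shift_shift k) (by
        change f * k.negOnePow • P.p = k.negOnePow • Q.p * f
        rw [Matrix.mul_smul, Matrix.smul_mul, hf'])) := rfl

/-- Two factorizations with the same matrix, and with equal gradings, are isomorphic. -/
def isoOfEq (P : HMF a d W) (s : P.ι → ZMod 2) (t : P.ι → ℤ) (p h₁ h₂) (hs : P.par = s)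
    (ht : P.deg = t) (hp : P.p = p) : P ≅ ⟨⟨P.ι, s, t⟩, p, h₁, h₂⟩ where
  hom := homMk (1 : Matrix P.ι P.ι _) (IsHomog.one_of_eq hs ht) (by rw [hp]; simp)
  inv := homMk (1 : Matrix P.ι P.ι _) (IsHomog.one_of_eq hs.symm ht.symm) (by rw [hp]; simp)
  hom_inv_id := eq_of_val (Matrix.mul_one (1 : Matrix P.ι P.ι (MvPolynomial (Fin n) ℂ)))
  inv_hom_id := eq_of_val (Matrix.mul_one (1 : Matrix P.ι P.ι (MvPolynomial (Fin n) ℂ)))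

/-- The isomorphism `P[0] ≅ P`. -/
def shiftZero : shiftFun (a := a) (d := d) (W := W) 0 ≅ 𝟭 _ :=
  NatIso.ofComponents (fun P => isoOfEq (shiftObj 0 P) P.par P.deg P.p P.p_homog P.p_mul_p
    (by funext i; simp [shiftObj, GrFree.shift])
    (by funext i; simp [shiftObj, GrFree.shift, shiftIdx_zero])
    (by
      change (0 : ℤ).negOnePow • P.p = P.p
      rw [Int.negOnePow_zero, one_smul])) (fun {P Q} f => by
      obtain ⟨f, _, _, rfl⟩ := exists_mk f
      refine eq_of_val ?_
      exact (Matrix.one_mul f).trans (Matrix.mul_one f).symm)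

/-- The isomorphism `P[k + l] ≅ P[k][l]`. -/
def shiftAdd (k l : ℤ) : shiftFun (a := a) (d := d) (W := W) (k + l) ≅ shiftFun k ⋙ shiftFun l :=
  NatIso.ofComponents (fun P => isoOfEq (shiftObj (k + l) P)
    (shiftObj l (shiftObj k P)).par (shiftObj l (shiftObj k P)).deg (shiftObj l (shiftObj k P)).p
    (shiftObj l (shiftObj k P)).p_homog (shiftObj l (shiftObj k P)).p_mul_p
    (by funext i; simp [shiftObj, GrFree.shift, add_assoc])
    (by funext i; simp [shiftObj, GrFree.shift, shiftIdx_add, add_mul, add_assoc])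
    (by
      change (k + l).negOnePow • P.p = l.negOnePow • k.negOnePow • P.p
      rw [smul_smul, add_comm, Int.negOnePow_add])) (fun {P Q} f => by
      obtain ⟨f, _, _, rfl⟩ := exists_mk f
      refine eq_of_val ?_
      exact (Matrix.one_mul f).trans (Matrix.mul_one f).symm)

/-- A morphism represented by the identity matrix of the common index type. -/
theorem eqToHom_shiftFun {k l : ℤ} (P : HMF a d W) (h : k = l)
    (h' : (shiftFun k).obj P = (shiftFun l).obj P) :
    ∃ h₁ h₂, eqToHom h' = homMk (P := shiftObj k P) (Q := shiftObj l P)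
      (1 : Matrix P.ι P.ι _) h₁ h₂ := by
  subst h
  exact ⟨IsHomog.one, (Matrix.one_mul (shiftObj k P).p).trans (Matrix.mul_one (shiftObj k P).p).symm, rfl⟩

/-- The data defining the action of `ℤ` on `HMF^gr(W)` by shifts. -/
def shiftMkCore : ShiftMkCore (HMF a d W) ℤ where
  F := shiftFun
  zero := shiftZero
  add := shiftAdd
  assoc_hom_app k l m P := by
    obtain ⟨h₁, h₂, e⟩ := eqToHom_shiftFun P (add_assoc k l m) (by rw [add_assoc])
    rw [e]
    refine eq_of_val ?_
    exact (Matrix.mul_one ((1 : Matrix P.ι P.ι (MvPolynomial (Fin n) ℂ)) *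
      (1 : Matrix P.ι P.ι (MvPolynomial (Fin n) ℂ)))).symm
  zero_add_hom_app k P := by
    obtain ⟨h₁, h₂, e⟩ := eqToHom_shiftFun P (zero_add k) (by rw [zero_add])
    rw [e]
    refine eq_of_val ?_
    exact (Matrix.mul_one (1 : Matrix P.ι P.ι (MvPolynomial (Fin n) ℂ))).symm
  add_zero_hom_app k P := by
    obtain ⟨h₁, h₂, e⟩ := eqToHom_shiftFun P (add_zero k) (by rw [add_zero])
    rw [e]
    refine eq_of_val ?_
    exact (Matrix.mul_one (1 : Matrix P.ι P.ι (MvPolynomial (Fin n) ℂ))).symm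

instance : HasShift (HMF a d W) ℤ := hasShiftMk _ _ shiftMkCore

instance (k : ℤ) : (shiftFunctor (HMF a d W) k).Additive where
  map_add {P Q f g} := by
    obtain ⟨f, _, _, rfl⟩ := exists_mk f
    obtain ⟨g, _, _, rfl⟩ := exists_mk g
    rfl

end HMF
/-! ## Mapping cones and distinguished triangles -/

namespace HMF

variable {n : ℕ} {a : Fin n → ℤ} {d : ℤ} {W : MvPolynomial (Fin n) ℂ}

theorem shiftObj_p (k : ℤ) (P : HMF a d W) : (shiftObj k P).p = k.negOnePow • P.p := rfl

theorem shiftObj_one_p (P : HMF a d W) : (shiftObj 1 P).p = -P.p := by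
  rw [shiftObj_p, Int.negOnePow_one, Units.neg_smul, one_smul]

theorem shiftObj_neg_one_p (P : HMF a d W) : (shiftObj (-1) P).p = -P.p := by
  rw [shiftObj_p, Int.negOnePow_neg, Int.negOnePow_one, Units.neg_smul, one_smul]

/-- An isomorphism given by mutually inverse matrices. -/
def mkIso {P Q : HMF a d W} (f : Matrix Q.ι P.ι (MvPolynomial (Fin n) ℂ))
    (g : Matrix P.ι Q.ι (MvPolynomial (Fin n) ℂ)) (hf : IsHomog a d 0 P.toGrFree Q.toGrFree f)
    (hf' : f * P.p = Q.p * f) (hg : IsHomog a d 0 Q.toGrFree P.toGrFree g)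
    (hg' : g * Q.p = P.p * g) (h₁ : g * f = 1) (h₂ : f * g = 1) : P ≅ Q where
  hom := homMk f hf hf'
  inv := homMk g hg hg'
  hom_inv_id := eq_of_val h₁
  inv_hom_id := eq_of_val h₂

instance : HasZeroObject (HMF a d W) := by
  let Z : HMF a d W := ⟨⟨Empty, Empty.elim, Empty.elim⟩, 0, IsHomog.zero, Subsingleton.elim _ _⟩
  refine ⟨Z, (IsZero.iff_id_eq_zero Z).2 
    (eq_of_val ?_)⟩
  exact Subsingleton.elim (α := Matrix Empty Empty (MvPolynomial (Fin n) ℂ)) _ _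

section cone

variable {P Q : HMF a d W} (f : Matrix Q.ι P.ι (MvPolynomial (Fin n) ℂ))
  (hf : IsHomog a d 0 P.toGrFree Q.toGrFree f) (hc : f * P.p = Q.p * f)

/-- The mapping cone `Q ⊕ P[1]` of a morphism `f : P → Q`. -/
def cone : HMF a d W where
  toGrFree := Q.toGrFree.sum (P.toGrFree.shift d 1)
  p := (Matrix.fromBlocks Q.p f 0 (-P.p) : Matrix (Q.ι ⊕ P.ι) (Q.ι ⊕ P.ι) (MvPolynomial (Fin n) ℂ))
  p_homog := IsHomog.fromBlocks (P := Q.toGrFree) (Q := P.toGrFree.shift d 1) (R := Q.toGrFree)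
    (S := P.toGrFree.shift d 1) Q.p_homog ((IsHomog.shift_left 1 (by norm_num)).2 hf) IsHomog.zero
    (P.p_homog.neg.shift_shift 1)
  p_mul_p := by
    have : (Matrix.fromBlocks Q.p f 0 (-P.p) : Matrix (Q.ι ⊕ P.ι) (Q.ι ⊕ P.ι) (MvPolynomial (Fin n) ℂ)) *
        (Matrix.fromBlocks Q.p f 0 (-P.p) : Matrix (Q.ι ⊕ P.ι) (Q.ι ⊕ P.ι) (MvPolynomial (Fin n) ℂ)) =
        W • (1 : Matrix (Q.ι ⊕ P.ι) (Q.ι ⊕ P.ι) (MvPolynomial (Fin n) ℂ)) := by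
      rw [Matrix.fromBlocks_multiply, ← Matrix.fromBlocks_one, Matrix.fromBlocks_smul]
      simp [P.p_mul_p, Q.p_mul_p, hc]
    exact this

theorem cone_p : (cone f hf hc).p =
    (Matrix.fromBlocks Q.p f 0 (-P.p) : Matrix (Q.ι ⊕ P.ι) (Q.ι ⊕ P.ι) (MvPolynomial (Fin n) ℂ)) := rfl

/-- The inclusion `Q → cone f`. -/
def coneInl : Q ⟶ cone f hf hc :=
  homMk (Matrix.fromRows 1 0 : Matrix (Q.ι ⊕ P.ι) Q.ι (MvPolynomial (Fin n) ℂ))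
    (IsHomog.fromRows (R := Q.toGrFree) (S := P.toGrFree.shift d 1) IsHomog.one IsHomog.zero)
    (by
      have : (Matrix.fromRows 1 0 : Matrix (Q.ι ⊕ P.ι) Q.ι (MvPolynomial (Fin n) ℂ)) * Q.p =
          (Matrix.fromBlocks Q.p f 0 (-P.p) : Matrix (Q.ι ⊕ P.ι) (Q.ι ⊕ P.ι) (MvPolynomial (Fin n) ℂ)) *
          (Matrix.fromRows 1 0 : Matrix (Q.ι ⊕ P.ι) Q.ι (MvPolynomial (Fin n) ℂ)) := by
        rw [Matrix.fromRows_mul, Matrix.fromBlocks_mul_fromRows]; simp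
      exact this)

/-- The projection `cone f → P[1]`. -/
def coneSnd : cone f hf hc ⟶ (shiftFunctor (HMF a d W) (1 : ℤ)).obj P :=
  homMk (P := cone f hf hc) (Q := shiftObj 1 P) (Matrix.fromCols 0 1 : Matrix P.ι (Q.ι ⊕ P.ι) (MvPolynomial (Fin n) ℂ))
    (IsHomog.fromCols (P := Q.toGrFree) (Q := P.toGrFree.shift d 1) IsHomog.zero
      IsHomog.one)
    (by
      have : (Matrix.fromCols 0 1 : Matrix P.ι (Q.ι ⊕ P.ι) (MvPolynomial (Fin n) ℂ)) *
          (Matrix.fromBlocks Q.p f 0 (-P.p) : Matrix (Q.ι ⊕ P.ι) (Q.ι ⊕ P.ι) (MvPolynomial (Fin n) ℂ)) =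
          -P.p * (Matrix.fromCols 0 1 : Matrix P.ι (Q.ι ⊕ P.ι) (MvPolynomial (Fin n) ℂ)) := by
        rw [Matrix.mul_fromCols, Matrix.fromCols_mul_fromBlocks]; simp
      rw [shiftObj_one_p]
      exact this)

/-- The triangle `P → Q → cone f → P[1]`. -/
def coneTriangle : Pretriangulated.Triangle (HMF a d W) :=
  Pretriangulated.Triangle.mk (homMk f hf hc) (coneInl f hf hc) (coneSnd f hf hc)

end cone

/-- The distinguished triangles: those isomorphic to the triangle of a mapping cone. -/
def distTriangles : Set (Pretriangulated.Triangle (HMF a d W)) :=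
  {T | ∃ (P Q : HMF a d W) (f : Matrix Q.ι P.ι (MvPolynomial (Fin n) ℂ)) (hf : _) (hc : _),
    Nonempty (T ≅ coneTriangle (P := P) (Q := Q) f hf hc)}

theorem isZero_cone_one (P : HMF a d W) :
    IsZero (cone (P := P) (Q := P) 1 IsHomog.one (by simp)) := by
  rw [IsZero.iff_id_eq_zero]
  refine eq_of_homotopy (Matrix.fromBlocks 0 0 (-1) 0 :
    Matrix (P.ι ⊕ P.ι) (P.ι ⊕ P.ι) (MvPolynomial (Fin n) ℂ)) ?_ ?_
  · refine IsHomog.fromBlocks (P := P.toGrFree) (Q := P.toGrFree.shift d 1) (R := P.toGrFree)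
      (S := P.toGrFree.shift d 1) IsHomog.zero IsHomog.zero ?_ IsHomog.zero
    exact (IsHomog.shift_right 1 (by norm_num)).2 IsHomog.one.neg
  · rw [cone_p]
    change (0 : Matrix (P.ι ⊕ P.ι) (P.ι ⊕ P.ι) (MvPolynomial (Fin n) ℂ)) - (1 : Matrix (P.ι ⊕ P.ι) (P.ι ⊕ P.ι) (MvPolynomial (Fin n) ℂ)) =
      (Matrix.fromBlocks P.p 1 0 (-P.p) : Matrix (P.ι ⊕ P.ι) (P.ι ⊕ P.ι) (MvPolynomial (Fin n) ℂ)) *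
        (Matrix.fromBlocks 0 0 (-1) 0 : Matrix (P.ι ⊕ P.ι) (P.ι ⊕ P.ι) (MvPolynomial (Fin n) ℂ)) +
      (Matrix.fromBlocks 0 0 (-1) 0 : Matrix (P.ι ⊕ P.ι) (P.ι ⊕ P.ι) (MvPolynomial (Fin n) ℂ)) *
        (Matrix.fromBlocks P.p 1 0 (-P.p) : Matrix (P.ι ⊕ P.ι) (P.ι ⊕ P.ι) (MvPolynomial (Fin n) ℂ))
    rw [Matrix.fromBlocks_multiply, Matrix.fromBlocks_multiply, Matrix.fromBlocks_add, zero_sub,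
      ← Matrix.fromBlocks_one, Matrix.fromBlocks_neg]
    simp

theorem contractible_mem (P : HMF a d W) :
    Pretriangulated.contractibleTriangle P ∈ distTriangles := by
  refine ⟨P, P, 1, IsHomog.one, by simp, ⟨?_⟩⟩
  have h := isZero_cone_one P
  exact Pretriangulated.Triangle.isoMk _ _ (Iso.refl _) (Iso.refl _) h.isoZero.symm
    (by exact (Category.comp_id _).trans (Category.id_comp _).symm) (h.eq_of_tgt _ _)
    ((isZero_zero _).eq_of_src _ _)

theorem exists_cone (P Q : HMF a d W) (f : P ⟶ Q) :
    ∃ (R : HMF a d W) (g : Q ⟶ R) (h : R ⟶ (shiftFunctor (HMF a d W) (1 : ℤ)).obj P),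
      Pretriangulated.Triangle.mk f g h ∈ distTriangles (a := a) (d := d) (W := W) := by
  obtain ⟨f, hf, hc, rfl⟩ := exists_mk f
  exact ⟨_, _, _, P, Q, f, hf, hc, ⟨Iso.refl _⟩⟩

end HMF
namespace HMF

section BlockMatrices

variable {R ι κ : Type*} [CommRing R] [Fintype ι] [Fintype κ] [DecidableEq ι] [DecidableEq κ]

theorem fromRows_add {l m o : Type*} (A B : Matrix l o R) (C D : Matrix m o R) :
    Matrix.fromRows A C + Matrix.fromRows B D = Matrix.fromRows (A + B) (C + D) := by
  ext (i | i) j <;> rfl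

theorem fromCols_add {l m o : Type*} (A B : Matrix o l R) (C D : Matrix o m R) :
    Matrix.fromCols A C + Matrix.fromCols B D = Matrix.fromCols (A + B) (C + D) := by
  ext i (j | j) <;> rfl

/-- The matrix of the mapping cone. -/
abbrev bCone (q : Matrix κ κ R) (f : Matrix κ ι R) (p : Matrix ι ι R) :
    Matrix (κ ⊕ ι) (κ ⊕ ι) R :=
  Matrix.fromBlocks q f 0 (-p)

variable (R ι κ) in
/-- The matrix of the inclusion into the mapping cone. -/
abbrev bInl : Matrix (κ ⊕ ι) κ R := Matrix.fromRows 1 0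

variable (R ι κ) in
/-- The matrix of the projection from the mapping cone. -/
abbrev bSnd : Matrix ι (κ ⊕ ι) R := Matrix.fromCols 0 1

/-- The matrix of the comparison map `P[1] → cone (Q → cone f)`. -/
abbrev bTheta (f : Matrix κ ι R) : Matrix ((κ ⊕ ι) ⊕ κ) ι R :=
  Matrix.fromRows (Matrix.fromRows 0 1) (-f)

variable (R ι κ) in
/-- The matrix of the comparison map `cone (Q → cone f) → P[1]`. -/
abbrev bTheta' : Matrix ι ((κ ⊕ ι) ⊕ κ) R :=
  Matrix.fromCols (bSnd R ι κ) 0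

variable (R ι κ) in
/-- The matrix of a homotopy on `cone (Q → cone f)`. -/
abbrev bHtpy : Matrix ((κ ⊕ ι) ⊕ κ) ((κ ⊕ ι) ⊕ κ) R :=
  Matrix.fromBlocks 0 0 (Matrix.fromCols 1 0) 0

variable (R ι κ) in
/-- The matrix of a homotopy from `cone f` to `cone (Q → cone f)`. -/
abbrev bHtpy' : Matrix ((κ ⊕ ι) ⊕ κ) (κ ⊕ ι) R :=
  Matrix.fromRows 0 (Matrix.fromCols 1 0)

variable (q : Matrix κ κ R) (f : Matrix κ ι R) (p : Matrix ι ι R)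

theorem block₁ (hc : f * p = q * f) :
    bTheta f * (-p) = bCone (bCone q f p) (bInl R ι κ) q * bTheta f := by
  ext ((i | i) | i) j <;>
  simp [Matrix.mul_apply, Fintype.sum_sum_type, Matrix.one_apply]
  have := congrFun (congrFun hc i) j
  simpa [Matrix.mul_apply] using this

theorem block₂ :
    bTheta' R ι κ * bCone (bCone q f p) (bInl R ι κ) q = -p * bTheta' R ι κ := by
  ext i ((j | j) | j) <;>
  simp [Matrix.mul_apply, Fintype.sum_sum_type, Matrix.one_apply]

theorem block₃ : bTheta' R ι κ * bTheta f = 1 := by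
  ext i j
  simp [Matrix.mul_apply, Fintype.sum_sum_type, Matrix.one_apply]

theorem block₄ : 1 - bTheta f * bTheta' R ι κ =
    bCone (bCone q f p) (bInl R ι κ) q * bHtpy R ι κ +
      bHtpy R ι κ * bCone (bCone q f p) (bInl R ι κ) q := by
  ext ((i | i) | i) ((j | j) | j) <;>
  simp [Matrix.mul_apply, Fintype.sum_sum_type, Matrix.one_apply]

theorem block₅ : bTheta f * bSnd R ι κ - Matrix.fromRows 1 0 =
    bCone (bCone q f p) (bInl R ι κ) q * (-bHtpy' R ι κ) +
      (-bHtpy' R ι κ) * bCone q f p := by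
  ext ((i | i) | i) (j | j) <;>
  simp [Matrix.mul_apply, Fintype.sum_sum_type, Matrix.one_apply]

end BlockMatrices

end HMF
namespace HMF

open Pretriangulated

variable {n : ℕ} {a : Fin n → ℤ} {d : ℤ} {W : MvPolynomial (Fin n) ℂ}

section

variable {P Q : HMF a d W} (f : Matrix Q.ι P.ι (MvPolynomial (Fin n) ℂ))
  (hf : IsHomog a d 0 P.toGrFree Q.toGrFree f) (hc : f * P.p = Q.p * f)

theorem inl_homog : IsHomog a d 0 Q.toGrFree (cone f hf hc).toGrFree
    (bInl (MvPolynomial (Fin n) ℂ) P.ι Q.ι) :=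
  IsHomog.fromRows (R := Q.toGrFree) (S := P.toGrFree.shift d 1) IsHomog.one IsHomog.zero

theorem inl_comm : bInl (MvPolynomial (Fin n) ℂ) P.ι Q.ι * Q.p =
    bCone Q.p f P.p * bInl (MvPolynomial (Fin n) ℂ) P.ι Q.ι := by
  rw [Matrix.fromRows_mul, Matrix.fromBlocks_mul_fromRows]; simp

/-- The isomorphism `P[1] ≅ cone (Q → cone f)`. -/
def thetaIso : shiftObj 1 P ≅ cone (P := Q) (Q := cone f hf hc)
    (bInl (MvPolynomial (Fin n) ℂ) P.ι Q.ι) (inl_homog f hf hc) (inl_comm f) where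
  hom := homMk (P := shiftObj 1 P) (Q := cone (P := Q) (Q := cone f hf hc)
      (bInl (MvPolynomial (Fin n) ℂ) P.ι Q.ι) (inl_homog f hf hc) (inl_comm f)) (bTheta f)
    (IsHomog.fromRows (P := P.toGrFree.shift d 1)
      (R := Q.toGrFree.sum (P.toGrFree.shift d 1)) (S := Q.toGrFree.shift d 1)
      (IsHomog.fromRows (R := Q.toGrFree) (S := P.toGrFree.shift d 1) IsHomog.zero
        IsHomog.one) (hf.neg.shift_shift 1))
    (by rw [shiftObj_one_p]; exact block₁ Q.p f P.p hc)
  inv := homMk (Q := shiftObj 1 P) (P := cone (P := Q) (Q := cone f hf hc)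
      (bInl (MvPolynomial (Fin n) ℂ) P.ι Q.ι) (inl_homog f hf hc) (inl_comm f))
    (bTheta' (MvPolynomial (Fin n) ℂ) P.ι Q.ι)
    (IsHomog.fromCols (R := P.toGrFree.shift d 1)
      (P := Q.toGrFree.sum (P.toGrFree.shift d 1)) (Q := Q.toGrFree.shift d 1)
      (IsHomog.fromCols (P := Q.toGrFree) (Q := P.toGrFree.shift d 1) IsHomog.zero
        IsHomog.one) IsHomog.zero)
    (by rw [shiftObj_one_p]; exact block₂ Q.p f P.p)
  hom_inv_id := eq_of_val (block₃ f)
  inv_hom_id := eq_of_homotopy (bHtpy (MvPolynomial (Fin n) ℂ) P.ι Q.ι)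
    (IsHomog.fromBlocks (P := Q.toGrFree.sum (P.toGrFree.shift d 1)) (Q := Q.toGrFree.shift d 1)
      (R := Q.toGrFree.sum (P.toGrFree.shift d 1)) (S := Q.toGrFree.shift d 1)
      IsHomog.zero IsHomog.zero (IsHomog.fromCols (P := Q.toGrFree) (Q := P.toGrFree.shift d 1)
        ((IsHomog.shift_right 1 (by norm_num)).2 IsHomog.one) IsHomog.zero) IsHomog.zero)
    (block₄ Q.p f P.p)

/-- The rotation of the triangle of a mapping cone is the triangle of a mapping cone. -/
def rotateIso : (coneTriangle f hf hc).rotate ≅ coneTriangle (P := Q) (Q := cone f hf hc)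
    (bInl (MvPolynomial (Fin n) ℂ) P.ι Q.ι) (inl_homog f hf hc) (inl_comm f) :=
  Triangle.isoMk _ _ (Iso.refl _) (Iso.refl _) (thetaIso f hf hc)
    ((Category.comp_id _).trans (Category.id_comp _).symm)
    (by
      refine Eq.trans ?_ (Category.id_comp _).symm
      refine (eq_of_homotopy (-bHtpy' (MvPolynomial (Fin n) ℂ) P.ι Q.ι) ?_
        (block₅ Q.p f P.p)).symm
      exact (IsHomog.fromRows (P := Q.toGrFree.sum (P.toGrFree.shift d 1))
        (R := Q.toGrFree.sum (P.toGrFree.shift d 1)) (S := Q.toGrFree.shift d 1) IsHomog.zero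
        (IsHomog.fromCols (P := Q.toGrFree) (Q := P.toGrFree.shift d 1)
          ((IsHomog.shift_right 1 (by norm_num)).2 IsHomog.one) IsHomog.zero)).neg)
    (by
      change (-(shiftFunctor (HMF a d W) (1 : ℤ)).map (homMk f hf hc)) ≫
        (shiftFunctor (HMF a d W) (1 : ℤ)).map (𝟙 Q) = _
      refine (congrArg (_ ≫ ·) ((shiftFunctor (HMF a d W) (1 : ℤ)).map_id Q)).trans ?_
      refine (Category.comp_id _).trans ?_
      refine eq_of_val ?_
      change -f = bSnd (MvPolynomial (Fin n) ℂ) Q.ι (Q.ι ⊕ P.ι) * bTheta f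
      rw [Matrix.fromCols_mul_fromRows]
      simp)

end

theorem shiftFunctorComm_hom_app (k l : ℤ) (P : HMF a d W) :
    ∃ h₁ h₂, (shiftFunctorComm (HMF a d W) k l).hom.app P =
      homMk (P := shiftObj l (shiftObj k P)) (Q := shiftObj k (shiftObj l P))
        (1 : Matrix P.ι P.ι (MvPolynomial (Fin n) ℂ)) h₁ h₂ := by
  have h₁ : IsHomog a d 0 (shiftObj l (shiftObj k P)).toGrFree
      (shiftObj k (shiftObj l P)).toGrFree (1 : Matrix P.ι P.ι (MvPolynomial (Fin n) ℂ)) :=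
    (IsHomog.shift_left l (k := -l) (by ring)).2 ((IsHomog.shift_left k (k := -k - l) (by ring)).2
      ((IsHomog.shift_right k (k := -l) (by ring)).2
        ((IsHomog.shift_right l (k := 0) (by ring)).2 IsHomog.one)))
  have h₂ : (1 : Matrix P.ι P.ι (MvPolynomial (Fin n) ℂ)) * (l.negOnePow • k.negOnePow • P.p) =
      (k.negOnePow • l.negOnePow • P.p) * (1 : Matrix P.ι P.ι (MvPolynomial (Fin n) ℂ)) := by
    rw [Matrix.one_mul, Matrix.mul_one, smul_comm]
  refine ⟨h₁, h₂, ?_⟩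
  obtain ⟨h₃, h₄, e⟩ := eqToHom_shiftFun P (add_comm k l) (by rw [add_comm])
  have h : shiftFun (a := a) (d := d) (W := W) (k + l) = shiftFun (l + k) := by rw [add_comm]
  have e' : (eqToIso h).hom.app P = homMk (P := shiftObj (k + l) P) (Q := shiftObj (l + k) P)
      (1 : Matrix P.ι P.ι (MvPolynomial (Fin n) ℂ)) h₃ h₄ := by
    rw [eqToIso.hom, eqToHom_app]; exact e
  refine (congrArg (fun t => (shiftAdd k l).inv.app P ≫ t ≫ (shiftAdd l k).hom.app P) e').trans ?_
  refine eq_of_val ?_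
  change ((1 : Matrix P.ι P.ι (MvPolynomial (Fin n) ℂ)) * (1 : Matrix P.ι P.ι (MvPolynomial (Fin n) ℂ))) *
    (1 : Matrix P.ι P.ι (MvPolynomial (Fin n) ℂ)) = (1 : Matrix P.ι P.ι (MvPolynomial (Fin n) ℂ))
  rw [Matrix.one_mul, Matrix.one_mul]

theorem neg_shift_comm {P Q : HMF a d W} (f : Matrix Q.ι P.ι (MvPolynomial (Fin n) ℂ))
    (hc : f * P.p = Q.p * f) :
    f * ((-1 : ℤ).negOnePow • P.p) = ((-1 : ℤ).negOnePow • Q.p) * f := by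
  rw [Matrix.mul_smul, Matrix.smul_mul, hc]

section

variable {P Q : HMF a d W} (f : Matrix Q.ι P.ι (MvPolynomial (Fin n) ℂ))
  (hf : IsHomog a d 0 P.toGrFree Q.toGrFree f) (hc : f * P.p = Q.p * f)

/-- The automorphism `-1`. -/
def negIso (P : HMF a d W) : P ≅ P where
  hom := -𝟙 P
  inv := -𝟙 P

/-- The isomorphism `cone (f[-1]) ≅ (cone f)[-1]`. -/
def coneShiftIso : cone (P := shiftObj (-1) P) (Q := shiftObj (-1) Q) f (hf.shift_shift (-1))
    (neg_shift_comm f hc) ≅ shiftObj (-1) (cone f hf hc) := by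
  have h₀ : (Matrix.fromBlocks 1 0 0 (-1) : Matrix (Q.ι ⊕ P.ι) (Q.ι ⊕ P.ι) (MvPolynomial (Fin n) ℂ)) *
      (Matrix.fromBlocks 1 0 0 (-1) : Matrix (Q.ι ⊕ P.ι) (Q.ι ⊕ P.ι) (MvPolynomial (Fin n) ℂ)) = 1 := by
    rw [Matrix.fromBlocks_multiply, ← Matrix.fromBlocks_one]; simp
  have h₁ : IsHomog a d 0 ((P.toGrFree.shift d (-1)).shift d 1)
      ((P.toGrFree.shift d 1).shift d (-1)) (-1 : Matrix P.ι P.ι (MvPolynomial (Fin n) ℂ)) :=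
    (IsHomog.shift_left 1 (k := -1) (by norm_num)).2
      ((IsHomog.shift_left (-1) (k := 0) (by norm_num)).2
        ((IsHomog.shift_right (-1) (k := -1) (by norm_num)).2
          ((IsHomog.shift_right 1 (k := 0) (by norm_num)).2 IsHomog.one.neg)))
  have h₁' : IsHomog a d 0 ((P.toGrFree.shift d 1).shift d (-1))
      ((P.toGrFree.shift d (-1)).shift d 1) (-1 : Matrix P.ι P.ι (MvPolynomial (Fin n) ℂ)) :=
    (IsHomog.shift_left (-1) (k := 1) (by norm_num)).2
      ((IsHomog.shift_left 1 (k := 0) (by norm_num)).2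
        ((IsHomog.shift_right 1 (k := 1) (by norm_num)).2
          ((IsHomog.shift_right (-1) (k := 0) (by norm_num)).2 IsHomog.one.neg)))
  have h₂ : IsHomog a d 0 (Q.toGrFree.shift d (-1)) (Q.toGrFree.shift d (-1))
      (1 : Matrix Q.ι Q.ι (MvPolynomial (Fin n) ℂ)) := IsHomog.one.shift_shift (-1)
  have hp : (cone (P := shiftObj (-1) P) (Q := shiftObj (-1) Q) f (hf.shift_shift (-1))
      (neg_shift_comm f hc)).p = (Matrix.fromBlocks (-Q.p) f 0 P.p :
        Matrix (Q.ι ⊕ P.ι) (Q.ι ⊕ P.ι) (MvPolynomial (Fin n) ℂ)) := by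
    refine (cone_p _ _ _).trans ?_
    rw [shiftObj_neg_one_p, shiftObj_neg_one_p]
    change Matrix.fromBlocks (-Q.p) f 0 (- -P.p) = _
    rw [neg_neg]
  have hp' : (shiftObj (-1) (cone f hf hc)).p = (Matrix.fromBlocks (-Q.p) (-f) 0 P.p :
        Matrix (Q.ι ⊕ P.ι) (Q.ι ⊕ P.ι) (MvPolynomial (Fin n) ℂ)) := by
    rw [shiftObj_neg_one_p, cone_p]
    refine (Matrix.fromBlocks_neg _ _ _ _).trans ?_
    rw [neg_neg, neg_zero]
  refine mkIso (P := cone (P := shiftObj (-1) P) (Q := shiftObj (-1) Q) f (hf.shift_shift (-1))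
      (neg_shift_comm f hc)) (Q := shiftObj (-1) (cone f hf hc))
    (Matrix.fromBlocks 1 0 0 (-1) : Matrix (Q.ι ⊕ P.ι) (Q.ι ⊕ P.ι) (MvPolynomial (Fin n) ℂ))
    (Matrix.fromBlocks 1 0 0 (-1) : Matrix (Q.ι ⊕ P.ι) (Q.ι ⊕ P.ι) (MvPolynomial (Fin n) ℂ))
    ?_ ?_ ?_ ?_ h₀ h₀
  · rintro (j | j) (i | i)
    exacts [h₂ j i, IsHomog.zero (P := (P.toGrFree.shift d (-1)).shift d 1)
        (Q := Q.toGrFree.shift d (-1)) j i,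
      IsHomog.zero (P := Q.toGrFree.shift d (-1)) (Q := (P.toGrFree.shift d 1).shift d (-1)) j i,
      h₁ j i]
  · rw [hp, hp']
    change (Matrix.fromBlocks 1 0 0 (-1) :
        Matrix (Q.ι ⊕ P.ι) (Q.ι ⊕ P.ι) (MvPolynomial (Fin n) ℂ)) *
      (Matrix.fromBlocks (-Q.p) f 0 P.p :
        Matrix (Q.ι ⊕ P.ι) (Q.ι ⊕ P.ι) (MvPolynomial (Fin n) ℂ)) =
      (Matrix.fromBlocks (-Q.p) (-f) 0 P.p :
        Matrix (Q.ι ⊕ P.ι) (Q.ι ⊕ P.ι) (MvPolynomial (Fin n) ℂ)) *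
      (Matrix.fromBlocks 1 0 0 (-1) :
        Matrix (Q.ι ⊕ P.ι) (Q.ι ⊕ P.ι) (MvPolynomial (Fin n) ℂ))
    rw [Matrix.fromBlocks_multiply, Matrix.fromBlocks_multiply]
    simp
  · rintro (j | j) (i | i)
    exacts [h₂ j i, IsHomog.zero (P := (P.toGrFree.shift d 1).shift d (-1))
        (Q := Q.toGrFree.shift d (-1)) j i,
      IsHomog.zero (P := Q.toGrFree.shift d (-1)) (Q := (P.toGrFree.shift d (-1)).shift d 1) j i,
      h₁' j i]
  · rw [hp, hp']
    change (Matrix.fromBlocks 1 0 0 (-1) :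
        Matrix (Q.ι ⊕ P.ι) (Q.ι ⊕ P.ι) (MvPolynomial (Fin n) ℂ)) *
      (Matrix.fromBlocks (-Q.p) (-f) 0 P.p :
        Matrix (Q.ι ⊕ P.ι) (Q.ι ⊕ P.ι) (MvPolynomial (Fin n) ℂ)) =
      (Matrix.fromBlocks (-Q.p) f 0 P.p :
        Matrix (Q.ι ⊕ P.ι) (Q.ι ⊕ P.ι) (MvPolynomial (Fin n) ℂ)) *
      (Matrix.fromBlocks 1 0 0 (-1) :
        Matrix (Q.ι ⊕ P.ι) (Q.ι ⊕ P.ι) (MvPolynomial (Fin n) ℂ))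
    rw [Matrix.fromBlocks_multiply, Matrix.fromBlocks_multiply]
    simp

/-- The shift by `-1` of the triangle of a mapping cone is the triangle of a mapping cone. -/
def shiftTriangleIso : coneTriangle (P := shiftObj (-1) P) (Q := shiftObj (-1) Q) f
    (hf.shift_shift (-1)) (neg_shift_comm f hc) ≅
      (Triangle.shiftFunctor (HMF a d W) (-1)).obj (coneTriangle f hf hc) := by
  have hn : (-1 : ℤ).negOnePow = -1 := by rw [Int.negOnePow_neg, Int.negOnePow_one]
  refine Triangle.isoMk _ _ (Iso.refl _) (negIso _) (coneShiftIso f hf hc) ?_ ?_ ?_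
  · refine Eq.trans ?_ (Category.id_comp _).symm
    change homMk (P := shiftObj (-1) P) (Q := shiftObj (-1) Q) f
      (hf.shift_shift (-1)) (neg_shift_comm f hc) ≫ (-𝟙 _) =
      (-1 : ℤ).negOnePow • (shiftFun (-1)).map (homMk f hf hc)
    rw [hn, Units.neg_smul, one_smul, Preadditive.comp_neg, Category.comp_id]
    rfl
  · change coneInl _ _ _ ≫ (coneShiftIso f hf hc).hom =
      (-𝟙 _) ≫ ((-1 : ℤ).negOnePow • (shiftFun (-1)).map (coneInl f hf hc))
    rw [hn, Units.neg_smul, one_smul, Preadditive.neg_comp, Preadditive.comp_neg, neg_neg,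
      Category.id_comp]
    refine eq_of_val ?_
    change (Matrix.fromBlocks 1 0 0 (-1) :
        Matrix (Q.ι ⊕ P.ι) (Q.ι ⊕ P.ι) (MvPolynomial (Fin n) ℂ)) *
      bInl (MvPolynomial (Fin n) ℂ) P.ι Q.ι = bInl (MvPolynomial (Fin n) ℂ) P.ι Q.ι
    rw [Matrix.fromBlocks_mul_fromRows]
    simp
  · obtain ⟨h₁, h₂, e⟩ := shiftFunctorComm_hom_app 1 (-1) P
    change coneSnd _ _ _ ≫ (shiftFunctor (HMF a d W) (1 : ℤ)).map (𝟙 _) =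
      (coneShiftIso f hf hc).hom ≫ ((-1 : ℤ).negOnePow • ((shiftFun (-1)).map (coneSnd f hf hc) ≫
        (shiftFunctorComm (HMF a d W) 1 (-1)).hom.app P))
    refine (congrArg (_ ≫ ·) ((shiftFunctor (HMF a d W) (1 : ℤ)).map_id _)).trans ?_
    refine (Category.comp_id _).trans ?_
    have hs : ∀ {X Y : HMF a d W} (g : X ⟶ Y), (-1 : ℤ).negOnePow • g = -g := fun g => by
      rw [hn, Units.neg_smul, one_smul]
    refine Eq.trans ?_ (congrArg ((coneShiftIso f hf hc).hom ≫ ·) (hs _).symm)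
    refine Eq.trans ?_ (congrArg (fun t => (coneShiftIso f hf hc).hom ≫
      (-((shiftFun (-1)).map (coneSnd f hf hc) ≫ t))) e.symm)
    refine eq_of_val ?_
    change bSnd (MvPolynomial (Fin n) ℂ) P.ι Q.ι = (-((1 : Matrix P.ι P.ι (MvPolynomial (Fin n) ℂ)) *
      bSnd (MvPolynomial (Fin n) ℂ) P.ι Q.ι)) * (Matrix.fromBlocks 1 0 0 (-1) :
        Matrix (Q.ι ⊕ P.ι) (Q.ι ⊕ P.ι) (MvPolynomial (Fin n) ℂ))
    rw [Matrix.one_mul, Matrix.neg_mul, Matrix.fromCols_mul_fromBlocks]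
    ext i (j | j) <;> simp

end


/-! ### The triangulated structure -/

theorem rotate_mem {T : Triangle (HMF a d W)} (hT : T ∈ distTriangles) :
    T.rotate ∈ distTriangles := by
  obtain ⟨P, Q, f, hf, hc, ⟨e⟩⟩ := hT
  exact ⟨_, _, _, _, _, ⟨(rotate _).mapIso e ≪≫ rotateIso f hf hc⟩⟩

theorem shift_mem {T : Triangle (HMF a d W)} (hT : T ∈ distTriangles) :
    (Triangle.shiftFunctor (HMF a d W) (-1)).obj T ∈ distTriangles := by
  obtain ⟨P, Q, f, hf, hc, ⟨e⟩⟩ := hT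
  exact ⟨_, _, _, _, _, ⟨(Triangle.shiftFunctor _ (-1)).mapIso e ≪≫
    (shiftTriangleIso f hf hc).symm⟩⟩

theorem mem_of_iso {T T' : Triangle (HMF a d W)} (hT : T ∈ distTriangles) (e : T' ≅ T) :
    T' ∈ distTriangles := by
  obtain ⟨P, Q, f, hf, hc, ⟨e'⟩⟩ := hT
  exact ⟨P, Q, f, hf, hc, ⟨e ≪≫ e'⟩⟩

theorem rotate_mem_iff (T : Triangle (HMF a d W)) :
    T ∈ distTriangles ↔ T.rotate ∈ distTriangles := by
  refine ⟨rotate_mem, fun hT => ?_⟩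
  refine mem_of_iso (mem_of_iso (shift_mem (rotate_mem (rotate_mem hT)))
    ((invRotateIsoRotateRotateShiftFunctorNegOne _).app T.rotate)) ?_
  exact (triangleRotation _).unitIso.app T

/-- A homotopy commutative square induces a map of mapping cones. -/
theorem cone_map {P Q P' Q' : HMF a d W} (f : Matrix Q.ι P.ι (MvPolynomial (Fin n) ℂ))
    (hf : IsHomog a d 0 P.toGrFree Q.toGrFree f) (hc : f * P.p = Q.p * f)
    (f' : Matrix Q'.ι P'.ι (MvPolynomial (Fin n) ℂ))
    (hf' : IsHomog a d 0 P'.toGrFree Q'.toGrFree f') (hc' : f' * P'.p = Q'.p * f')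
    (u : P ⟶ P') (v : Q ⟶ Q') (h : homMk f hf hc ≫ v = u ≫ homMk f' hf' hc') :
    ∃ w : cone f hf hc ⟶ cone f' hf' hc', coneInl f hf hc ≫ w = v ≫ coneInl f' hf' hc' ∧
      coneSnd f hf hc ≫ (shiftFunctor (HMF a d W) (1 : ℤ)).map u = w ≫ coneSnd f' hf' hc' := by
  obtain ⟨u, hu, hu', rfl⟩ := exists_mk u
  obtain ⟨v, hv, hv', rfl⟩ := exists_mk v
  obtain ⟨s, hs, e⟩ := quot_eq_iff.1 h
  change f' * u - v * f = Q'.p * s + s * P.p at e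
  refine ⟨homMk (P := cone f hf hc) (Q := cone f' hf' hc') (Matrix.fromBlocks v (-s) 0 u :
    Matrix (Q'.ι ⊕ P'.ι) (Q.ι ⊕ P.ι) (MvPolynomial (Fin n) ℂ)) ?_ ?_, ?_, ?_⟩
  · exact IsHomog.fromBlocks (P := Q.toGrFree) (Q := P.toGrFree.shift d 1) (R := Q'.toGrFree)
      (S := P'.toGrFree.shift d 1) hv ((IsHomog.shift_left 1 (by norm_num)).2 hs.neg) IsHomog.zero
      (hu.shift_shift 1)
  · change (Matrix.fromBlocks v (-s) 0 u :
        Matrix (Q'.ι ⊕ P'.ι) (Q.ι ⊕ P.ι) (MvPolynomial (Fin n) ℂ)) * bCone Q.p f P.p =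
      bCone Q'.p f' P'.p * (Matrix.fromBlocks v (-s) 0 u :
        Matrix (Q'.ι ⊕ P'.ι) (Q.ι ⊕ P.ι) (MvPolynomial (Fin n) ℂ))
    rw [Matrix.fromBlocks_multiply, Matrix.fromBlocks_multiply]
    simp only [Matrix.mul_neg, Matrix.neg_mul, Matrix.mul_zero, Matrix.zero_mul, add_zero,
      zero_add, neg_neg, hv', hu', neg_zero]
    congr 1
    rw [sub_eq_iff_eq_add] at e
    rw [e]
    abel
  · refine eq_of_val ?_
    change (Matrix.fromBlocks v (-s) 0 u :
        Matrix (Q'.ι ⊕ P'.ι) (Q.ι ⊕ P.ι) (MvPolynomial (Fin n) ℂ)) *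
      bInl (MvPolynomial (Fin n) ℂ) P.ι Q.ι = bInl (MvPolynomial (Fin n) ℂ) P'.ι Q'.ι * v
    rw [Matrix.fromBlocks_mul_fromRows, Matrix.fromRows_mul]
    simp
  · refine eq_of_val ?_
    change u * bSnd (MvPolynomial (Fin n) ℂ) P.ι Q.ι = bSnd (MvPolynomial (Fin n) ℂ) P'.ι Q'.ι *
      (Matrix.fromBlocks v (-s) 0 u :
        Matrix (Q'.ι ⊕ P'.ι) (Q.ι ⊕ P.ι) (MvPolynomial (Fin n) ℂ))
    rw [Matrix.mul_fromCols, Matrix.fromCols_mul_fromBlocks]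
    simp

theorem complete_of_iso {T₁ T₂ T₁' T₂' : Triangle (HMF a d W)} (e : T₁ ≅ T₁') (e' : T₂ ≅ T₂')
    (H : ∀ (u : T₁'.obj₁ ⟶ T₂'.obj₁) (v : T₁'.obj₂ ⟶ T₂'.obj₂), T₁'.mor₁ ≫ v = u ≫ T₂'.mor₁ →
      ∃ w : T₁'.obj₃ ⟶ T₂'.obj₃, T₁'.mor₂ ≫ w = v ≫ T₂'.mor₂ ∧
        T₁'.mor₃ ≫ (shiftFunctor (HMF a d W) (1 : ℤ)).map u = w ≫ T₂'.mor₃)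
    (u : T₁.obj₁ ⟶ T₂.obj₁) (v : T₁.obj₂ ⟶ T₂.obj₂) (h : T₁.mor₁ ≫ v = u ≫ T₂.mor₁) :
    ∃ w : T₁.obj₃ ⟶ T₂.obj₃, T₁.mor₂ ≫ w = v ≫ T₂.mor₂ ∧
      T₁.mor₃ ≫ (shiftFunctor (HMF a d W) (1 : ℤ)).map u = w ≫ T₂.mor₃ := by
  obtain ⟨w, hw₁, hw₂⟩ := H (e.inv.hom₁ ≫ u ≫ e'.hom.hom₁) (e.inv.hom₂ ≫ v ≫ e'.hom.hom₂) (by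
    rw [← Category.assoc, e.inv.comm₁, Category.assoc, ← Category.assoc T₁.mor₁, h]
    simp only [Category.assoc, e'.hom.comm₁])
  refine ⟨e.hom.hom₃ ≫ w ≫ e'.inv.hom₃, ?_, ?_⟩
  · rw [← Category.assoc, e.hom.comm₂, Category.assoc, ← Category.assoc T₁'.mor₂, hw₁]
    simp only [Category.assoc]
    rw [e'.inv.comm₂]
    simp
  · rw [Category.assoc, Category.assoc, ← e'.inv.comm₃, ← Category.assoc w, ← hw₂]
    simp only [Category.assoc, ← Functor.map_comp]
    rw [← Category.assoc, ← e.hom.comm₃, Category.assoc, ← Functor.map_comp]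
    simp

theorem complete_mem (T₁ T₂ : Triangle (HMF a d W)) (h₁ : T₁ ∈ distTriangles)
    (h₂ : T₂ ∈ distTriangles) (u : T₁.obj₁ ⟶ T₂.obj₁) (v : T₁.obj₂ ⟶ T₂.obj₂)
    (h : T₁.mor₁ ≫ v = u ≫ T₂.mor₁) :
    ∃ w : T₁.obj₃ ⟶ T₂.obj₃, T₁.mor₂ ≫ w = v ≫ T₂.mor₂ ∧
      T₁.mor₃ ≫ (shiftFunctor (HMF a d W) (1 : ℤ)).map u = w ≫ T₂.mor₃ := by
  obtain ⟨P, Q, f, hf, hc, ⟨e⟩⟩ := h₁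
  obtain ⟨P', Q', f', hf', hc', ⟨e'⟩⟩ := h₂
  exact complete_of_iso e e' (cone_map f hf hc f' hf' hc') u v h

/-- `HMF^gr(W)` is a triangulated category. -/
instance : Pretriangulated (HMF a d W) where
  distinguishedTriangles := distTriangles
  isomorphic_distinguished _ hT _ e := mem_of_iso hT e
  contractible_distinguished := contractible_mem
  distinguished_cocone_triangle {P Q} f := exists_cone P Q f
  rotate_distinguished_triangle := rotate_mem_iff
  complete_distinguished_triangle_morphism := complete_mem

end HMF

/-! ## Stability conditions -/

/-- The Grothendieck group of a triangulated category: it is generated by the objects, with the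
relation `[Y] = [X] + [Z]` for every distinguished triangle `X → Y → Z → X[1]`. -/
def K0 (C : Type*) [Category C] [Preadditive C] [HasZeroObject C] [HasShift C ℤ]
    [∀ k : ℤ, (shiftFunctor C k).Additive] [Pretriangulated C] : Type _ :=
  FreeAbelianGroup C ⧸ AddSubgroup.closure
    {x : FreeAbelianGroup C | ∃ T ∈ Pretriangulated.distinguishedTriangles (C := C),
      x = FreeAbelianGroup.of T.obj₂ - FreeAbelianGroup.of T.obj₁ - FreeAbelianGroup.of T.obj₃}

section Stability

variable {C : Type*} [Category C] [Preadditive C] [HasZeroObject C] [HasShift C ℤ]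
  [∀ k : ℤ, (shiftFunctor C k).Additive] [Pretriangulated C]

instance : AddCommGroup (K0 C) :=
  inferInstanceAs (AddCommGroup (FreeAbelianGroup C ⧸ _))

/-- The class of an object in the Grothendieck group. -/
def K0.of (E : C) : K0 C := QuotientAddGroup.mk (FreeAbelianGroup.of E)

variable (C) in
/-- A stability condition on a triangulated category: a central charge `Z` and full additive
subcategories `P φ` of semistable objects of phase `φ`, for all real `φ`. -/
structure StabilityCondition where
  Z : K0 C →+ ℂ
  P : ℝ → ObjectProperty C
  mem_of_iso : ∀ (φ : ℝ) (E F : C), Nonempty (E ≅ F) → P φ E → P φ F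
  mem_of_isZero : ∀ (φ : ℝ) (E : C), IsZero E → P φ E
  biprod_mem : ∀ (φ : ℝ) (E F : C), P φ E → P φ F → P φ (E ⊞ F)
  exists_Z_eq : ∀ (φ : ℝ) (E : C), P φ E → ¬ IsZero E →
    ∃ r : ℝ, 0 < r ∧ Z (K0.of E) = r * Complex.exp (Complex.I * Real.pi * φ)
  P_add_one : ∀ φ : ℝ, P (φ + 1) = (P φ).map (shiftFunctor C (1 : ℤ))
  hom_eq_zero : ∀ (φ₁ φ₂ : ℝ), φ₂ < φ₁ → ∀ (E₁ E₂ : C), P φ₁ E₁ → P φ₂ E₂ →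
    ∀ f : E₁ ⟶ E₂, f = 0
  exists_filtration : ∀ E : C, ¬ IsZero E →
    ∃ (N : ℕ) (X : Fin (N + 1) → C) (F : Fin N → C) (φ : Fin N → ℝ),
      IsZero (X 0) ∧ Nonempty (X (Fin.last N) ≅ E) ∧ StrictAnti φ ∧ (∀ i, P (φ i) (F i)) ∧
        ∀ i : Fin N, ∃ (f : X i.castSucc ⟶ X i.succ) (g : X i.succ ⟶ F i)
          (h : F i ⟶ (shiftFunctor C (1 : ℤ)).obj (X i.castSucc)),
          Pretriangulated.Triangle.mk f g h ∈ Pretriangulated.distinguishedTriangles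

/-- The stability condition `σ = (Z, P)` is of Gepner type with respect to `(Φ, l)`, that is
`(Z ∘ Φ⁻¹, Φ(P φ)) = (exp(-i π l) Z, P (φ + Re l))`. -/
def StabilityCondition.IsGepner (σ : StabilityCondition C) (Φ : C ≌ C) (l : ℂ) : Prop :=
  (∀ E : C, σ.Z (K0.of (Φ.inverse.obj E)) =
    Complex.exp (-(Complex.I * Real.pi * l)) * σ.Z (K0.of E)) ∧
  ∀ φ : ℝ, (σ.P φ).map Φ.functor = σ.P (φ + l.re)

/-- `E` is isomorphic to a finite direct sum of members `X i` of a family, with `i` in `S`. -/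
def IsFiniteSumOf {I : Type*} (X : I → C) (S : Set I) (E : C) : Prop :=
  ∃ (m : ℕ) (t : Fin m → I), (∀ i, t i ∈ S) ∧ Nonempty (E ≅ ⨁ fun i => X (t i))

end Stability

/-! ## The grade shift, the central charge, and factorizations of rank one -/

namespace HMF

variable {n : ℕ} {a : Fin n → ℤ} {d : ℤ} {W : MvPolynomial (Fin n) ℂ}

/-- The object `P(m)`. -/
def twistObj (m : ℤ) (P : HMF a d W) : HMF a d W where
  toGrFree := P.toGrFree.twist m
  p := P.p
  p_homog := P.p_homog.twist_twist m
  p_mul_p := P.p_mul_p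

/-- The functor `P ↦ P(m)`. -/
def twistFun (m : ℤ) : HMF a d W ⥤ HMF a d W where
  obj := twistObj m
  map {P Q} := QuotientAddGroup.map (nullHomotopic P Q)
    (nullHomotopic (twistObj m P) (twistObj m Q))
    (AddMonoidHom.mk' (fun f : cocycles P Q => (⟨f.1, f.2.1.twist_twist m, f.2.2⟩ :
          cocycles (twistObj m P) (twistObj m Q))) fun _ _ => rfl)
    (by
      rintro f ⟨h, hh, hf⟩
      exact ⟨h, hh.twist_twist m, hf⟩)
  map_id P := rfl
  map_comp f g := by
    obtain ⟨f, _, _, rfl⟩ := exists_mk f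
    obtain ⟨g, _, _, rfl⟩ := exists_mk g
    rfl

/-- The isomorphism `P ≅ P(m)(l)` for `m + l = 0`. -/
def twistTwist (m l : ℤ) (h : m + l = 0) :
    𝟭 (HMF a d W) ≅ twistFun m ⋙ twistFun l :=
  NatIso.ofComponents (fun P => isoOfEq P (twistObj l (twistObj m P)).par
    (twistObj l (twistObj m P)).deg (twistObj l (twistObj m P)).p
    (twistObj l (twistObj m P)).p_homog (twistObj l (twistObj m P)).p_mul_p rfl
    (by funext i; simp [twistObj, GrFree.twist, add_assoc, h]) rfl) (fun {P Q} f => by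
      obtain ⟨f, _, _, rfl⟩ := exists_mk f
      refine eq_of_val ?_
      exact (Matrix.one_mul f).trans (Matrix.mul_one f).symm)

/-- The grade shift `P ↦ P(1)`, an autoequivalence of `HMF^gr(W)`. -/
def tau : HMF a d W ≌ HMF a d W :=
  CategoryTheory.Equivalence.mk (twistFun 1) (twistFun (-1)) (twistTwist 1 (-1) (by norm_num))
    (twistTwist (-1) 1 (by norm_num)).symm

/-- The supertrace of `exp(2πi/d)` on `P`: the sum of `exp(2πi m/d)` over the summands `A(m)` of
`P⁰`, minus the same sum for `P¹`. -/
def centralCharge (P : HMF a d W) : ℂ :=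
  ∑ i, (-1 : ℂ) ^ (P.par i).val * Complex.exp (2 * Real.pi * Complex.I * (P.deg i / d))

/-- The factorization `A(j - e) → A(j) → A(j - e + d)` given by the multiplications by `u`
and `v`, where `u` and `v` have the degrees `e` and `e'` and `u * v = W`. -/
def rankOne {e e' : ℤ} {u v : MvPolynomial (Fin n) ℂ}
    (hu : MvPolynomial.IsWeightedHomogeneous a u e)
    (hv : MvPolynomial.IsWeightedHomogeneous a v e') (hd : d = e + e') (hW : W = u * v) (j : ℤ) :
    HMF a d W where
  ι := Fin 2
  par := ![0, 1]
  deg := ![j - e, j]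
  p := !![0, v; u, 0]
  p_homog := by
    have h1 : ((1 : ZMod 2).val : ℤ) = 1 := rfl
    intro s t
    fin_cases s <;> fin_cases t
    · exact ⟨fun _ _ => MvPolynomial.isWeightedHomogeneous_zero _ _ _, fun _ => rfl⟩
    · refine ⟨fun m hm => ?_, fun hm => (hm 1 (by simp [h1])).elim⟩
      obtain rfl : m = 1 := by simp [h1] at hm; omega
      have he : e' = j - e + 1 * d - j := by rw [hd]; ring
      exact he ▸ hv
    · refine ⟨fun m hm => ?_, fun hm => (hm 0 (by simp [h1])).elim⟩
      obtain rfl : m = 0 := by simp [h1] at hm; omega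
      simpa using hu
    · exact ⟨fun _ _ => MvPolynomial.isWeightedHomogeneous_zero _ _ _, fun _ => rfl⟩
  p_mul_p := by
    rw [hW]
    ext s t : 2
    fin_cases s <;> fin_cases t <;> simp [Matrix.mul_apply, mul_comm]

end HMF

end

/-! ## Weighted homogeneous polynomials in two variables -/

namespace HMF

open MvPolynomial

section Polynomials

variable {a : Fin 2 → ℤ} {i j : Fin 2}

/-! Differentiating `p * p = W` gives `p ∂p + ∂p p = ∂W`, so every derivative of `W` acts as zero up
to homotopy on every factorization. If ε > 0, homogeneity and the isolated singularity force a
partial derivative of `W` to be a nonzero constant (`exists_pderiv_eq_C`), and all objects vanish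
(`isZero_of_pderiv`).

If ε = 0, degrees alone make `W` a product `u 0 * u 1` (`exists_factorization`): it is a binary
quadratic form when the weights agree, and a multiple of the lighter variable otherwise. A common
zero of the factors is a singular point of `W`, so the factors are coordinates on the plane
(`aeval_bijective`). Thus they form a regular sequence generating the ideal of the origin, and the
derivative of `W` along `u 0` is `u 1`.

A morphism from `L(s) = L(j)[k]`, `s = (j, k)`, to `E` amounts to a vector `e` with `p e` divisible
by `u 0`, that is, to a cycle of `E` modulo `u 0`. It vanishes exactly when `e` is a boundary modulo
`u 0`. Since `u 1` is null-homotopic on `E`, this can be tested on constant terms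
(`exists_boundary`, `homMk_line_eq_zero_iff`). Hence `Hom(L(s), E)` embeds into a finite-dimensional
space. For `E = L(t)`, comparing degrees yields orthogonality and scalar endomorphisms.

If all `Hom(L(s), E)` vanish, the constant term of `p` is exact, and a contraction of it lifts to
`E` by a graded form of Nakayama's lemma, so `E = 0` (`isZero_of_line`). Now the evaluation map from
the sum of copies of `L(s)`, one for each basis element of `Hom(L(s), E)`, is bijective on morphisms
from every `L(s)`. Its cone receives no nonzero morphism from them, so it is an isomorphism
(`exists_iso_biproduct`).

The central charge is a supertrace, which vanishes on contractible factorizations and is additive on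
cones, so it descends to the Grothendieck group. The grade shift multiplies it by `exp(2πi/d)` and
`[1]` by `-1`, which gives the phases of the `L(s)`. Filtrations come from sorting the summands by
phase. The Gepner property holds because the grade shift sends `L(j)` to `L(j + 1)` and `L(d) =
L(0)[2]` closes the cycle. -/

theorem weight_eq_of_ne (hij : i ≠ j) (m : Fin 2 →₀ ℕ) :
    Finsupp.weight a m = m i * a i + m j * a j := by
  rw [Finsupp.weight_apply, Finsupp.sum_fintype _ _ (by simp), Fin.sum_univ_two]
  fin_cases i <;> fin_cases j <;> simp at hij ⊢
  rw [add_comm]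

theorem isWeightedHomogeneous_pderiv {n : ℕ} {a : Fin n → ℤ} {q : MvPolynomial (Fin n) ℂ} {D : ℤ}
    (hq : IsWeightedHomogeneous a q D) (i : Fin n) :
    IsWeightedHomogeneous a (pderiv i q) (D - a i) := by
  intro m hm
  rw [coeff_pderiv] at hm
  have := hq (left_ne_zero_of_mul hm)
  rw [map_add, Finsupp.weight_single, one_smul] at this
  linarith

/-- For positive weights only the monomial `1` has weight zero. -/
theorem eq_C_of_isWeightedHomogeneous_zero {n : ℕ} {a : Fin n → ℤ} (ha : ∀ i, 0 < a i)
    {q : MvPolynomial (Fin n) ℂ} (hq : IsWeightedHomogeneous a q 0) :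
    q = C (constantCoeff q) := by
  ext m
  rw [coeff_C, constantCoeff_eq]
  split_ifs with h
  · rw [h]
  · by_contra hm
    have := hq hm
    rw [Finsupp.weight_apply, Finsupp.sum_fintype _ _ (by simp),
      Finset.sum_eq_zero_iff_of_nonneg (fun i _ => by have := ha i; positivity)] at this
    refine h (Finsupp.ext fun i => ?_)
    have h1 := this i (Finset.mem_univ i)
    have h2 := (ha i).ne'
    simp [h2] at h1
    simp [h1]

theorem constantCoeff_eq_zero_of_isWeightedHomogeneous {n : ℕ} {a : Fin n → ℤ}
    {q : MvPolynomial (Fin n) ℂ} {D : ℤ} (hq : IsWeightedHomogeneous a q D) (hD : D ≠ 0) :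
    constantCoeff q = 0 := by
  by_contra h
  exact hD (by simpa using (hq h).symm)

/-- Monomials involving the other variable vanish at the `j`-th unit vector, so a nonzero value must
come from a pure power of `x_j`. -/
theorem exists_coeff_single_ne_zero {q : MvPolynomial (Fin 2) ℂ}
    (hq : eval (Pi.single j 1) q ≠ 0) : ∃ n : ℕ, coeff (Finsupp.single j n) q ≠ 0 := by
  rw [eval_eq'] at hq
  obtain ⟨m, hm, h⟩ := Finset.exists_ne_zero_of_sum_ne_zero hq
  refine ⟨m j, ?_⟩
  have h2 := right_ne_zero_of_mul h
  have : m = Finsupp.single j (m j) := by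
    ext k
    by_cases hk : k = j
    · subst hk; simp
    · have h3 := Finset.prod_ne_zero_iff.1 h2 k (Finset.mem_univ k)
      rw [Pi.single_eq_of_ne hk] at h3
      rw [Finsupp.single_eq_of_ne hk]
      by_contra h4
      exact h3 (zero_pow h4)
  rw [← this]
  exact mem_support_iff.1 hm

theorem exists_eq_mul_of_eval_single_ne_zero {q : MvPolynomial (Fin 2) ℂ} {D : ℤ}
    (h : IsWeightedHomogeneous a q D) (hq : eval (Pi.single j 1) q ≠ 0) :
    ∃ n : ℕ, D = n * a j ∧ coeff (Finsupp.single j n) q ≠ 0 := by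
  obtain ⟨n, hn⟩ := exists_coeff_single_ne_zero hq
  refine ⟨n, ?_, hn⟩
  rw [← h hn, Finsupp.weight_single, nsmul_eq_mul]

/-- The first variable index has the smaller weight. -/
theorem exists_ordered (a : Fin 2 → ℤ) : ∃ i j : Fin 2, i ≠ j ∧ a i ≤ a j := by
  rcases le_total (a 0) (a 1) with h | h
  · exact ⟨0, 1, by decide, h⟩
  · exact ⟨1, 0, by decide, h⟩

theorem add_eq_of_ne {M : Type*} [AddCommMonoid M] (f : Fin 2 → M) (hij : i ≠ j) :
    f 0 + f 1 = f i + f j := by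
  fin_cases i <;> fin_cases j <;> simp at hij ⊢
  rw [add_comm]

theorem mul_eq_of_ne {M : Type*} [CommMonoid M] (f : Fin 2 → M) (hij : i ≠ j) :
    f 0 * f 1 = f i * f j := by
  fin_cases i <;> fin_cases j <;> simp at hij ⊢
  rw [mul_comm]

theorem eq_or_eq_of_ne (hij : i ≠ j) (k : Fin 2) : k = i ∨ k = j := by
  fin_cases i <;> fin_cases j <;> fin_cases k <;> simp at hij ⊢

variable {d : ℤ} {W : MvPolynomial (Fin 2) ℂ}

theorem exists_eval_single_ne_zero (hsing : ∀ x : Fin 2 → ℂ, eval x W = 0 →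
      (∀ i, eval x (pderiv i W) = 0) → x = 0) (j : Fin 2) :
    eval (Pi.single j 1) W ≠ 0 ∨ ∃ k, eval (Pi.single j 1) (pderiv k W) ≠ 0 := by
  by_contra! h
  have := congrFun (hsing _ h.1 h.2) j
  simp at this

theorem ne_zero_of_isolated (hsing : ∀ x : Fin 2 → ℂ, eval x W = 0 →
      (∀ i, eval x (pderiv i W) = 0) → x = 0) : W ≠ 0 := by
  rintro rfl
  rcases exists_eval_single_ne_zero hsing 0 with h | ⟨k, h⟩ <;> simp at h

/-- If `d < a 0 + a 1` then some partial derivative of `W` is a nonzero constant. -/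
theorem exists_pderiv_eq_C (ha : ∀ i, 0 < a i) (hd : 0 < d) (hW : IsWeightedHomogeneous a W d)
    (hsing : ∀ x : Fin 2 → ℂ, eval x W = 0 → (∀ i, eval x (pderiv i W) = 0) → x = 0)
    (hε : d < a 0 + a 1) : ∃ (i : Fin 2) (c : ℂ), c ≠ 0 ∧ pderiv i W = C c := by
  obtain ⟨i, j, hij, hle⟩ := exists_ordered a
  rw [add_eq_of_ne a hij] at hε
  have key : ∀ k, d = a k → constantCoeff (pderiv k W) ≠ 0 →
      ∃ (i : Fin 2) (c : ℂ), c ≠ 0 ∧ pderiv i W = C c := fun k hk h => by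
    have h0 := isWeightedHomogeneous_pderiv hW k
    rw [hk, sub_self] at h0
    exact ⟨k, _, h, eq_C_of_isWeightedHomogeneous_zero ha h0⟩
  have h1 := ha i
  have h2 := ha j
  -- The singularity condition is tested on the axis of the heavier variable. If `W` contains `x_j ^
  -- n`, then `n a_j = d < a_i + a_j ≤ 2 a_j` forces `n = 1`. If `∂_k W` contains `x_j ^ n`, then `n
  -- a_j = d - a_k < a_j` forces `n = 0`.
  rcases exists_eval_single_ne_zero hsing j with h | ⟨k, h⟩
  · obtain ⟨n, hn, hc⟩ := exists_eq_mul_of_eval_single_ne_zero hW h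
    have : n = 1 := by
      have : n < 2 := by
        by_contra h
        have : (2 : ℤ) ≤ n := by exact_mod_cast not_lt.1 h
        nlinarith
      interval_cases n
      · simp at hn; omega
      · rfl
    subst this
    refine key j (by simpa using hn) ?_
    rw [constantCoeff_eq, coeff_pderiv]
    simpa using hc
  · obtain ⟨n, hn, hc⟩ :=
      exists_eq_mul_of_eval_single_ne_zero (isWeightedHomogeneous_pderiv hW k) h
    have : n = 0 := by
      by_contra h
      have : (1 : ℤ) ≤ n := by exact_mod_cast Nat.pos_of_ne_zero h
      rcases eq_or_eq_of_ne hij k with rfl | rfl <;> nlinarith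
    subst this
    refine key k (by simp at hn; omega) ?_
    simpa [constantCoeff_eq] using hc

variable {u : Fin 2 → MvPolynomial (Fin 2) ℂ}

/-- The two factors of `W` have no common zero outside the origin. -/
theorem eq_zero_of_common_zero
    (hsing : ∀ x : Fin 2 → ℂ, eval x W = 0 → (∀ i, eval x (pderiv i W) = 0) → x = 0)
    (huW : W = u 0 * u 1) (x : Fin 2 → ℂ) (h : ∀ k, eval x (u k) = 0) : x = 0 := by
  refine hsing x ?_ fun i => ?_
  · rw [huW, map_mul, h, zero_mul]
  · rw [huW, pderiv_mul, map_add, map_mul, map_mul, h, h, mul_zero, zero_mul, add_zero]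

theorem mem_of_support {S : Submodule ℂ (MvPolynomial (Fin 2) ℂ)} {q : MvPolynomial (Fin 2) ℂ}
    (h : ∀ m, coeff m q ≠ 0 → monomial m 1 ∈ S) : q ∈ S := by
  rw [q.as_sum]
  refine S.sum_mem fun m hm => ?_
  rw [← mul_one (coeff m q), ← smul_eq_mul, ← smul_monomial]
  exact S.smul_mem _ (h m (mem_support_iff.1 hm))

theorem eq_sum_of_support {q : MvPolynomial (Fin 2) ℂ} {s : Finset (Fin 2 →₀ ℕ)}
    (h : ∀ m, coeff m q ≠ 0 → m ∈ s) : q = ∑ m ∈ s, monomial m (coeff m q) := by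
  conv_lhs => rw [q.as_sum]
  refine Finset.sum_subset (fun m hm => h m (mem_support_iff.1 hm)) fun m _ hm => ?_
  rw [notMem_support_iff.1 hm, monomial_zero]

theorem finsupp_eq_of_ne (hij : i ≠ j) (m : Fin 2 →₀ ℕ) :
    m = Finsupp.single i (m i) + Finsupp.single j (m j) := by
  ext k
  rcases eq_or_eq_of_ne hij k with rfl | rfl
  · simp [hij]
  · simp [hij.symm]

/-- Two linear forms without a common zero generate the polynomial ring. -/
theorem aeval_surjective_of_eq (ha : ∀ i, 0 < a i) (h01 : a 0 = a 1)
    (hu : ∀ k, IsWeightedHomogeneous a (u k) (a k))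
    (h0 : ∀ x : Fin 2 → ℂ, (∀ k, eval x (u k) = 0) → x = 0) (l : Fin 2) :
    X l ∈ (aeval u : MvPolynomial (Fin 2) ℂ →ₐ[ℂ] MvPolynomial (Fin 2) ℂ).range := by
  have hall : ∀ k, a k = a 0 := fun k => by fin_cases k <;> simp [h01]
  let J : Matrix (Fin 2) (Fin 2) ℂ := fun k l => coeff (Finsupp.single l 1) (u k)
  have hJ : ∀ k, u k = ∑ l, C (J k l) * X l := fun k => by
    have := eq_sum_of_support (q := u k)
      (s := {Finsupp.single 0 1, Finsupp.single 1 1}) (fun m hm => by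
        have h1 := hu k hm
        rw [weight_eq_of_ne (i := 0) (j := 1) (by decide), hall k, ← h01, ← add_mul] at h1
        have h2 : (m 0 : ℤ) + m 1 = 1 := mul_right_cancel₀ (ha 0).ne' (by rw [h1, one_mul])
        have h3 := finsupp_eq_of_ne (i := 0) (j := 1) (by decide) m
        have h4 : m 0 = 1 ∧ m 1 = 0 ∨ m 0 = 0 ∧ m 1 = 1 := by omega
        rcases h4 with ⟨h4, h5⟩ | ⟨h4, h5⟩ <;> rw [h4, h5] at h3 <;> rw [h3] <;> simp)
    rw [this, Finset.sum_pair (by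
      intro h
      have := congrArg (fun f => f 0) h
      simp at this), Fin.sum_univ_two]
    simp [J, C_mul_X_eq_monomial]
  have hdet : IsUnit J.det := by
    rw [isUnit_iff_ne_zero]
    intro hdet
    -- A kernel vector of the coefficient matrix would be a common zero of the two linear forms.
    obtain ⟨x, hx, hx'⟩ := Matrix.exists_mulVec_eq_zero_iff.2 hdet
    refine hx (h0 x fun k => ?_)
    rw [hJ k]
    simpa [Matrix.mulVec, dotProduct] using congrFun hx' k
  have : X l = ∑ k, C (J⁻¹ l k) * u k := by
    have h1 : ∀ l', ∑ k, J⁻¹ l k * J k l' = (1 : Matrix (Fin 2) (Fin 2) ℂ) l l' := fun l' => by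
      rw [← Matrix.nonsing_inv_mul J hdet, Matrix.mul_apply]
    simp_rw [hJ, Finset.mul_sum]
    rw [Finset.sum_comm]
    simp_rw [← mul_assoc, ← C_mul, ← Finset.sum_mul, ← map_sum, h1, Matrix.one_apply]
    simp
  rw [this]
  refine Subalgebra.sum_mem _ fun k _ => ?_
  exact ⟨C (J⁻¹ l k) * X k, by simp⟩

/-- The change of coordinates is triangular: degrees force `u i = α x_i`, while `u j` is `γ x_j`
plus a polynomial in `x_i`. Here `α ≠ 0` since `u i ≠ 0`, and `γ ≠ 0` since otherwise both factors
vanish at the `j`-th unit vector. -/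
theorem aeval_surjective_of_lt (ha : ∀ i, 0 < a i) (hij : i ≠ j) (hlt : a i < a j)
    (hu : ∀ k, IsWeightedHomogeneous a (u k) (a k)) (hui : u i ≠ 0)
    (h0 : ∀ x : Fin 2 → ℂ, (∀ k, eval x (u k) = 0) → x = 0) (l : Fin 2) :
    X l ∈ (aeval u : MvPolynomial (Fin 2) ℂ →ₐ[ℂ] MvPolynomial (Fin 2) ℂ).range := by
  have hi := ha i
  have hmem : ∀ k, u k ∈ (aeval u : MvPolynomial (Fin 2) ℂ →ₐ[ℂ] MvPolynomial (Fin 2) ℂ).range :=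
    fun k => ⟨X k, by simp⟩
  have hC : ∀ c : ℂ, C c ∈
      (aeval u : MvPolynomial (Fin 2) ℂ →ₐ[ℂ] MvPolynomial (Fin 2) ℂ).range :=
    fun c => ⟨C c, by simp [algebraMap_eq]⟩
  have h1 : u i = C (coeff (Finsupp.single i 1) (u i)) * X i := by
    have := eq_sum_of_support (q := u i) (s := {Finsupp.single i 1}) (fun m hm => by
      have h1 := hu i hm
      rw [weight_eq_of_ne hij] at h1
      have hmj : m j = 0 := by
        by_contra h
        have : (1 : ℤ) ≤ m j := by exact_mod_cast Nat.pos_of_ne_zero h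
        nlinarith [mul_nonneg (Int.natCast_nonneg (m i)) hi.le]
      have hmi : m i = 1 := by
        rw [hmj, Nat.cast_zero, zero_mul, add_zero] at h1
        exact_mod_cast (mul_right_cancel₀ hi.ne' (h1.trans (one_mul _).symm) : (m i : ℤ) = 1)
      rw [finsupp_eq_of_ne hij m, hmi, hmj]
      simp)
    rw [this, Finset.sum_singleton]
    simp [C_mul_X_eq_monomial]
  set α := coeff (Finsupp.single i 1) (u i) with hα
  have hα0 : α ≠ 0 := by
    intro h
    rw [h] at h1
    exact hui (by simpa using h1)
  have hXi : X i ∈ (aeval u : MvPolynomial (Fin 2) ℂ →ₐ[ℂ] MvPolynomial (Fin 2) ℂ).range := by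
    have : X i = C α⁻¹ * u i := by
      rw [h1, ← mul_assoc, ← C_mul, inv_mul_cancel₀ hα0, C_1, one_mul]
    rw [this]
    exact Subalgebra.mul_mem _ (hC _) (hmem i)
  rcases eq_or_eq_of_ne hij l with rfl | rfl
  · exact hXi
  set γ := coeff (Finsupp.single l 1) (u l) with hγ
  have h2 : u l - C γ * X l ∈
      (aeval u : MvPolynomial (Fin 2) ℂ →ₐ[ℂ] MvPolynomial (Fin 2) ℂ).range := by
    rw [← Subalgebra.mem_toSubmodule]
    refine mem_of_support fun m hm => ?_
    -- The only monomial of weight `a l` involving `x_l` is `x_l` itself, and its term has been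
    -- subtracted.
    have hml : m l = 0 := by
      by_contra h
      rw [coeff_sub, C_mul_X_eq_monomial, coeff_monomial] at hm
      have hne : Finsupp.single l 1 ≠ m := by
        intro h'
        rw [if_pos h', ← h', hγ, sub_self] at hm
        exact hm rfl
      rw [if_neg hne, sub_zero] at hm
      have h1 := hu l hm
      rw [weight_eq_of_ne hij] at h1
      have h3 : (1 : ℤ) ≤ m l := by exact_mod_cast Nat.pos_of_ne_zero h
      have hmi : m i = 0 := by
        by_contra h
        have : (1 : ℤ) ≤ m i := by exact_mod_cast Nat.pos_of_ne_zero h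
        nlinarith
      have hml : m l = 1 := by
        rw [hmi, Nat.cast_zero, zero_mul, zero_add] at h1
        exact_mod_cast
          (mul_right_cancel₀ (hi.trans hlt).ne' (h1.trans (one_mul _).symm) : (m l : ℤ) = 1)
      refine hne ?_
      rw [finsupp_eq_of_ne hij m, hmi, hml]
      simp
    rw [finsupp_eq_of_ne hij m, hml, Finsupp.single_zero, add_zero, ← X_pow_eq_monomial]
    exact Subalgebra.pow_mem _ hXi _
  have hγ0 : γ ≠ 0 := by
    intro h
    have h3 : eval (Pi.single l 1) (u i) = 0 := by
      rw [h1]; simp [hij]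
    have h4 : eval (Pi.single l 1) (u l) = 0 := by
      by_contra h5
      obtain ⟨n, hn, hc⟩ := exists_eq_mul_of_eval_single_ne_zero (hu l) h5
      have : n = 1 := by
        exact_mod_cast
          (mul_right_cancel₀ (hi.trans hlt).ne' (hn.symm.trans (one_mul _).symm) : (n : ℤ) = 1)
      rw [this] at hc
      exact hc h
    have := congrFun (h0 (Pi.single l 1) fun k => by
      rcases eq_or_eq_of_ne hij k with rfl | rfl
      · exact h3
      · exact h4) l
    simp at this
  have : X l = C γ⁻¹ * (u l - (u l - C γ * X l)) := by
    rw [sub_sub_cancel, ← mul_assoc, ← C_mul, inv_mul_cancel₀ hγ0, C_1, one_mul]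
  rw [this]
  exact Subalgebra.mul_mem _ (hC _) (Subalgebra.sub_mem _ (hmem l) h2)

/-- The kernels of the iterates of `f` stabilize, say at `n`. An element of the kernel of `f` has
the form `f ^ n y`, so `y` lies in the kernel of `f ^ (n + 1)`, hence in that of `f ^ n`. -/
theorem injective_of_surjective_ringHom {R : Type*} [CommRing R] [IsNoetherianRing R] (f : R →+* R)
    (hf : Function.Surjective f) : Function.Injective f := by
  let K : ℕ →o Ideal R := ⟨fun n => RingHom.ker (f ^ n), monotone_nat_of_le_succ fun n x hx => by
    rw [RingHom.mem_ker] at hx ⊢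
    rw [pow_succ', RingHom.mul_def, RingHom.comp_apply, hx, map_zero]⟩
  obtain ⟨n, hn⟩ := monotone_stabilizes_iff_noetherian.2 ‹IsNoetherianRing R› K
  rw [injective_iff_map_eq_zero]
  intro x hx
  have hs : Function.Surjective (f ^ n) := by
    rw [RingHom.coe_pow]; exact hf.iterate n
  obtain ⟨y, rfl⟩ := hs x
  have : y ∈ K (n + 1) := by
    change y ∈ RingHom.ker (f ^ (n + 1))
    rw [RingHom.mem_ker, pow_succ', RingHom.mul_def, RingHom.comp_apply, hx]
  rw [← hn (n + 1) n.le_succ] at this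
  exact this

/-- The factors of `W` are coordinates on the affine plane. -/
theorem aeval_bijective (ha : ∀ i, 0 < a i)
    (hsing : ∀ x : Fin 2 → ℂ, eval x W = 0 → (∀ i, eval x (pderiv i W) = 0) → x = 0)
    (hu : ∀ k, IsWeightedHomogeneous a (u k) (a k)) (huW : W = u 0 * u 1) :
    Function.Bijective (aeval u : MvPolynomial (Fin 2) ℂ →ₐ[ℂ] MvPolynomial (Fin 2) ℂ) := by
  have h0 := eq_zero_of_common_zero hsing huW
  have hW0 := ne_zero_of_isolated hsing
  have hne : ∀ k, u k ≠ 0 := fun k hk => hW0 (by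
    rw [huW]
    fin_cases k
    · exact mul_eq_zero_of_left hk _
    · exact mul_eq_zero_of_right _ hk)
  have hX : ∀ l, X l ∈
      (aeval u : MvPolynomial (Fin 2) ℂ →ₐ[ℂ] MvPolynomial (Fin 2) ℂ).range := by
    rcases lt_trichotomy (a 0) (a 1) with h | h | h
    · exact aeval_surjective_of_lt ha (by decide) h hu (hne 0) h0
    · exact aeval_surjective_of_eq ha h hu h0
    · exact aeval_surjective_of_lt ha (by decide) h hu (hne 1) h0
  have hs : Function.Surjective (aeval u :
      MvPolynomial (Fin 2) ℂ →ₐ[ℂ] MvPolynomial (Fin 2) ℂ) := by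
    rw [← AlgHom.range_eq_top, eq_top_iff, ← adjoin_range_X, Algebra.adjoin_le_iff]
    rintro _ ⟨l, rfl⟩
    exact hX l
  exact ⟨injective_of_surjective_ringHom
    (aeval u : MvPolynomial (Fin 2) ℂ →ₐ[ℂ] MvPolynomial (Fin 2) ℂ).toRingHom hs, hs⟩

/-- A product of homogeneous coordinates: the case of distinct weights. -/
theorem exists_factorization_of_lt (ha : ∀ i, 0 < a i) (hij : i ≠ j) (hlt : a i < a j)
    (hW : IsWeightedHomogeneous a W (a 0 + a 1)) :
    ∃ u : Fin 2 → MvPolynomial (Fin 2) ℂ,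
      (∀ k, IsWeightedHomogeneous a (u k) (a k)) ∧ W = u 0 * u 1 := by
  rw [add_eq_of_ne a hij] at hW
  have hi := ha i
  have hdvd : X i ∣ W := by
    rw [← Ideal.mem_span_singleton]
    have : W ∈ ((Ideal.span {X i} : Ideal (MvPolynomial (Fin 2) ℂ)).restrictScalars ℂ) := by
      -- A monomial without `x_i` would be a power of `x_j` of weight `a i + a j`, which lies
      -- strictly between `a j` and `2 * a j`.
      refine mem_of_support fun m hm => ?_
      rw [Submodule.restrictScalars_mem, Ideal.mem_span_singleton, X_dvd_monomial]
      refine Or.inr fun hmi => ?_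
      have h1 := hW hm
      rw [weight_eq_of_ne hij, hmi, Nat.cast_zero, zero_mul, zero_add] at h1
      have h2 : (1 : ℤ) < m j := by
        by_contra h
        nlinarith [not_lt.1 h]
      nlinarith
    exact this
  obtain ⟨V, hV⟩ := hdvd
  -- Passing to a component makes the cofactor visibly homogeneous; the product is unaffected
  -- because `W` is homogeneous.
  refine ⟨fun k => if k = i then X i else weightedHomogeneousComponent a (a j) V, fun k => ?_, ?_⟩
  · beta_reduce
    rcases eq_or_eq_of_ne hij k with rfl | rfl
    · rw [if_pos rfl]; exact isWeightedHomogeneous_X ℂ a k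
    · rw [if_neg hij.symm]
      apply weightedHomogeneousComponent_isWeightedHomogeneous
  · rw [mul_eq_of_ne (fun k => if k = i then X i else weightedHomogeneousComponent a (a j) V) hij]
    simp only [if_true, if_neg hij.symm]
    ext m
    rw [hV, coeff_X_mul', coeff_X_mul', coeff_weightedHomogeneousComponent]
    split_ifs with h h1
    · rfl
    · by_contra h2
      refine h1 ?_
      have h3 := hW (d := m) (by rw [hV, coeff_X_mul', if_pos h]; exact h2)
      have h4 : m = (m - Finsupp.single i 1) + Finsupp.single i 1 := by
        rw [tsub_add_cancel_of_le]
        rw [Finsupp.single_le_iff]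
        exact Nat.pos_of_ne_zero (Finsupp.mem_support_iff.1 h)
      rw [h4, map_add, Finsupp.weight_single, one_smul] at h3
      linarith
    · rfl

/-- A product of homogeneous coordinates: the case of equal weights. -/
theorem exists_factorization_of_eq (ha : ∀ i, 0 < a i) (h01 : a 0 = a 1)
    (hW : IsWeightedHomogeneous a W (a 0 + a 1)) :
    ∃ u : Fin 2 → MvPolynomial (Fin 2) ℂ,
      (∀ k, IsWeightedHomogeneous a (u k) (a k)) ∧ W = u 0 * u 1 := by
  have hlin : ∀ (r s : ℂ) (k : Fin 2), IsWeightedHomogeneous a (C r * X 0 + C s * X 1) (a k) := by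
    intro r s k
    have hk : a k = a 0 := by fin_cases k <;> simp [h01]
    rw [hk]
    refine ((isWeightedHomogeneous_X ℂ a 0).C_mul r).add ?_
    rw [h01]
    exact (isWeightedHomogeneous_X ℂ a 1).C_mul s
  have hsum : ∃ α β γ : ℂ, W = C α * X 0 ^ 2 + C β * (X 0 * X 1) + C γ * X 1 ^ 2 := by
    have := eq_sum_of_support (q := W) (s := {Finsupp.single 0 2,
      Finsupp.single 0 1 + Finsupp.single 1 1, Finsupp.single 1 2}) (fun m hm => by
        have h1 := hW hm
        rw [weight_eq_of_ne (i := 0) (j := 1) (by decide), ← h01, ← add_mul, ← two_mul] at h1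
        have h2 : (m 0 : ℤ) + m 1 = 2 := mul_right_cancel₀ (ha 0).ne' h1
        have h3 := finsupp_eq_of_ne (i := 0) (j := 1) (by decide) m
        have h4 : m 0 = 2 ∧ m 1 = 0 ∨ m 0 = 1 ∧ m 1 = 1 ∨ m 0 = 0 ∧ m 1 = 2 := by omega
        rcases h4 with ⟨h4, h5⟩ | ⟨h4, h5⟩ | ⟨h4, h5⟩ <;> rw [h4, h5] at h3 <;> rw [h3] <;> simp)
    refine ⟨coeff (Finsupp.single 0 2) W, coeff (Finsupp.single 0 1 + Finsupp.single 1 1) W,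
      coeff (Finsupp.single 1 2) W, this.trans ?_⟩
    rw [Finset.sum_insert, Finset.sum_pair, ← add_assoc, C_mul_X_pow_eq_monomial,
      C_mul_X_pow_eq_monomial]
    · congr 2
      rw [X, X, monomial_mul, C_mul_monomial]
      simp
    · intro h
      have := congrArg (fun f => f 0) h
      simp at this
    · simp only [Finset.mem_insert, Finset.mem_singleton, not_or]
      constructor <;> intro h <;> have := congrArg (fun f => f 0) h <;> simp at this
  obtain ⟨α, β, γ, rfl⟩ := hsum
  -- If `α = 0` the form is divisible by `X 1`; otherwise it splits by the quadratic formula, with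
  -- `s` a square root of the discriminant.
  by_cases hα : α = 0
  · refine ⟨![C 0 * X 0 + C 1 * X 1, C β * X 0 + C γ * X 1], fun k => ?_, ?_⟩
    · fin_cases k
      · exact hlin 0 1 0
      · exact hlin β γ 1
    · simp [hα]; ring
  · obtain ⟨s, hs⟩ := IsAlgClosed.exists_pow_nat_eq (β ^ 2 - 4 * α * γ) (n := 2) (by norm_num)
    refine ⟨![C α * X 0 + C ((β - s) / 2) * X 1, C 1 * X 0 + C ((β + s) / (2 * α)) * X 1],
      fun k => ?_, ?_⟩
    · fin_cases k
      · exact hlin _ _ 0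
      · exact hlin _ _ 1
    · have h1 : β = α * ((β + s) / (2 * α)) + (β - s) / 2 := by field_simp; ring
      have h2 : γ = (β - s) / 2 * ((β + s) / (2 * α)) := by
        field_simp
        linear_combination hs
      conv_lhs => rw [h1, h2]
      simp only [C_add, C_mul, Matrix.cons_val_zero, Matrix.cons_val_one, C_1]
      ring

theorem exists_factorization (ha : ∀ i, 0 < a i)
    (hW : IsWeightedHomogeneous a W (a 0 + a 1)) :
    ∃ u : Fin 2 → MvPolynomial (Fin 2) ℂ,
      (∀ k, IsWeightedHomogeneous a (u k) (a k)) ∧ W = u 0 * u 1 := by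
  rcases lt_trichotomy (a 0) (a 1) with h | h | h
  · exact exists_factorization_of_lt ha (i := 0) (j := 1) (by decide) h hW
  · exact exists_factorization_of_eq ha h hW
  · exact exists_factorization_of_lt ha (i := 1) (j := 0) (by decide) h hW

/-- A polynomial without constant term lies in the ideal of the coordinates `u`. -/
theorem exists_eq_mul_add_mul
    (hb : Function.Bijective (aeval u : MvPolynomial (Fin 2) ℂ →ₐ[ℂ] MvPolynomial (Fin 2) ℂ))
    (hc : ∀ k, constantCoeff (u k) = 0) {q : MvPolynomial (Fin 2) ℂ} (hq : constantCoeff q = 0) :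
    ∃ r s, q = u 0 * r + u 1 * s := by
  obtain ⟨q, rfl⟩ := hb.2 q
  -- The change of coordinates fixes the origin, so it carries the ideal of the origin to itself.
  have hcc : ∀ f : MvPolynomial (Fin 2) ℂ, constantCoeff (aeval u f) = constantCoeff f := by
    intro f
    induction f using MvPolynomial.induction_on with
    | C c => simp [algebraMap_eq]
    | add f g hf hg => rw [map_add, map_add, map_add, hf, hg]
    | mul_X f k hf => simp [hc]
  rw [hcc] at hq
  have : q ∈ Ideal.span (Set.range (X : Fin 2 → MvPolynomial (Fin 2) ℂ)) := by
    have h := MvPolynomial.mem_ideal_span_X_image (R := ℂ) (s := Set.univ) (x := q)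
    rw [Set.image_univ] at h
    rw [h]
    intro m hm
    by_contra h'
    push Not at h'
    have : m = 0 := Finsupp.ext fun k => h' k (Set.mem_univ k)
    rw [this, mem_support_iff] at hm
    exact hm hq
  rw [Ideal.mem_span_range_iff_exists_fun] at this
  obtain ⟨c, hc⟩ := this
  refine ⟨aeval u (c 0), aeval u (c 1), ?_⟩
  rw [← hc, Fin.sum_univ_two]
  simp [mul_comm]

/-- The coordinates `u 0, u 1` form a regular sequence: after undoing the change of variables, the
prime `X 0` does not divide `X 1`. -/
theorem dvd_of_dvd_mul
    (hb : Function.Bijective (aeval u : MvPolynomial (Fin 2) ℂ →ₐ[ℂ] MvPolynomial (Fin 2) ℂ))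
    {q : MvPolynomial (Fin 2) ℂ} (h : u 0 ∣ u 1 * q) : u 0 ∣ q := by
  obtain ⟨q, rfl⟩ := hb.2 q
  obtain ⟨r, hr⟩ := h
  obtain ⟨r, rfl⟩ := hb.2 r
  have : (X 1 * q : MvPolynomial (Fin 2) ℂ) = X 0 * r := hb.1 (by simpa using hr)
  have h2 : (X 0 : MvPolynomial (Fin 2) ℂ) ∣ q := by
    rcases X_prime.dvd_mul.1 (Dvd.intro r this.symm) with h | h
    · simp [X_dvd_X] at h
    · exact h
  obtain ⟨s, rfl⟩ := h2
  exact ⟨aeval u s, by simp⟩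

/-- The partial derivative with respect to the first of the coordinates `u`. -/
theorem exists_derivation
    (hb : Function.Bijective (aeval u : MvPolynomial (Fin 2) ℂ →ₐ[ℂ] MvPolynomial (Fin 2) ℂ)) :
    ∃ δ : MvPolynomial (Fin 2) ℂ →+ MvPolynomial (Fin 2) ℂ,
      (∀ f g, δ (f * g) = f * δ g + δ f * g) ∧ δ (u 0 * u 1) = u 1 := by
  let φ := AlgEquiv.ofBijective _ hb
  have hφ : ∀ k, φ.symm (u k) = X k := fun k => by
    rw [AlgEquiv.symm_apply_eq]
    change u k = aeval u (X k)
    simp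
  refine ⟨(φ : MvPolynomial (Fin 2) ℂ →+ MvPolynomial (Fin 2) ℂ).comp
    ((pderiv 0 : Derivation ℂ (MvPolynomial (Fin 2) ℂ) _).toLinearMap.toAddMonoidHom.comp
      (φ.symm : MvPolynomial (Fin 2) ℂ →+ MvPolynomial (Fin 2) ℂ)), fun f g => ?_, ?_⟩
  · change φ (pderiv 0 (φ.symm (f * g))) = f * φ (pderiv 0 (φ.symm g)) +
      φ (pderiv 0 (φ.symm f)) * g
    rw [map_mul, pderiv_mul, map_add, map_mul, map_mul]
    simp [add_comm]
  · change φ (pderiv 0 (φ.symm (u 0 * u 1))) = u 1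
    rw [map_mul, hφ, hφ, pderiv_mul, pderiv_X_self, pderiv_X_of_ne (by decide), mul_zero,
      add_zero, one_mul, ← hφ 1, AlgEquiv.apply_symm_apply]

end Polynomials

/-! ## Homogeneous components of matrices -/

section Components

variable {n : ℕ} {a : Fin n → ℤ} {d : ℤ}

theorem weightedHomogeneousComponent_mul_left {q f : MvPolynomial (Fin n) ℂ} {D D' : ℤ}
    (hq : IsWeightedHomogeneous a q D) :
    weightedHomogeneousComponent a (D + D') (q * f) = q * weightedHomogeneousComponent a D' f := by
  induction f using MvPolynomial.induction_on' with
  | monomial m c =>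
    have h1 := isWeightedHomogeneous_monomial (R := ℂ) a m c rfl
    rw [weightedHomogeneousComponent_of_mem (hq.mul h1), weightedHomogeneousComponent_of_mem h1]
    by_cases h : D' = Finsupp.weight a m
    · rw [if_pos (by rw [h]), if_pos h]
    · rw [if_neg (by simpa using h), if_neg h, mul_zero]
  | add f g hf hg => rw [mul_add, map_add, map_add, hf, hg, mul_add]

theorem weightedHomogeneousComponent_mul_right {q f : MvPolynomial (Fin n) ℂ} {D D' : ℤ}
    (hq : IsWeightedHomogeneous a q D) :
    weightedHomogeneousComponent a (D' + D) (f * q) = weightedHomogeneousComponent a D' f * q := by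
  rw [mul_comm, add_comm, weightedHomogeneousComponent_mul_left hq, mul_comm]

variable (a d) in
/-- The component of a matrix which is homogeneous of cohomological degree `k`. -/
noncomputable def hproj (k : ℤ) (P Q : GrFree) (f : Matrix Q.ι P.ι (MvPolynomial (Fin n) ℂ)) :
    Matrix Q.ι P.ι (MvPolynomial (Fin n) ℂ) := fun j i =>
  if 2 ∣ ((P.par i).val : ℤ) + k - (Q.par j).val then
    weightedHomogeneousComponent a
      (Q.deg j + (((P.par i).val : ℤ) + k - (Q.par j).val) / 2 * d - P.deg i) (f j i)
  else 0

variable {k l : ℤ} {P Q R : GrFree}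

theorem hproj_apply_of_eq {f : Matrix Q.ι P.ι (MvPolynomial (Fin n) ℂ)} {i : P.ι} {j : Q.ι}
    {m : ℤ} (h : ((P.par i).val : ℤ) + k = (Q.par j).val + 2 * m) :
    hproj a d k P Q f j i =
      weightedHomogeneousComponent a (Q.deg j + m * d - P.deg i) (f j i) := by
  rw [hproj, if_pos ⟨m, by linarith⟩, show (((P.par i).val : ℤ) + k - (Q.par j).val) / 2 = m by omega]

theorem hproj_apply_of_ne {f : Matrix Q.ι P.ι (MvPolynomial (Fin n) ℂ)} {i : P.ι} {j : Q.ι}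
    (h : ∀ m : ℤ, ((P.par i).val : ℤ) + k ≠ (Q.par j).val + 2 * m) :
    hproj a d k P Q f j i = 0 := by
  rw [hproj, if_neg]
  rintro ⟨m, hm⟩
  exact h m (by linarith)

theorem isHomog_hproj (f : Matrix Q.ι P.ι (MvPolynomial (Fin n) ℂ)) :
    IsHomog a d k P Q (hproj a d k P Q f) := fun j i =>
  ⟨fun m hm => by
    rw [hproj_apply_of_eq hm]
    apply weightedHomogeneousComponent_isWeightedHomogeneous, hproj_apply_of_ne⟩

theorem hproj_of_isHomog {f : Matrix Q.ι P.ι (MvPolynomial (Fin n) ℂ)} (hf : IsHomog a d k P Q f) :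
    hproj a d k P Q f = f := by
  ext1 j i
  by_cases h : ∃ m : ℤ, ((P.par i).val : ℤ) + k = (Q.par j).val + 2 * m
  · obtain ⟨m, hm⟩ := h
    rw [hproj_apply_of_eq hm]
    exact weightedHomogeneousComponent_eq_self ((hf j i).1 m hm)
  · push Not at h
    rw [hproj_apply_of_ne h, (hf j i).2 h]

theorem hproj_add (f g : Matrix Q.ι P.ι (MvPolynomial (Fin n) ℂ)) :
    hproj a d k P Q (f + g) = hproj a d k P Q f + hproj a d k P Q g := by
  ext1 j i
  rw [Matrix.add_apply]
  simp only [hproj]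
  split_ifs
  · rw [Matrix.add_apply, map_add]
  · rw [add_zero]

/-- Taking components is linear over homogeneous matrices. This allows equations to be solved
without regard to the grading, and the solutions to be made homogeneous afterwards. -/
theorem hproj_mul_left {g : Matrix R.ι Q.ι (MvPolynomial (Fin n) ℂ)} (hg : IsHomog a d l Q R g)
    (f : Matrix Q.ι P.ι (MvPolynomial (Fin n) ℂ)) {m : ℤ} (hm : l + k = m) :
    hproj a d m P R (g * f) = g * hproj a d k P Q f := by
  subst hm
  ext1 r i
  rw [Matrix.mul_apply]
  by_cases h : ∃ m : ℤ, ((P.par i).val : ℤ) + (l + k) = (R.par r).val + 2 * m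
  · obtain ⟨m, hm⟩ := h
    rw [hproj_apply_of_eq hm, Matrix.mul_apply, map_sum]
    refine Finset.sum_congr rfl fun j _ => ?_
    by_cases h : ∃ m₁ : ℤ, ((P.par i).val : ℤ) + k = (Q.par j).val + 2 * m₁
    · obtain ⟨m₁, h₁⟩ := h
      rw [hproj_apply_of_eq h₁,
        ← weightedHomogeneousComponent_mul_left ((hg r j).1 (m - m₁) (by linarith))]
      congr 1
      ring_nf
    · push Not at h
      rw [hproj_apply_of_ne h, (hg r j).2 (fun m₂ h₂ => h (m - m₂) (by linarith)), zero_mul,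
        map_zero, mul_zero]
  · push Not at h
    rw [hproj_apply_of_ne h]
    refine (Finset.sum_eq_zero fun j _ => ?_).symm
    by_cases h' : ∃ m₁ : ℤ, ((P.par i).val : ℤ) + k = (Q.par j).val + 2 * m₁
    · obtain ⟨m₁, h₁⟩ := h'
      rw [(hg r j).2 (fun m₂ h₂ => h (m₁ + m₂) (by linarith)), zero_mul]
    · push Not at h'
      rw [hproj_apply_of_ne h', mul_zero]

theorem hproj_mul_right {g : Matrix Q.ι P.ι (MvPolynomial (Fin n) ℂ)} (hg : IsHomog a d l P Q g)
    (f : Matrix R.ι Q.ι (MvPolynomial (Fin n) ℂ)) {m : ℤ} (hm : k + l = m) :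
    hproj a d m P R (f * g) = hproj a d k Q R f * g := by
  subst hm
  ext1 r i
  rw [Matrix.mul_apply]
  by_cases h : ∃ m : ℤ, ((P.par i).val : ℤ) + (k + l) = (R.par r).val + 2 * m
  · obtain ⟨m, hm⟩ := h
    rw [hproj_apply_of_eq hm, Matrix.mul_apply, map_sum]
    refine Finset.sum_congr rfl fun j _ => ?_
    by_cases h : ∃ m₁ : ℤ, ((P.par i).val : ℤ) + l = (Q.par j).val + 2 * m₁
    · obtain ⟨m₁, h₁⟩ := h
      rw [hproj_apply_of_eq (m := m - m₁) (by linarith),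
        ← weightedHomogeneousComponent_mul_right ((hg j i).1 m₁ h₁)]
      congr 1
      ring_nf
    · push Not at h
      rw [(hg j i).2 h, mul_zero, map_zero, mul_zero]
  · push Not at h
    rw [hproj_apply_of_ne h]
    refine (Finset.sum_eq_zero fun j _ => ?_).symm
    by_cases h' : ∃ m₁ : ℤ, ((P.par i).val : ℤ) + l = (Q.par j).val + 2 * m₁
    · obtain ⟨m₁, h₁⟩ := h'
      rw [hproj_apply_of_ne (fun m₂ h₂ => h (m₁ + m₂) (by linarith)), zero_mul]
    · push Not at h'
      rw [(hg j i).2 h', mul_zero]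

end Components

/-! ### Homotopies and contractible factorizations -/

section Homotopies

variable {n : ℕ} {a : Fin n → ℤ} {d : ℤ} {W : MvPolynomial (Fin n) ℂ}

/-- A homotopy need not be homogeneous. -/
theorem homMk_eq_zero_iff {P Q : HMF a d W} {f : Matrix Q.ι P.ι (MvPolynomial (Fin n) ℂ)} {hf hc} :
    (homMk f hf hc : P ⟶ Q) = 0 ↔
      ∃ h : Matrix Q.ι P.ι (MvPolynomial (Fin n) ℂ), f = Q.p * h + h * P.p := by
  rw [eq_comm, zero_eq_mk, mk_eq_mk_iff]
  simp only [sub_zero]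
  -- As `f` has degree 0 and the differentials have degree 1, only the component of `h` of degree
  -- `-1` contributes to the equation.
  refine ⟨fun ⟨h, _, e⟩ => ⟨h, e⟩, fun ⟨h, e⟩ => ⟨hproj a d (-1) _ _ h, isHomog_hproj h, ?_⟩⟩
  rw [← hproj_of_isHomog hf, ← hproj_mul_left (k := -1) Q.p_homog h (by norm_num : (1 : ℤ) + -1 = 0),
    ← hproj_mul_right (k := -1) P.p_homog h (by norm_num : (-1 : ℤ) + 1 = 0), ← hproj_add]
  exact congrArg _ e

theorem isZero_iff {P : HMF a d W} :
    IsZero P ↔ ∃ h : Matrix P.ι P.ι (MvPolynomial (Fin n) ℂ), 1 = P.p * h + h * P.p := by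
  rw [IsZero.iff_id_eq_zero, id_eq_mk, homMk_eq_zero_iff]

/-- By the Leibniz rule applied to `p * p = W`, the entrywise derivative of `p` is a homotopy
between `∂W = c` and zero; dividing by `c` contracts `P`. -/
theorem isZero_of_pderiv {i : Fin n} {c : ℂ} (hc : c ≠ 0) (h : pderiv i W = C c) (P : HMF a d W) :
    IsZero P := by
  refine isZero_iff.2 ⟨(C c⁻¹ : MvPolynomial (Fin n) ℂ) • P.p.map (pderiv i), ?_⟩
  have h1 : P.p * P.p.map (pderiv i) + P.p.map (pderiv i) * P.p =
      (C c : MvPolynomial (Fin n) ℂ) • (1 : Matrix P.ι P.ι (MvPolynomial (Fin n) ℂ)) := by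
    ext1 s t
    have := congrArg (pderiv i) (congrFun (congrFun P.p_mul_p s) t)
    rw [Matrix.mul_apply, map_sum] at this
    simp only [pderiv_mul, Finset.sum_add_distrib] at this
    rw [Matrix.add_apply, Matrix.mul_apply, Matrix.mul_apply, add_comm]
    refine this.trans ?_
    rw [Matrix.smul_apply, Matrix.smul_apply, Matrix.one_apply]
    split_ifs <;> simp [h]
  rw [Matrix.mul_smul, Matrix.smul_mul, ← smul_add, h1, smul_smul, ← C_mul,
    inv_mul_cancel₀ hc, C_1, one_smul]

end Homotopies

/-! ### Reduction to constant terms -/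

section Constants

variable {n : ℕ} {a : Fin n → ℤ} {d : ℤ} {W : MvPolynomial (Fin n) ℂ}

theorem constantCoeff_weightedHomogeneousComponent_zero (q : MvPolynomial (Fin n) ℂ) :
    constantCoeff (weightedHomogeneousComponent a 0 q) = constantCoeff q := by
  rw [constantCoeff_eq, coeff_weightedHomogeneousComponent, map_zero, if_pos rfl]

theorem constantCoeff_weightedHomogeneousComponent_of_eq_zero {q : MvPolynomial (Fin n) ℂ}
    (hq : constantCoeff q = 0) (D : ℤ) :
    constantCoeff (weightedHomogeneousComponent a D q) = 0 := by
  rw [constantCoeff_eq] at hq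
  rw [constantCoeff_eq, coeff_weightedHomogeneousComponent, hq, ite_self]

/-- In each term of the Leibniz expansion the differences of the degrees of generators cancel along
the permutation, and the same cancellation of parities makes the multiples of `d` add up to zero. -/
theorem isWeightedHomogeneous_det {P : GrFree} {f : Matrix P.ι P.ι (MvPolynomial (Fin n) ℂ)}
    (hf : IsHomog a d 0 P P f) : IsWeightedHomogeneous a f.det 0 := by
  rw [Matrix.det_apply]
  refine IsWeightedHomogeneous.sum _ _ _ fun σ _ => ?_
  have key : IsWeightedHomogeneous a (∏ i, f (σ i) i) 0 := by
    by_cases h : ∀ i, ∃ m : ℤ, ((P.par i).val : ℤ) + 0 = (P.par (σ i)).val + 2 * m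
    · choose m hm using h
      have := IsWeightedHomogeneous.prod Finset.univ (fun i => f (σ i) i) _
        (fun i _ => (hf (σ i) i).1 (m i) (hm i))
      convert this using 1
      have h1 : ∑ i, P.deg (σ i) = ∑ i, P.deg i := Equiv.sum_comp σ P.deg
      have h2 : ∑ i, ((P.par (σ i)).val : ℤ) = ∑ i, ((P.par i).val : ℤ) :=
        Equiv.sum_comp σ fun i => ((P.par i).val : ℤ)
      have h3 : ∑ i, m i = 0 := by
        have := Finset.sum_congr rfl fun i (_ : i ∈ Finset.univ) => hm i
        rw [Finset.sum_add_distrib, Finset.sum_add_distrib, h2, ← Finset.mul_sum] at this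
        simpa using this
      rw [Finset.sum_sub_distrib, Finset.sum_add_distrib, h1, ← Finset.sum_mul, h3]
      ring
    · push Not at h
      obtain ⟨i, hi⟩ := h
      have : ∏ i, f (σ i) i = 0 :=
        Finset.prod_eq_zero (Finset.mem_univ i) ((hf (σ i) i).2 hi)
      exact this ▸ isWeightedHomogeneous_zero _ _ _
  rcases Int.units_eq_one_or (Equiv.Perm.sign σ) with h | h <;> rw [h]
  · rwa [one_smul]
  · rw [Units.neg_smul, one_smul]; exact key.neg

/-- Diagonal entries are projected to weight zero, which keeps their constants; the other entries
have no constant term to lose. -/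
theorem map_constantCoeff_hproj {P : GrFree} {f : Matrix P.ι P.ι (MvPolynomial (Fin n) ℂ)}
    (hf : f.map constantCoeff = 1) : (hproj a d 0 P P f).map constantCoeff = 1 := by
  ext1 j i
  have hji := congrFun (congrFun hf j) i
  rw [Matrix.map_apply] at hji ⊢
  by_cases hij : j = i
  · subst hij
    rw [hproj_apply_of_eq (m := 0) (by simp), zero_mul, add_zero, sub_self,
      constantCoeff_weightedHomogeneousComponent_zero, hji]
  · rw [Matrix.one_apply_ne hij] at hji ⊢
    simp only [hproj]
    split_ifs
    · exact constantCoeff_weightedHomogeneousComponent_of_eq_zero hji _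
    · exact map_zero _

/-- Let `g` be a generalized inverse, `p g p = p`. Then `1 - g p` maps into the kernel of `p`, which
is contained in the image, and `p g` is the identity there. Hence `g (1 - g p)` is a contraction. -/
theorem exists_contraction {ι : Type*} [Fintype ι] [DecidableEq ι] (p : Matrix ι ι ℂ)
    (h : ∀ x, p.mulVec x = 0 → ∃ y, x = p.mulVec y) (hp : p * p = 0) :
    ∃ h : Matrix ι ι ℂ, p * h + h * p = 1 := by
  obtain ⟨g, hg⟩ : ∃ g : Matrix ι ι ℂ, p * g * p = p := by
    let f := Matrix.toLin' p
    obtain ⟨s, hs⟩ := f.rangeRestrict.exists_rightInverse_of_surjective f.range_rangeRestrict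
    obtain ⟨s', hs'⟩ := LinearMap.exists_extend s
    refine ⟨LinearMap.toMatrix' s', Matrix.toLin'.injective ?_⟩
    rw [Matrix.toLin'_mul, Matrix.toLin'_mul, Matrix.toLin'_toMatrix']
    refine LinearMap.ext fun x => ?_
    have h1 : s' (f x) = s ⟨f x, LinearMap.mem_range_self f x⟩ :=
      LinearMap.congr_fun hs' ⟨f x, LinearMap.mem_range_self f x⟩
    have h2 := congrArg Subtype.val (LinearMap.congr_fun hs ⟨f x, LinearMap.mem_range_self f x⟩)
    change f (s' (f x)) = f x
    rw [h1]
    exact h2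
  have h1 : p * g * (1 - g * p) = 1 - g * p := by
    refine Matrix.ext_of_mulVec_single fun i => ?_
    obtain ⟨y, hy⟩ := h ((1 - g * p).mulVec (Pi.single i 1)) (by
      rw [Matrix.mulVec_mulVec, Matrix.mul_sub, Matrix.mul_one, ← Matrix.mul_assoc, hg, sub_self,
        Matrix.zero_mulVec])
    rw [← Matrix.mulVec_mulVec, hy, Matrix.mulVec_mulVec, hg]
  refine ⟨g * (1 - g * p), ?_⟩
  rw [← Matrix.mul_assoc, h1, Matrix.mul_assoc g, Matrix.sub_mul, Matrix.mul_assoc g p p, hp]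
  simp

variable (E : HMF a d W)

/-- The constant term of the matrix of a factorization. -/
noncomputable def const : Matrix E.ι E.ι ℂ := E.p.map constantCoeff

theorem const_mul_const (hW : constantCoeff W = 0) : const E * const E = 0 := by
  rw [const, ← Matrix.map_mul, E.p_mul_p]
  ext1 i j
  rw [Matrix.map_apply, Matrix.smul_apply, smul_eq_mul, map_mul, hW, zero_mul, Matrix.zero_apply]

theorem constantCoeff_mulVec (x : E.ι → MvPolynomial (Fin n) ℂ) :
    (fun i => constantCoeff (E.p.mulVec x i)) =
      (const E).mulVec (fun i => constantCoeff (x i)) := by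
  funext i
  simp [Matrix.mulVec, dotProduct, const]

/-- A factorization is zero if its constant term is exact. -/
theorem isZero_of_exact (ha : ∀ i, 0 < a i) (hW : constantCoeff W = 0)
    (hE : ∀ x, (const E).mulVec x = 0 → ∃ y, x = (const E).mulVec y) : IsZero E := by
  obtain ⟨h, hh⟩ := exists_contraction (const E) hE (const_mul_const E hW)
  -- The contraction of the constant term is lifted to a homogeneous matrix. The resulting `M` is
  -- only the identity at the origin, and is then inverted.
  let H := hproj a d (-1) E.toGrFree E.toGrFree (h.map C)
  have hH : hproj a d 0 E.toGrFree E.toGrFree (E.p * h.map C + h.map C * E.p) =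
      E.p * H + H * E.p := by
    rw [hproj_add, hproj_mul_left (k := -1) E.p_homog _ (by norm_num),
      hproj_mul_right (k := -1) E.p_homog _ (by norm_num)]
  have h1 : (E.p * h.map C + h.map C * E.p).map constantCoeff =
      (1 : Matrix E.ι E.ι ℂ) := by
    have h2 : ((h.map C : Matrix E.ι E.ι (MvPolynomial (Fin n) ℂ))).map constantCoeff = h := by
      ext1 i j; simp
    rw [Matrix.map_add _ (map_add _), Matrix.map_mul, Matrix.map_mul, h2]
    exact hh
  set M := E.p * H + H * E.p with hM
  have h2 : M.map constantCoeff = 1 := by rw [← hH]; exact map_constantCoeff_hproj h1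
  -- The determinant has weight zero, so it is a constant and can be read off at the origin.
  have h3 : M.det = 1 := by
    rw [eq_C_of_isWeightedHomogeneous_zero ha
      (isWeightedHomogeneous_det (by rw [← hH]; exact isHomog_hproj _) :
        IsWeightedHomogeneous a M.det 0), RingHom.map_det, RingHom.mapMatrix_apply, h2,
      Matrix.det_one, C_1]
  have hdet : IsUnit M.det := by rw [h3]; exact isUnit_one
  -- Both sides equal `p H p` plus the central term `W H`; so `p` commutes with the inverse of `M`
  -- as well, and `H * M⁻¹` contracts `E`.
  have h4 : M * E.p = E.p * M := by
    rw [hM, Matrix.add_mul, Matrix.mul_add, Matrix.mul_assoc H, ← Matrix.mul_assoc E.p E.p,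
      E.p_mul_p, add_comm, Matrix.mul_assoc]
    simp
  have h5 : M⁻¹ * E.p = E.p * M⁻¹ := by
    calc M⁻¹ * E.p = M⁻¹ * (E.p * M) * M⁻¹ := by
          rw [Matrix.mul_assoc, Matrix.mul_assoc, Matrix.mul_nonsing_inv _ hdet, Matrix.mul_one]
      _ = E.p * M⁻¹ := by
          rw [← h4, ← Matrix.mul_assoc, Matrix.nonsing_inv_mul _ hdet, Matrix.one_mul]
  refine isZero_iff.2 ⟨H * M⁻¹, ?_⟩
  rw [Matrix.mul_assoc, h5, ← Matrix.mul_assoc, ← Matrix.mul_assoc, ← Matrix.add_mul, ← hM,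
    Matrix.mul_nonsing_inv _ hdet]

end Constants

/-! ## Morphisms from factorizations of rank one -/

section RankOne

variable {a : Fin 2 → ℤ} {d : ℤ} {W : MvPolynomial (Fin 2) ℂ}
  {u : Fin 2 → MvPolynomial (Fin 2) ℂ}

/-- If `e` is a cycle modulo `u 0` whose constant term is a boundary, then `e` is a boundary
modulo `u 0`. -/
theorem exists_boundary
    (hb : Function.Bijective (aeval u : MvPolynomial (Fin 2) ℂ →ₐ[ℂ] MvPolynomial (Fin 2) ℂ))
    (hc : ∀ k, constantCoeff (u k) = 0) (huW : W = u 0 * u 1) (E : HMF a d W)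
    {e e' : E.ι → MvPolynomial (Fin 2) ℂ} (he : E.p.mulVec e = u 0 • e') {y : E.ι → ℂ}
    (hy : (fun i => constantCoeff (e i)) = (const E).mulVec y) :
    ∃ g g', e = E.p.mulVec g + u 0 • g' := by
  have hpp : ∀ x, E.p.mulVec (E.p.mulVec x) = (u 0 * u 1) • x := fun x => by
    rw [Matrix.mulVec_mulVec, E.p_mul_p, Matrix.smul_mulVec, Matrix.one_mulVec]
    exact congrArg (· • x) huW
  -- Subtracting the boundary of this constant lift of `y` leaves entries in the ideal generated by
  -- `u 0` and `u 1`.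
  let Y : E.ι → MvPolynomial (Fin 2) ℂ := fun i => C (y i)
  have h1 : ∀ i, constantCoeff ((e - E.p.mulVec Y) i) = 0 := fun i => by
    have h2 := congrFun (constantCoeff_mulVec E Y) i
    have h3 := congrFun hy i
    simp only [Y, constantCoeff_C] at h2
    rw [Pi.sub_apply, map_sub, h2, sub_eq_zero]
    exact h3
  choose b c hbc using fun i => exists_eq_mul_add_mul hb hc (h1 i)
  have h2 : e = E.p.mulVec Y + u 0 • b + u 1 • c := by
    funext i
    have := hbc i
    simp only [Pi.sub_apply, Pi.add_apply, Pi.smul_apply, smul_eq_mul] at this ⊢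
    linear_combination this
  -- Applying `p` to the expression for `e` shows that `u 1 • p c` is divisible by `u 0`, and `u 1`
  -- is regular modulo `u 0`.
  have h3 : ∀ i, u 0 ∣ E.p.mulVec c i := fun i => by
    refine dvd_of_dvd_mul hb ⟨(e' - u 1 • Y - E.p.mulVec b) i, ?_⟩
    have := congrFun he i
    rw [h2, Matrix.mulVec_add, Matrix.mulVec_add, hpp, Matrix.mulVec_smul, Matrix.mulVec_smul] at this
    simp only [Pi.sub_apply, Pi.add_apply, Pi.smul_apply, smul_eq_mul] at this ⊢
    linear_combination this
  choose c' hc' using h3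
  obtain ⟨δ, hδ, hδW⟩ := exists_derivation hb
  -- The derivative of `p` along `u 0` is a homotopy from `u 1` to zero. As `c` is a cycle modulo `u
  -- 0`, the vector `u 1 • c` is therefore a boundary modulo `u 0`.
  have h4 : E.p * E.p.map δ + E.p.map δ * E.p =
      u 1 • (1 : Matrix E.ι E.ι (MvPolynomial (Fin 2) ℂ)) := by
    ext1 s t
    have := congrArg δ (congrFun (congrFun E.p_mul_p s) t)
    rw [Matrix.mul_apply, map_sum] at this
    simp only [hδ, Finset.sum_add_distrib] at this
    rw [Matrix.add_apply, Matrix.mul_apply, Matrix.mul_apply]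
    refine this.trans ?_
    rw [Matrix.smul_apply, Matrix.smul_apply, Matrix.one_apply]
    split_ifs <;> simp [huW, hδW]
  have h5 : u 1 • c = E.p.mulVec ((E.p.map δ).mulVec c) + u 0 • (E.p.map δ).mulVec c' := by
    have h6 : E.p.mulVec c = u 0 • c' := funext hc'
    rw [← Matrix.mulVec_smul, ← h6, Matrix.mulVec_mulVec, Matrix.mulVec_mulVec, ← Matrix.add_mulVec,
      h4, Matrix.smul_mulVec, Matrix.one_mulVec]
  refine ⟨Y + (E.p.map δ).mulVec c, b + (E.p.map δ).mulVec c', ?_⟩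
  rw [h2, h5, Matrix.mulVec_add, smul_add]
  abel

/-! ### Morphisms out of a rank one factorization as cycles modulo a factor -/

section Columns

/-- The first column of a morphism is a cycle modulo `u`, witnessed by the second column. The factor
`ε` stands for the sign that shifting puts on the differential. -/
theorem mulVec_col_zero {ι R : Type*} [Fintype ι] [CommRing R] {ε u v : R} {p : Matrix ι ι R} {f : Matrix ι (Fin 2) R}
    (h : f * (ε • !![0, v; u, 0]) = p * f) :
    p.mulVec (fun i => f i 0) = u • fun i => ε * f i 1 := by
  funext i
  have := congrFun (congrFun h i) 0
  simp only [Matrix.mul_apply, Fin.sum_univ_two] at this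
  simp only [Matrix.mulVec, dotProduct, Pi.smul_apply, smul_eq_mul]
  rw [← this]
  simp
  ring

variable {ι R : Type*} [Fintype ι] [DecidableEq ι] [CommRing R] [IsDomain R] {ε u v : R}
  {p : Matrix ι ι R}

/-- Every cycle modulo `u` is the first column of a morphism: the condition on the second column
follows by applying `p` once more and cancelling `u`. -/
theorem mul_eq_mul_of_col (hu : u ≠ 0) (hε : ε * ε = 1) (hp : p * p = (u * v) • (1 : Matrix ι ι R))
    {b b' : ι → R} (h : p.mulVec b = u • b') :
    (Matrix.of fun i => ![b i, ε * b' i]) * (ε • !![0, v; u, 0]) =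
      p * (Matrix.of fun i => ![b i, ε * b' i]) := by
  have h' : p.mulVec b' = v • b := by
    have h1 : p.mulVec (p.mulVec b) = (u * v) • b := by
      rw [Matrix.mulVec_mulVec, hp, Matrix.smul_mulVec, Matrix.one_mulVec]
    rw [h, Matrix.mulVec_smul, mul_smul] at h1
    exact smul_right_injective _ hu h1
  ext i j
  have h1 := congrFun h i
  have h2 := congrFun h' i
  simp only [Matrix.mulVec, dotProduct, Pi.smul_apply, smul_eq_mul] at h1 h2
  simp only [Matrix.mul_apply, Fin.sum_univ_two]
  fin_cases j
  · simp [h1]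
    linear_combination (u * b' i) * hε
  · simp [mul_left_comm _ ε, ← Finset.mul_sum, h2]
    exact Or.inl (mul_comm _ _)

/-- A boundary modulo `u` in the first column determines the whole homotopy, since the second column
is again recovered by cancelling `u`. -/
theorem eq_homotopy_of_col (hu : u ≠ 0) (hε : ε * ε = 1)
    (hp : p * p = (u * v) • (1 : Matrix ι ι R)) {f : Matrix ι (Fin 2) R}
    (h : f * (ε • !![0, v; u, 0]) = p * f) {g g' : ι → R}
    (hg : (fun i => f i 0) = p.mulVec g + u • g') :
    f = p * (Matrix.of fun i => ![g i, ε * g' i]) +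
      (Matrix.of fun i => ![g i, ε * g' i]) * (ε • !![0, v; u, 0]) := by
  have h1 := mulVec_col_zero h
  rw [hg, Matrix.mulVec_add, Matrix.mulVec_mulVec, hp, Matrix.smul_mulVec, Matrix.one_mulVec,
    Matrix.mulVec_smul, mul_smul, ← smul_add] at h1
  have h2 := smul_right_injective _ hu h1
  ext i j
  have h3 := congrFun h2 i
  have h4 := congrFun hg i
  simp only [Matrix.mulVec, dotProduct, Pi.smul_apply, Pi.add_apply, smul_eq_mul] at h3 h4
  simp only [Matrix.add_apply, Matrix.mul_apply, Fin.sum_univ_two]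
  fin_cases j
  · simp [h4]
    linear_combination (-u * g' i) * hε
  · simp [mul_left_comm _ ε, ← Finset.mul_sum]
    linear_combination (-ε) * h3 - f i 1 * hε

end Columns

end RankOne

/-! ### The objects `L(j)[k]` and the detection of zero objects -/

section Line

theorem hproj_comm {n : ℕ} {a : Fin n → ℤ} {d : ℤ} {W : MvPolynomial (Fin n) ℂ} {P Q : HMF a d W}
    {f : Matrix Q.ι P.ι (MvPolynomial (Fin n) ℂ)} (h : f * P.p = Q.p * f) :
    hproj a d 0 P.toGrFree Q.toGrFree f * P.p = Q.p * hproj a d 0 P.toGrFree Q.toGrFree f := by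
  rw [← hproj_mul_right (k := 0) (m := 1) P.p_homog f (by norm_num),
    ← hproj_mul_left (k := 0) (m := 1) Q.p_homog f (by norm_num), h]

variable {a : Fin 2 → ℤ} {d : ℤ} {W : MvPolynomial (Fin 2) ℂ}
  {u : Fin 2 → MvPolynomial (Fin 2) ℂ} (hu : ∀ i, IsWeightedHomogeneous a (u i) (a i))
  (hd : d = a 0 + a 1) (huW : W = u 0 * u 1)

/-- The object `L(j)[k]`, for `s = (j, k)`. -/
noncomputable abbrev line (s : ℤ × ℤ) : HMF a d W :=
  shiftObj s.2 (rankOne (hu 0) (hu 1) hd huW s.1)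

variable (u) in
/-- The matrix of a factorization of rank one. -/
noncomputable abbrev lineMatrix : Matrix (Fin 2) (Fin 2) (MvPolynomial (Fin 2) ℂ) :=
  !![0, u 1; u 0, 0]

/-- The sign of the differential of `L(j)[k]`. -/
noncomputable def sgn (k : ℤ) : MvPolynomial (Fin 2) ℂ := ((k.negOnePow : ℤ) : MvPolynomial (Fin 2) ℂ)

theorem sgn_mul_sgn (k : ℤ) : sgn k * sgn k = 1 := by
  rw [sgn]
  rcases Int.units_eq_one_or k.negOnePow with h | h <;> rw [h] <;> simp

theorem line_p (s : ℤ × ℤ) : (line hu hd huW s).p =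
    (sgn s.2 • lineMatrix u : Matrix (Fin 2) (Fin 2) (MvPolynomial (Fin 2) ℂ)) := by
  change (s.2.negOnePow • lineMatrix u : Matrix (Fin 2) (Fin 2) (MvPolynomial (Fin 2) ℂ)) = _
  rw [sgn]
  rcases Int.units_eq_one_or s.2.negOnePow with h | h <;> rw [h] <;> simp

theorem constantCoeff_line_p (hc : ∀ k, constantCoeff (u k) = 0) (s : ℤ × ℤ) :
    const (line hu hd huW s) = 0 := by
  rw [const, line_p]
  change (sgn s.2 • lineMatrix u : Matrix (Fin 2) (Fin 2) (MvPolynomial (Fin 2) ℂ)).map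
    constantCoeff = 0
  ext1 i j
  fin_cases i <;> fin_cases j <;> simp [hc]

/-- A morphism `L(j)[k] → E` is zero if and only if its constant term is a boundary. -/
theorem homMk_line_eq_zero_iff
    (hb : Function.Bijective (aeval u : MvPolynomial (Fin 2) ℂ →ₐ[ℂ] MvPolynomial (Fin 2) ℂ))
    (hc : ∀ k, constantCoeff (u k) = 0) (hne : u 0 ≠ 0) (s : ℤ × ℤ) {E : HMF a d W}
    {f : Matrix E.ι (Fin 2) (MvPolynomial (Fin 2) ℂ)} {hf hf'} :
    (homMk (P := line hu hd huW s) f hf hf' : line hu hd huW s ⟶ E) = 0 ↔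
      (fun i => constantCoeff (f i 0)) ∈ LinearMap.range (const E).mulVecLin := by
  have hf'' : f * (sgn s.2 • lineMatrix u) = E.p * f := by
    have := hf'
    rw [line_p] at this
    exact this
  refine homMk_eq_zero_iff.trans ⟨?_, ?_⟩
  · rintro ⟨h, e⟩
    obtain ⟨h, e⟩ : ∃ h : Matrix E.ι (Fin 2) (MvPolynomial (Fin 2) ℂ),
        f = E.p * h + h * (sgn s.2 • lineMatrix u) := ⟨h, by
      rw [line_p] at e
      exact e⟩
    refine ⟨fun i => constantCoeff (h i 0), ?_⟩
    refine (constantCoeff_mulVec E fun i => h i 0).symm.trans (funext fun i => ?_)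
    -- The first column of `h` times the differential of `L(s)` is a multiple of `u 0`, so it has no
    -- constant term.
    rw [e, Matrix.add_apply, map_add, Matrix.mul_apply (M := h), Fin.sum_univ_two]
    simp [hc]
    simp [Matrix.mul_apply, Matrix.mulVec, dotProduct]
  · rintro ⟨y, hy⟩
    have h1 := mulVec_col_zero hf''
    obtain ⟨g, g', hg⟩ := exists_boundary hb hc huW E h1 (y := y) hy.symm
    refine ⟨(Matrix.of fun i => ![g i, sgn s.2 * g' i] : Matrix E.ι (Fin 2) _), ?_⟩
    have hp : E.p * E.p = (u 0 * u 1) • (1 : Matrix E.ι E.ι (MvPolynomial (Fin 2) ℂ)) :=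
      E.p_mul_p.trans (congrArg (· • (1 : Matrix E.ι E.ι (MvPolynomial (Fin 2) ℂ))) huW)
    have h2 := eq_homotopy_of_col hne (sgn_mul_sgn s.2) hp hf'' hg
    rw [line_p]
    exact h2

/-- The number `s` such that the `i`-th summand of `E` is of the type of the first summand of
`L(s)`. -/
def lineIdx (a : Fin 2 → ℤ) (d : ℤ) (E : GrFree) (i : E.ι) : ℤ × ℤ :=
  ((E.deg i + a 0 - (E.par i).val * d) % d,
    (E.par i).val + 2 * ((E.deg i + a 0 - (E.par i).val * d) / d))

theorem shiftIdx_spec_zero (k : ℤ) : (((k : ZMod 2).val : ℕ) : ℤ) + k = 2 * shiftIdx 0 k := by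
  have := shiftIdx_spec 0 k
  rw [zero_add] at this
  simpa using this

/-- Matching the first summand of `L(j)[k]` with a summand of parity `π` and degree `n` means `n + a
0 - π * d = j + q * d` and `k = π + 2 * q` for some `q`. With `0 ≤ j < d` this is division with
remainder. -/
theorem eq_lineIdx (hd0 : 0 < d) {s : ℤ × ℤ} (h0 : 0 ≤ s.1) (h1 : s.1 < d) {E : GrFree} {i : E.ι}
    {m : ℤ} (hm : (((s.2 : ZMod 2).val : ℕ) : ℤ) = (E.par i).val + 2 * m)
    (hD : E.deg i + m * d - (s.1 - a 0 + shiftIdx 0 s.2 * d) = 0) : s = lineIdx a d E i := by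
  have h2 := shiftIdx_spec_zero s.2
  set I := shiftIdx 0 s.2
  have hk : s.2 = (E.par i).val + 2 * (I - m - (E.par i).val) := by linarith
  have hN : E.deg i + a 0 - (E.par i).val * d = s.1 + d * (I - m - (E.par i).val) := by linarith
  refine Prod.ext ?_ ?_
  · change s.1 = _ % d
    rw [hN, Int.add_mul_emod_self_left, Int.emod_eq_of_lt h0 h1]
  · change s.2 = _ + 2 * (_ / d)
    rw [hN, Int.add_mul_ediv_left _ _ hd0.ne', Int.ediv_eq_zero_of_lt h0 h1, zero_add]
    exact hk

theorem lineIdx_mem (hd0 : 0 < d) (E : GrFree) (i : E.ι) :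
    0 ≤ (lineIdx a d E i).1 ∧ (lineIdx a d E i).1 < d :=
  ⟨Int.emod_nonneg _ hd0.ne', Int.emod_lt_of_pos _ hd0⟩

/-- The index `s = lineIdx i` matches the `i`-th summand of `E` in parity and in degree. -/
theorem lineIdx_spec (E : GrFree) (i : E.ι) {s : ℤ × ℤ} (hs : s = lineIdx a d E i) :
    (((s.2 : ZMod 2).val : ℕ) : ℤ) = (E.par i).val + 2 * 0 ∧
    E.deg i + 0 * d - (s.1 - a 0 + shiftIdx 0 s.2 * d) = 0 := by
  have h1 : (s.2 : ZMod 2) = E.par i := by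
    rw [hs, lineIdx]
    push_cast
    rw [ZMod.natCast_zmod_val, show (2 : ZMod 2) = 0 from rfl, zero_mul, add_zero]
  have h2 := shiftIdx_spec_zero s.2
  rw [h1] at h2 ⊢
  refine ⟨by ring, ?_⟩
  rw [hs] at h2 ⊢
  simp only [lineIdx] at h2 ⊢
  have h3 := Int.emod_add_mul_ediv (E.deg i + a 0 - (E.par i).val * d) d
  set q := (E.deg i + a 0 - (E.par i).val * d) / d
  have h4 : shiftIdx 0 ((E.par i).val + 2 * q) = (E.par i).val + q := by linarith
  rw [h4]
  linarith

theorem line_par_zero (s : ℤ × ℤ) : (line hu hd huW s).par (0 : Fin 2) = (s.2 : ZMod 2) :=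
  zero_add _

theorem line_deg_zero (s : ℤ × ℤ) :
    (line hu hd huW s).deg (0 : Fin 2) = s.1 - a 0 + shiftIdx 0 s.2 * d := rfl

/-- A nonzero constant term needs an entry of weight zero, which occurs only between matching
summands. -/
theorem constantCoeff_eq_zero_of_ne (hd0 : 0 < d) {s : ℤ × ℤ} (h0 : 0 ≤ s.1) (h1 : s.1 < d)
    {E : GrFree} {f : Matrix E.ι (Fin 2) (MvPolynomial (Fin 2) ℂ)}
    (hf : IsHomog a d 0 (line hu hd huW s).toGrFree E f) {i : E.ι} (hi : s ≠ lineIdx a d E i) :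
    constantCoeff (f i 0) = 0 := by
  by_cases h : ∃ m : ℤ, (((line hu hd huW s).par (0 : Fin 2)).val : ℤ) + 0 = (E.par i).val + 2 * m
  · obtain ⟨m, hm⟩ := h
    refine constantCoeff_eq_zero_of_isWeightedHomogeneous ((hf i (0 : Fin 2)).1 m hm) fun hD => ?_
    rw [line_par_zero, add_zero] at hm
    exact hi (eq_lineIdx hd0 h0 h1 hm hD)
  · push Not at h
    have := (hf i (0 : Fin 2)).2 h
    exact (congrArg constantCoeff this).trans (map_zero _)

/-- Between matching summands the projection selects weight zero, so the constant survives. -/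
theorem constantCoeff_hproj_line {s : ℤ × ℤ} {E : GrFree}
    (f : Matrix E.ι (Fin 2) (MvPolynomial (Fin 2) ℂ)) {i : E.ι} (hi : s = lineIdx a d E i) :
    constantCoeff (hproj a d 0 (line hu hd huW s).toGrFree E f i (0 : Fin 2)) =
      constantCoeff (f i 0) := by
  obtain ⟨h1, h2⟩ := lineIdx_spec E i hi
  have h3 := hproj_apply_of_eq (a := a) (d := d) (k := 0) (P := (line hu hd huW s).toGrFree)
    (Q := E) (f := f) (i := (0 : Fin 2)) (j := i) (m := 0)
    (by rw [line_par_zero, add_zero]; exact h1)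
  rw [line_deg_zero, h2] at h3
  exact (congrArg constantCoeff h3).trans (constantCoeff_weightedHomogeneousComponent_zero _)

/-- The factorizations `L(s)` detect zero objects. -/
theorem isZero_of_line (ha : ∀ i, 0 < a i)
    (hb : Function.Bijective (aeval u : MvPolynomial (Fin 2) ℂ →ₐ[ℂ] MvPolynomial (Fin 2) ℂ))
    (hc : ∀ k, constantCoeff (u k) = 0) (hne : u 0 ≠ 0) (E : HMF a d W)
    (hE : ∀ s : ℤ × ℤ, 0 ≤ s.1 → s.1 < d → ∀ f : line hu hd huW s ⟶ E, f = 0) : IsZero E := by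
  have hd0 : 0 < d := by have := ha 0; have := ha 1; omega
  have hp : E.p * E.p = (u 0 * u 1) • (1 : Matrix E.ι E.ι (MvPolynomial (Fin 2) ℂ)) :=
    E.p_mul_p.trans (congrArg (· • (1 : Matrix E.ι E.ι (MvPolynomial (Fin 2) ℂ))) huW)
  have hpp : ∀ x, E.p.mulVec (E.p.mulVec x) = (u 0 * u 1) • x := fun x => by
    rw [Matrix.mulVec_mulVec, hp, Matrix.smul_mulVec, Matrix.one_mulVec]
  -- The constant term of a cycle modulo `u 0` is split according to the type of the summands. Each
  -- part is the constant term of a homogeneous morphism `L(s) ⟶ E`, which vanishes by hypothesis.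
  have key : ∀ b b' : E.ι → MvPolynomial (Fin 2) ℂ, E.p.mulVec b = u 0 • b' →
      (fun i => constantCoeff (b i)) ∈ LinearMap.range (const E).mulVecLin := by
    intro b b' h
    have h1 : ∀ s : ℤ × ℤ, 0 ≤ s.1 → s.1 < d →
        (fun i => if s = lineIdx a d E.toGrFree i then constantCoeff (b i) else 0) ∈
          LinearMap.range (const E).mulVecLin := by
      intro s hs0 hs1
      set f : Matrix E.ι (Fin 2) (MvPolynomial (Fin 2) ℂ) :=
        Matrix.of fun i => ![b i, sgn s.2 * b' i] with hf
      have h2 : f * (sgn s.2 • lineMatrix u) = E.p * f :=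
        mul_eq_mul_of_col hne (sgn_mul_sgn s.2) hp h
      let f' : Matrix E.ι (line hu hd huW s).ι (MvPolynomial (Fin 2) ℂ) := f
      have h3 : f' * (line hu hd huW s).p = E.p * f' := by
        rw [line_p]
        exact h2
      have hg := isHomog_hproj (a := a) (d := d) (k := 0) (P := (line hu hd huW s).toGrFree)
        (Q := E.toGrFree) f'
      have h4 := (homMk_line_eq_zero_iff hu hd huW hb hc hne s).1 (hE s hs0 hs1 (homMk _ hg (hproj_comm h3)))
      convert h4 using 2 with i
      split_ifs with hi
      · exact (constantCoeff_hproj_line hu hd huW f hi).symm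
      · exact (constantCoeff_eq_zero_of_ne hu hd huW hd0 hs0 hs1 hg hi).symm
    have h2 : (fun i => constantCoeff (b i)) =
        ∑ s ∈ Finset.univ.image (lineIdx a d E.toGrFree), (fun i =>
          if s = lineIdx a d E.toGrFree i then constantCoeff (b i) else 0) := by
      funext i
      rw [Finset.sum_apply, Finset.sum_ite_eq' , if_pos (Finset.mem_image_of_mem _ (Finset.mem_univ i))]
    rw [h2]
    refine Submodule.sum_mem _ fun s hs => ?_
    obtain ⟨i, -, rfl⟩ := Finset.mem_image.1 hs
    exact h1 _ (lineIdx_mem hd0 _ i).1 (lineIdx_mem hd0 _ i).2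
  have hW : constantCoeff W = 0 := by rw [huW, map_mul, hc, zero_mul]
  -- Let `Y` lift a cycle `x` of the constant term and write `p Y = u 0 • r + u 1 • b`. Then `b` is
  -- a cycle modulo `u 0`, hence a boundary `p c` modulo `u 0`. So `Y - u 1 • c` is a cycle modulo
  -- `u 0` which still has constant term `x`, and `key` applies to it.
  refine isZero_of_exact E ha hW fun x hx => ?_
  let Y : E.ι → MvPolynomial (Fin 2) ℂ := fun i => C (x i)
  have h1 : ∀ i, constantCoeff (E.p.mulVec Y i) = 0 := fun i => by
    have h2 := congrFun (constantCoeff_mulVec E Y) i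
    simp only [Y, constantCoeff_C] at h2
    exact h2.trans (congrFun hx i)
  choose r b hrb using fun i => exists_eq_mul_add_mul hb hc (h1 i)
  have h2 : E.p.mulVec Y = u 0 • r + u 1 • b := funext hrb
  have h3 : ∀ i, u 0 ∣ E.p.mulVec b i := fun i => by
    refine dvd_of_dvd_mul hb ⟨(u 1 • Y - E.p.mulVec r) i, ?_⟩
    have := congrFun (hpp Y) i
    rw [h2, Matrix.mulVec_add, Matrix.mulVec_smul, Matrix.mulVec_smul] at this
    simp only [Pi.sub_apply, Pi.add_apply, Pi.smul_apply, smul_eq_mul] at this ⊢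
    linear_combination this
  choose b' hb' using h3
  have h4 : E.p.mulVec b = u 0 • b' := funext hb'
  obtain ⟨y, hy⟩ := key b b' h4
  obtain ⟨c, c', hcc⟩ := exists_boundary hb hc huW E h4 (y := y) hy.symm
  have h5 : E.p.mulVec (Y - u 1 • c) = u 0 • (r + u 1 • c') := by
    rw [Matrix.mulVec_sub, h2, hcc, Matrix.mulVec_smul]
    funext i
    simp only [Pi.sub_apply, Pi.add_apply, Pi.smul_apply, smul_eq_mul]
    ring
  obtain ⟨z, hz⟩ := key _ _ h5
  refine ⟨z, ?_⟩
  refine Eq.trans (funext fun i => ?_) hz.symm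
  simp [Y, hc]

end Line

/-! ### Scalar endomorphisms -/

section Scalars

variable {n : ℕ} {a : Fin n → ℤ} {d : ℤ} {W : MvPolynomial (Fin n) ℂ}

theorem isHomog_C_smul {k : ℤ} {P Q : GrFree} {f : Matrix Q.ι P.ι (MvPolynomial (Fin n) ℂ)}
    (hf : IsHomog a d k P Q f) (c : ℂ) :
    IsHomog a d k P Q ((C c : MvPolynomial (Fin n) ℂ) • f) := fun j i =>
  ⟨fun m hm => ((hf j i).1 m hm).C_mul c, fun h => by
    rw [Matrix.smul_apply, (hf j i).2 h, smul_zero]⟩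

/-- The multiplication by a scalar. -/
noncomputable def homScalar (P : HMF a d W) (c : ℂ) : P ⟶ P :=
  homMk ((C c : MvPolynomial (Fin n) ℂ) • (1 : Matrix P.ι P.ι (MvPolynomial (Fin n) ℂ)))
    (isHomog_C_smul IsHomog.one c) (by simp)

theorem homScalar_one (P : HMF a d W) : homScalar P 1 = 𝟙 P := by
  refine eq_of_val ?_
  change (C 1 : MvPolynomial (Fin n) ℂ) • (1 : Matrix P.ι P.ι (MvPolynomial (Fin n) ℂ)) = 1
  rw [C_1, one_smul]

theorem homScalar_zero (P : HMF a d W) : homScalar P 0 = 0 := by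
  refine eq_of_val ?_
  change (C 0 : MvPolynomial (Fin n) ℂ) • (1 : Matrix P.ι P.ι (MvPolynomial (Fin n) ℂ)) = 0
  rw [C_0, zero_smul]

theorem homScalar_comp (P : HMF a d W) (c c' : ℂ) :
    homScalar P c ≫ homScalar P c' = homScalar P (c * c') := by
  refine eq_of_val ?_
  change ((C c' : MvPolynomial (Fin n) ℂ) • (1 : Matrix P.ι P.ι (MvPolynomial (Fin n) ℂ))) *
    ((C c : MvPolynomial (Fin n) ℂ) • (1 : Matrix P.ι P.ι (MvPolynomial (Fin n) ℂ))) =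
    (C (c * c') : MvPolynomial (Fin n) ℂ) • (1 : Matrix P.ι P.ι (MvPolynomial (Fin n) ℂ))
  rw [Matrix.smul_mul, Matrix.one_mul, smul_smul, C_mul, mul_comm]

theorem homScalar_comp_homMk {P Q : HMF a d W} (c : ℂ)
    {f : Matrix Q.ι P.ι (MvPolynomial (Fin n) ℂ)} (hf hf') :
    homScalar P c ≫ (homMk f hf hf' : P ⟶ Q) =
      homMk ((C c : MvPolynomial (Fin n) ℂ) • f) (isHomog_C_smul hf c)
        (by rw [Matrix.smul_mul, Matrix.mul_smul, hf']) := by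
  refine eq_of_val ?_
  change f * ((C c : MvPolynomial (Fin n) ℂ) • (1 : Matrix P.ι P.ι (MvPolynomial (Fin n) ℂ))) =
    (C c : MvPolynomial (Fin n) ℂ) • f
  rw [Matrix.mul_smul, Matrix.mul_one]

end Scalars

/-! ### Morphism spaces out of the objects `L(j)[k]` -/

section LineHom

variable {a : Fin 2 → ℤ} {d : ℤ} {W : MvPolynomial (Fin 2) ℂ}
  {u : Fin 2 → MvPolynomial (Fin 2) ℂ} (hu : ∀ i, IsWeightedHomogeneous a (u i) (a i))
  (hd : d = a 0 + a 1) (huW : W = u 0 * u 1)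
  (hb : Function.Bijective (aeval u : MvPolynomial (Fin 2) ℂ →ₐ[ℂ] MvPolynomial (Fin 2) ℂ))
  (hc : ∀ k, constantCoeff (u k) = 0) (hne : u 0 ≠ 0)

/-- The constant term embeds the morphisms `L(s) → E` into a finite-dimensional vector space. -/
theorem exists_class (hb : Function.Bijective (aeval u :
      MvPolynomial (Fin 2) ℂ →ₐ[ℂ] MvPolynomial (Fin 2) ℂ))
    (hc : ∀ k, constantCoeff (u k) = 0) (hne : u 0 ≠ 0) (s : ℤ × ℤ) (E : HMF a d W) :
    ∃ c : (line hu hd huW s ⟶ E) →+ (E.ι → ℂ) ⧸ LinearMap.range (const E).mulVecLin,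
      Function.Injective c ∧ ∀ z f, c (homScalar _ z ≫ f) = z • c f := by
  -- The classes lie in the homology of the constant term, but its cokernel suffices: only
  -- injectivity and finite dimension are needed.
  let V := (E.ι → ℂ) ⧸ LinearMap.range (const E).mulVecLin
  let c : (line hu hd huW s ⟶ E) →+ V := QuotientAddGroup.lift (nullHomotopic (line hu hd huW s) E)
    (AddMonoidHom.mk' (fun f : cocycles (line hu hd huW s) E => (Submodule.Quotient.mk
      (fun i => constantCoeff (f.1 i (0 : Fin 2))) : V)) (fun f g => by
        rw [← Submodule.Quotient.mk_add]
        exact congrArg _ (funext fun i => map_add constantCoeff _ _)))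
    (fun f hf => by
      refine (Submodule.Quotient.mk_eq_zero _).2 ?_
      refine (homMk_line_eq_zero_iff hu hd huW hb hc hne s (hf := f.2.1) (hf' := f.2.2)).1 ?_
      exact (QuotientAddGroup.eq_zero_iff _).2 hf)
  refine ⟨c, ?_, ?_⟩
  · rw [injective_iff_map_eq_zero]
    intro f h
    obtain ⟨f, hf, hf', rfl⟩ := exists_mk f
    exact (homMk_line_eq_zero_iff hu hd huW hb hc hne s).2
      ((Submodule.Quotient.mk_eq_zero (LinearMap.range (const E).mulVecLin)
        (x := fun i => constantCoeff (f i (0 : Fin 2)))).1 h)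
  · intro z f
    obtain ⟨f, hf, hf', rfl⟩ := exists_mk f
    rw [homScalar_comp_homMk]
    change Submodule.Quotient.mk (fun i => constantCoeff (((C z : MvPolynomial (Fin 2) ℂ) • f) i
      (0 : Fin 2))) = z • Submodule.Quotient.mk (fun i => constantCoeff (f i (0 : Fin 2)))
    rw [← Submodule.Quotient.mk_smul]
    congr 1
    funext i
    refine (map_mul constantCoeff (C z) (f i (0 : Fin 2))).trans ?_
    rw [constantCoeff_C]
    rfl

theorem hom_eq_zero_of_ne_lineIdx (hb : Function.Bijective (aeval u :
      MvPolynomial (Fin 2) ℂ →ₐ[ℂ] MvPolynomial (Fin 2) ℂ))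
    (hc : ∀ k, constantCoeff (u k) = 0) (hne : u 0 ≠ 0) (hd0 : 0 < d)
    {s : ℤ × ℤ} (h0 : 0 ≤ s.1) (h1 : s.1 < d) {E : HMF a d W}
    (h : ∀ i, s ≠ lineIdx a d E.toGrFree i) (f : line hu hd huW s ⟶ E) : f = 0 := by
  obtain ⟨f, hf, hf', rfl⟩ := exists_mk f
  refine (homMk_line_eq_zero_iff hu hd huW hb hc hne s).2 ?_
  convert Submodule.zero_mem _ with i
  exact constantCoeff_eq_zero_of_ne hu hd huW hd0 h0 h1 hf (h i)

/-- A morphism between factorizations of rank one is determined by one constant. -/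
theorem homMk_line_line_eq_zero (hb : Function.Bijective (aeval u :
      MvPolynomial (Fin 2) ℂ →ₐ[ℂ] MvPolynomial (Fin 2) ℂ))
    (hc : ∀ k, constantCoeff (u k) = 0) (hne : u 0 ≠ 0) {s t : ℤ × ℤ}
    {f : Matrix (Fin 2) (Fin 2) (MvPolynomial (Fin 2) ℂ)} {hf hf'}
    (h : constantCoeff (f 0 0) = 0) :
    (homMk (P := line hu hd huW s) (Q := line hu hd huW t) f hf hf' :
      line hu hd huW s ⟶ line hu hd huW t) = 0 := by
  refine (homMk_line_eq_zero_iff hu hd huW hb hc hne s).2 ?_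
  have h1 : f * (sgn s.2 • lineMatrix u) = (sgn t.2 • lineMatrix u) * f := by
    have := hf'
    rw [line_p, line_p] at this
    exact this
  -- Commutation with the differentials makes `u 1 * f 1 0` divisible by `u 0`, hence so is `f 1 0`.
  have h2 : constantCoeff (f 1 0) = 0 := by
    have h3 := congrFun (congrFun h1 0) 0
    simp [Matrix.mul_apply] at h3
    have h4 : u 0 ∣ u 1 * f 1 0 := by
      refine ⟨sgn t.2 * (sgn s.2 * f 0 1), ?_⟩
      linear_combination (-sgn t.2) * h3 - u 1 * f 1 0 * sgn_mul_sgn t.2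
    obtain ⟨q, hq⟩ := dvd_of_dvd_mul hb h4
    rw [hq, map_mul, hc, zero_mul]
  convert Submodule.zero_mem _ with i
  change Fin 2 at i
  fin_cases i
  · exact h
  · exact h2

/-- Distinct factorizations of rank one are orthogonal. -/
theorem hom_line_line_eq_zero (hb : Function.Bijective (aeval u :
      MvPolynomial (Fin 2) ℂ →ₐ[ℂ] MvPolynomial (Fin 2) ℂ))
    (hc : ∀ k, constantCoeff (u k) = 0) (hne : u 0 ≠ 0) (hd0 : 0 < d) {s t : ℤ × ℤ}
    (hs0 : 0 ≤ s.1) (hs1 : s.1 < d) (ht0 : 0 ≤ t.1) (ht1 : t.1 < d) (hst : s ≠ t)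
    (f : line hu hd huW s ⟶ line hu hd huW t) : f = 0 := by
  obtain ⟨f, hf, hf', rfl⟩ := exists_mk f
  refine homMk_line_line_eq_zero hu hd huW hb hc hne ?_
  refine constantCoeff_eq_zero_of_ne hu hd huW hd0 hs0 hs1 hf (i := (0 : Fin 2)) fun h => hst ?_
  rw [h]
  -- The first summand of `L(t)` has type `t`.
  refine (eq_lineIdx hd0 ht0 ht1 (m := 0) ?_ ?_).symm
  · rw [line_par_zero]; simp
  · rw [line_deg_zero]; simp

/-- Subtracting the scalar read off from the first diagonal entry removes the one constant that
determines the endomorphism. -/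
theorem exists_eq_homScalar (hb : Function.Bijective (aeval u :
      MvPolynomial (Fin 2) ℂ →ₐ[ℂ] MvPolynomial (Fin 2) ℂ))
    (hc : ∀ k, constantCoeff (u k) = 0) (hne : u 0 ≠ 0) {s : ℤ × ℤ}
    (f : line hu hd huW s ⟶ line hu hd huW s) : ∃ c, f = homScalar _ c := by
  obtain ⟨f, hf, hf', rfl⟩ := exists_mk f
  refine ⟨constantCoeff (f (0 : Fin 2) (0 : Fin 2)), ?_⟩
  rw [← sub_eq_zero, sub_eq_add_neg, homScalar, neg_mk, mk_add_mk]
  refine homMk_line_line_eq_zero hu hd huW hb hc hne ?_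
  have : (1 : Matrix (line hu hd huW s).ι (line hu hd huW s).ι (MvPolynomial (Fin 2) ℂ))
    (0 : Fin 2) (0 : Fin 2) = 1 := Matrix.one_apply_eq _
  change constantCoeff (f (0 : Fin 2) (0 : Fin 2) + -(C (constantCoeff (f (0 : Fin 2) (0 : Fin 2))) *
    (1 : Matrix (line hu hd huW s).ι (line hu hd huW s).ι (MvPolynomial (Fin 2) ℂ))
      (0 : Fin 2) (0 : Fin 2))) = 0
  rw [this, mul_one, map_add, map_neg, constantCoeff_C, add_neg_cancel]

/-- The differential of `L(s)` has zero constant term, so there are no boundaries that could kill a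
nonzero scalar. -/
theorem homScalar_line_eq_zero_iff (hb : Function.Bijective (aeval u :
      MvPolynomial (Fin 2) ℂ →ₐ[ℂ] MvPolynomial (Fin 2) ℂ))
    (hc : ∀ k, constantCoeff (u k) = 0) (hne : u 0 ≠ 0) (s : ℤ × ℤ) (c : ℂ) :
    homScalar (line hu hd huW s) c = 0 ↔ c = 0 := by
  refine ⟨fun h => ?_, fun h => by rw [h, homScalar_zero]⟩
  obtain ⟨y, hy⟩ := (homMk_line_eq_zero_iff hu hd huW hb hc hne s).1 h
  rw [constantCoeff_line_p hu hd huW hc] at hy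
  have h1 := congrFun hy (0 : Fin 2)
  have : (1 : Matrix (line hu hd huW s).ι (line hu hd huW s).ι (MvPolynomial (Fin 2) ℂ))
    (0 : Fin 2) (0 : Fin 2) = 1 := Matrix.one_apply_eq _
  change (0 : Matrix _ _ ℂ).mulVec y _ = constantCoeff (C c *
    (1 : Matrix (line hu hd huW s).ι (line hu hd huW s).ι (MvPolynomial (Fin 2) ℂ))
      (0 : Fin 2) (0 : Fin 2)) at h1
  rw [this, mul_one, constantCoeff_C, Matrix.zero_mulVec] at h1
  exact h1.symm

theorem not_isZero_line (hb : Function.Bijective (aeval u :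
      MvPolynomial (Fin 2) ℂ →ₐ[ℂ] MvPolynomial (Fin 2) ℂ))
    (hc : ∀ k, constantCoeff (u k) = 0) (hne : u 0 ≠ 0) (s : ℤ × ℤ) :
    ¬ IsZero (line hu hd huW s) := fun h => by
  have := (homScalar_line_eq_zero_iff hu hd huW hb hc hne s 1).1 (h.eq_of_src _ _)
  exact one_ne_zero this

end LineHom

end HMF

/-! ### Testing isomorphisms on a generating family -/

section Generators

open Pretriangulated

variable {C : Type*} [Category C] [Preadditive C] [HasZeroObject C] [HasShift C ℤ]
  [∀ k : ℤ, (shiftFunctor C k).Additive] [Pretriangulated C]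

/-- A morphism which is bijective on the morphisms from a generating family, closed under
shifts, is an isomorphism. -/
theorem isIso_of_bijective_of_generators {S : Type*} (X : S → C)
    (hX : ∀ s, ∃ t, Nonempty (X s ≅ (shiftFunctor C (1 : ℤ)).obj (X t)))
    (hgen : ∀ E : C, (∀ s, ∀ f : X s ⟶ E, f = 0) → IsZero E) {F E : C} (Ψ : F ⟶ E)
    (hinj : ∀ s (g : X s ⟶ F), g ≫ Ψ = 0 → g = 0)
    (hsurj : ∀ s (g : X s ⟶ E), ∃ h : X s ⟶ F, h ≫ Ψ = g) : IsIso Ψ := by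
  -- The cone is zero by the long exact sequence: for `f : X s ⟶ Z`, injectivity on the shifted
  -- generator gives `f ≫ h = 0`, so `f` factors through `E`, then through `Ψ` by surjectivity, and
  -- `Ψ ≫ g = 0`.
  obtain ⟨Z, g, h, hT⟩ := distinguished_cocone_triangle Ψ
  refine (Triangle.isZero₃_iff_isIso₁ _ hT).1 (hgen Z fun s f => ?_)
  obtain ⟨t, ⟨e⟩⟩ := hX s
  have h1 : f ≫ h = 0 := by
    obtain ⟨k, hk⟩ := (shiftFunctor C (1 : ℤ)).map_surjective (e.inv ≫ f ≫ h)
    have h2 : k ≫ Ψ = 0 := by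
      refine (shiftFunctor C (1 : ℤ)).map_injective ?_
      have h3 : h ≫ (shiftFunctor C (1 : ℤ)).map Ψ = 0 := comp_distTriang_mor_zero₃₁ _ hT
      rw [Functor.map_comp, hk, Category.assoc, Category.assoc, h3, comp_zero, comp_zero,
        Functor.map_zero]
    rw [hinj t k h2, Functor.map_zero] at hk
    rw [← cancel_epi e.inv, ← hk, comp_zero]
  obtain ⟨k, hk⟩ := Triangle.coyoneda_exact₃ _ hT f h1
  obtain ⟨l, rfl⟩ := hsurj s k
  have h3 : Ψ ≫ g = 0 := comp_distTriang_mor_zero₁₂ _ hT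
  change f = (l ≫ Ψ) ≫ g at hk
  rw [hk, Category.assoc, h3, comp_zero]

end Generators

namespace HMF

open MvPolynomial

/-! ### Decomposition of an arbitrary factorization -/

section Decomposition

variable {a : Fin 2 → ℤ} {d : ℤ} {W : MvPolynomial (Fin 2) ℂ}
  {u : Fin 2 → MvPolynomial (Fin 2) ℂ} (hu : ∀ i, IsWeightedHomogeneous a (u i) (a i))
  (hd : d = a 0 + a 1) (huW : W = u 0 * u 1)

theorem line_iso_shift (s : ℤ × ℤ) (k : ℤ) : Nonempty (line hu hd huW (s.1, s.2 + k) ≅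
    (shiftFunctor (HMF a d W) k).obj (line hu hd huW s)) :=
  ⟨(shiftFunctorAdd (HMF a d W) s.2 k).app (rankOne (hu 0) (hu 1) hd huW s.1)⟩

/-- Every factorization is a direct sum of factorizations of rank one. -/
theorem exists_iso_biproduct (ha : ∀ i, 0 < a i) (hb : Function.Bijective (aeval u :
      MvPolynomial (Fin 2) ℂ →ₐ[ℂ] MvPolynomial (Fin 2) ℂ))
    (hc : ∀ k, constantCoeff (u k) = 0) (hne : u 0 ≠ 0) (E : HMF a d W) :
    ∃ (I : Type) (_ : Fintype I) (t : I → ℤ × ℤ), (∀ i, 0 ≤ (t i).1 ∧ (t i).1 < d) ∧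
      Nonempty (E ≅ ⨁ fun i => line hu hd huW (t i)) := by
  have hd0 : 0 < d := by have := ha 0; have := ha 1; omega
  choose c hinj hsmul using fun s => exists_class hu hd huW hb hc hne s E
  -- This is a copy of `Hom(L(s), E)` as a finite-dimensional vector space; its dimension is the
  -- multiplicity of `L(s)` in `E`.
  let H : ℤ × ℤ → Submodule ℂ ((E.ι → ℂ) ⧸ LinearMap.range (const E).mulVecLin) := fun s =>
    { carrier := Set.range (c s)
      add_mem' := by
        rintro _ _ ⟨x, rfl⟩ ⟨y, rfl⟩
        exact ⟨x + y, map_add _ _ _⟩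
      zero_mem' := ⟨0, map_zero _⟩
      smul_mem' := by
        rintro z _ ⟨x, rfl⟩
        exact ⟨_, hsmul s z x⟩ }
  let b := fun s => Module.finBasis ℂ (H s)
  choose f hf using fun s i => (b s i).2
  let S : Finset (ℤ × ℤ) := Finset.univ.image (lineIdx a d E.toGrFree)
  have hS : ∀ s ∈ S, 0 ≤ s.1 ∧ s.1 < d := fun s hs => by
    obtain ⟨i, -, rfl⟩ := Finset.mem_image.1 hs
    exact lineIdx_mem hd0 _ i
  let I := Σ s : S, Fin (Module.finrank ℂ (H s))
  let F : HMF a d W := ⨁ fun i : I => line hu hd huW i.1.1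
  let Ψ : F ⟶ E := biproduct.desc fun i : I => f i.1.1 i.2
  refine ⟨I, inferInstance, fun i => i.1.1, fun i => hS _ i.1.2, ?_⟩
  have : IsIso Ψ := by
    refine isIso_of_bijective_of_generators
      (X := fun s : {s : ℤ × ℤ // 0 ≤ s.1 ∧ s.1 < d} => line hu hd huW s.1) ?_ ?_ Ψ ?_ ?_
    · rintro ⟨s, hs⟩
      have := line_iso_shift hu hd huW (s.1, s.2 - 1) 1
      rw [sub_add_cancel] at this
      exact ⟨⟨(s.1, s.2 - 1), hs⟩, this⟩
    · exact fun E h => isZero_of_line hu hd huW ha hb hc hne E fun s h0 h1 => h ⟨s, h0, h1⟩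
    -- Injectivity: by orthogonality only the copies of `L(s)` matter, and the components there are
    -- scalars, which are the coefficients of a linear relation between basis vectors.
    · rintro ⟨s, hs⟩ g hg
      change line hu hd huW s ⟶ F at g
      have h0 : ∀ i : I, s ≠ i.1.1 → g ≫ biproduct.π _ i = 0 := fun i hi =>
        hom_line_line_eq_zero hu hd huW hb hc hne hd0 hs.1 hs.2 (hS _ i.1.2).1 (hS _ i.1.2).2 hi _
      have h1 : ∀ i : I, g ≫ biproduct.π _ i = 0 := by
        by_cases hsS : s ∈ S
        · choose r hr using fun k => exists_eq_homScalar hu hd huW hb hc hne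
            (g ≫ biproduct.π (fun i : I => line hu hd huW i.1.1) ⟨⟨s, hsS⟩, k⟩)
          have h2 : ∑ k, homScalar (line hu hd huW s) (r k) ≫ f s k = 0 := by
            refine Eq.trans ?_ hg
            symm
            simp only [Ψ, biproduct.desc_eq, Preadditive.comp_sum]
            rw [Fintype.sum_sigma, Finset.sum_eq_single ⟨s, hsS⟩]
            · refine Finset.sum_congr rfl fun k _ => ?_
              rw [← hr, Category.assoc]
            · intro t _ ht
              refine Finset.sum_eq_zero fun k _ => ?_
              rw [← Category.assoc, h0 ⟨t, k⟩ (fun h => ht (Subtype.ext h.symm)), zero_comp]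
            · simp
          have h3 : ∑ k, r k • b s k = 0 := by
            refine Subtype.ext ?_
            have := congrArg (c s) h2
            rw [map_sum, map_zero] at this
            simp only [hsmul, hf] at this
            rw [Submodule.coe_sum]
            exact this
          have h4 := Fintype.linearIndependent_iff.1 (b s).linearIndependent r h3
          rintro ⟨⟨t, ht⟩, k⟩
          by_cases hst : s = t
          · subst hst
            rw [hr, h4, homScalar_zero]
          · exact h0 _ hst
        · exact fun i => h0 i fun h => hsS (h ▸ i.1.2)
      refine biproduct.hom_ext _ _ fun i => ?_
      rw [h1, zero_comp]
    -- Surjectivity: the coordinates of the class of `g` in the basis are the components of a lift.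
    · rintro ⟨s, hs⟩ g
      change line hu hd huW s ⟶ E at g
      by_cases hsS : s ∈ S
      · let x : H s := ⟨c s g, g, rfl⟩
        refine ⟨∑ k, homScalar _ ((b s).repr x k) ≫
          biproduct.ι (fun i : I => line hu hd huW i.1.1) ⟨⟨s, hsS⟩, k⟩, hinj s ?_⟩
        rw [Preadditive.sum_comp, map_sum]
        have h1 := congrArg Subtype.val ((b s).sum_repr x)
        rw [Submodule.coe_sum] at h1
        refine Eq.trans (Finset.sum_congr rfl fun k _ => ?_) h1
        rw [Category.assoc, biproduct.ι_desc, hsmul, hf]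
        rfl
      · refine ⟨0, ?_⟩
        rw [zero_comp, hom_eq_zero_of_ne_lineIdx hu hd huW hb hc hne hd0 hs.1 hs.2
          (fun i h => hsS (h ▸ Finset.mem_image_of_mem _ (Finset.mem_univ i))) g]
  exact ⟨(asIso Ψ).symm⟩

end Decomposition

end HMF

/-! ## Finite direct sums -/

section FiniteSums

open ZeroObject

/-- Splitting off the first summand of a finite direct sum. -/
noncomputable def biproductFinSuccIso {C : Type*} [Category C] [Preadditive C]
    [HasFiniteBiproducts C] [HasBinaryBiproducts C] {m : ℕ} (X : Fin (m + 1) → C) :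
    (⨁ X) ≅ X 0 ⊞ ⨁ fun i : Fin m => X i.succ where
  hom := biprod.lift (biproduct.π X 0) (biproduct.lift fun i => biproduct.π X i.succ)
  inv := biprod.desc (biproduct.ι X 0) (biproduct.desc fun i => biproduct.ι X i.succ)
  hom_inv_id := by
    rw [biprod.lift_desc, biproduct.lift_desc, ← biproduct.total, Fin.sum_univ_succ]
  inv_hom_id := by
    refine biprod.hom_ext' _ _ ?_ (biproduct.hom_ext' _ _ fun i => ?_)
    · refine biprod.hom_ext _ _ ?_ (biproduct.hom_ext _ _ fun j => ?_)
      · simp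
      · simp [biproduct.ι_π_ne X (Fin.succ_ne_zero j).symm]
    · refine biprod.hom_ext _ _ ?_ (biproduct.hom_ext _ _ fun j => ?_)
      · simp [biproduct.ι_π_ne X (Fin.succ_ne_zero i)]
      · simp only [biprod.inr_desc_assoc, Category.assoc, biproduct.ι_desc_assoc,
          biprod.lift_snd, biproduct.lift_π, biprod.inr_snd, Category.comp_id, biproduct.ι_π]
        by_cases h : i = j
        · subst h; simp
        · rw [dif_neg h, dif_neg (fun h' => h (Fin.succ_injective _ h'))]

variable {C : Type*} [Category C] [Preadditive C] [HasZeroObject C] [HasShift C ℤ]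
  [∀ k : ℤ, (shiftFunctor C k).Additive] [Pretriangulated C]
variable {I : Type*} {X : I → C} {S T : Set I} {E F : C}

namespace IsFiniteSumOf

theorem of_iso (e : E ≅ F) (h : IsFiniteSumOf X S E) : IsFiniteSumOf X S F := by
  obtain ⟨m, t, ht, ⟨e'⟩⟩ := h
  exact ⟨m, t, ht, ⟨e.symm ≪≫ e'⟩⟩

theorem of_fintype {J : Type} [Fintype J] (t : J → I) (ht : ∀ j, t j ∈ S)
    (e : E ≅ ⨁ fun j => X (t j)) : IsFiniteSumOf X S E := by
  let ε := Fintype.equivFin J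
  refine ⟨Fintype.card J, fun i => t (ε.symm i), fun i => ht _, ⟨e ≪≫ ?_⟩⟩
  exact biproduct.whiskerEquiv ε fun j => eqToIso (by simp)

theorem of_isZero (h : IsZero E) : IsFiniteSumOf X S E := by
  refine ⟨0, fun i => i.elim0, fun i => i.elim0, ⟨h.iso ?_⟩⟩
  rw [IsZero.iff_id_eq_zero]
  exact biproduct.hom_ext _ _ fun i => i.elim0

theorem cons {s : I} (hs : s ∈ S) (h : IsFiniteSumOf X S E) : IsFiniteSumOf X S (X s ⊞ E) := by
  obtain ⟨m, t, ht, ⟨e⟩⟩ := h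
  refine ⟨m + 1, Fin.cons s t, fun i => Fin.cases hs ht i, ⟨?_⟩⟩
  exact biprod.mapIso (Iso.refl _) e ≪≫
    (biproductFinSuccIso fun i => X (Fin.cons (α := fun _ => I) s t i)).symm

/-- This reduces statements about indexed biproducts to adding one summand at a time, up to
isomorphism. -/
theorem induction {Q : C → Prop} (hiso : ∀ E F : C, Nonempty (E ≅ F) → Q E → Q F)
    (hzero : ∀ E : C, IsZero E → Q E) (hcons : ∀ s ∈ S, ∀ E : C, Q E → Q (X s ⊞ E))
    (h : IsFiniteSumOf X S E) : Q E := by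
  obtain ⟨m, t, ht, ⟨e⟩⟩ := h
  refine hiso _ _ ⟨e.symm⟩ ?_
  clear e
  induction m with
  | zero =>
    refine hzero _ ?_
    rw [IsZero.iff_id_eq_zero]
    exact biproduct.hom_ext _ _ fun i => i.elim0
  | succ m ih =>
    exact hiso _ _ ⟨(biproductFinSuccIso fun i => X (t i)).symm⟩
      (hcons _ (ht 0) _ (ih (fun i => t i.succ) fun i => ht _))

theorem biprod (hE : IsFiniteSumOf X S E) (hF : IsFiniteSumOf X S F) :
    IsFiniteSumOf X S (E ⊞ F) :=
  induction (Q := fun E => IsFiniteSumOf X S (E ⊞ F))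
    (fun _ _ ⟨e⟩ h => of_iso (biprod.mapIso e (Iso.refl F)) h)
    (fun _ hE => of_iso (isoZeroBiprod hE) hF)
    (fun s hs E h => of_iso (biprod.associator (X s) E F).symm (cons hs h)) hE

theorem mono (hST : S ⊆ T) (h : IsFiniteSumOf X S E) : IsFiniteSumOf X T E := by
  obtain ⟨m, t, ht, e⟩ := h
  exact ⟨m, t, fun i => hST (ht i), e⟩

theorem map (Φ : C ⥤ C) [Φ.Additive] (hΦ : ∀ s ∈ S, ∃ t ∈ T, Nonempty (X t ≅ Φ.obj (X s)))
    (h : IsFiniteSumOf X S E) : IsFiniteSumOf X T (Φ.obj E) :=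
  induction (Q := fun E => IsFiniteSumOf X T (Φ.obj E))
    (fun _ _ ⟨e⟩ h => of_iso (Φ.mapIso e) h)
    (fun _ hE => of_isZero (Φ.map_isZero hE))
    (fun s hs E h => by
      obtain ⟨t, ht, ⟨e⟩⟩ := hΦ s hs
      have := preservesBinaryBiproduct_of_preservesBiproduct Φ (X s) E
      exact of_iso (biprod.mapIso e (Iso.refl _) ≪≫ (Φ.mapBiprod (X s) E).symm) (cons ht h)) h

/-- A direct sum of two kinds of summands splits. -/
theorem exists_biprod_iso (h : IsFiniteSumOf X (S ∪ T) E) :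
    ∃ E₁ E₂ : C, IsFiniteSumOf X S E₁ ∧ IsFiniteSumOf X T E₂ ∧ Nonempty (E₁ ⊞ E₂ ≅ E) := by
  refine induction (S := S ∪ T) (Q := fun E => ∃ E₁ E₂ : C, IsFiniteSumOf X S E₁ ∧
    IsFiniteSumOf X T E₂ ∧ Nonempty (E₁ ⊞ E₂ ≅ E)) ?_ ?_ ?_ h
  · rintro E F ⟨e⟩ ⟨E₁, E₂, h₁, h₂, ⟨e'⟩⟩
    exact ⟨E₁, E₂, h₁, h₂, ⟨e' ≪≫ e⟩⟩
  · intro E hE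
    exact ⟨E, E, of_isZero hE, of_isZero hE, ⟨(isoBiprodZero hE).symm⟩⟩
  · rintro s (hs | hs) E ⟨E₁, E₂, h₁, h₂, ⟨e⟩⟩
    · exact ⟨X s ⊞ E₁, E₂, cons hs h₁, h₂,
        ⟨biprod.associator _ _ _ ≪≫ biprod.mapIso (Iso.refl _) e⟩⟩
    · refine ⟨E₁, X s ⊞ E₂, h₁, cons hs h₂, ⟨?_⟩⟩
      exact (biprod.associator _ _ _).symm ≪≫ biprod.mapIso (biprod.braiding _ _) (Iso.refl _) ≪≫
        biprod.associator _ _ _ ≪≫ biprod.mapIso (Iso.refl _) e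

/-- A morphism between direct sums is determined by its matrix entries; the induction runs over the
source and then over the target. -/
theorem hom_eq_zero (hST : ∀ s ∈ S, ∀ t ∈ T, ∀ f : X s ⟶ X t, f = 0)
    (hE : IsFiniteSumOf X S E) (hF : IsFiniteSumOf X T F) (f : E ⟶ F) : f = 0 := by
  refine induction (S := S) (Q := fun E => ∀ f : E ⟶ F, f = 0) ?_ ?_ ?_ hE f
  · rintro E E' ⟨e⟩ h f
    rw [← cancel_epi e.hom, h (e.hom ≫ f), comp_zero]
  · exact fun E h f => h.eq_of_src _ _
  · intro s hs E h f
    refine biprod.hom_ext' _ _ ?_ ((h _).trans comp_zero.symm)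
    rw [comp_zero]
    refine induction (S := T) (Q := fun F => ∀ f : X s ⟶ F, f = 0) ?_ ?_ ?_ hF _
    · rintro E E' ⟨e⟩ h f
      rw [← cancel_mono e.inv, h (f ≫ e.inv), zero_comp]
    · exact fun E h f => h.eq_of_tgt _ _
    · intro t ht E h f
      refine biprod.hom_ext _ _ ?_ ((h _).trans zero_comp.symm)
      rw [zero_comp]
      exact hST s hs t ht _

/-- An indecomposable direct sum has one summand. -/
theorem exists_iso_of_indecomposable (hX : ∀ s ∈ S, ¬ IsZero (X s)) (hE : Indecomposable E)
    (h : IsFiniteSumOf X S E) : ∃ s ∈ S, Nonempty (E ≅ X s) := by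
  refine induction (S := S) (Q := fun E => Indecomposable E → ∃ s ∈ S, Nonempty (E ≅ X s))
    ?_ ?_ ?_ h hE
  · rintro E F ⟨e⟩ h hF
    obtain ⟨s, hs, ⟨e'⟩⟩ := h ⟨fun h0 => hF.1 (h0.of_iso e.symm),
      fun Y Z e' => hF.2 Y Z (e.symm ≪≫ e')⟩
    exact ⟨s, hs, ⟨e.symm ≪≫ e'⟩⟩
  · exact fun E h0 hE => (hE.1 h0).elim
  · intro s hs E _ hE
    rcases hE.2 _ _ (Iso.refl _) with h0 | h0
    · exact (hX s hs h0).elim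
    · exact ⟨s, hs, ⟨(isoBiprodZero h0).symm⟩⟩

/-- The filtration of a direct sum by decreasing phases. -/
theorem exists_filtration {ph : I → ℝ} (A : Finset ℝ) :
    ∀ E : C, IsFiniteSumOf X {s | s ∈ S ∧ ph s ∈ A} E →
    ∃ (N : ℕ) (F : ℕ → C) (φ : ℕ → ℝ), (∀ i < N, φ i ∈ A ∧
      IsFiniteSumOf X {s | s ∈ S ∧ ph s = φ i} (F i)) ∧
      (∀ i j, i < j → j < N → φ j < φ i) ∧
      Nonempty (Nat.rec (motive := fun _ => C) (0 : C) (fun i Y => Y ⊞ F i) N ≅ E) := by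
  -- The summands of smallest phase form the last quotient, so they are split off and appended to
  -- the filtration of the rest.
  induction A using Finset.induction_on_min with
  | empty =>
    intro E hE
    refine ⟨0, fun _ => 0, fun _ => 0, fun i hi => absurd hi (Nat.not_lt_zero i),
      fun i j _ hj => absurd hj (Nat.not_lt_zero j), ⟨?_⟩⟩
    refine (isZero_zero C).iso ?_
    obtain ⟨m, t, ht, ⟨e⟩⟩ := hE
    refine IsZero.of_iso ?_ e
    rw [IsZero.iff_id_eq_zero]
    exact biproduct.hom_ext _ _ fun i => absurd (ht i).2 (Finset.notMem_empty _)
  | insert x A hx ih =>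
    intro E hE
    have hE' : IsFiniteSumOf X ({s | s ∈ S ∧ ph s ∈ A} ∪ {s | s ∈ S ∧ ph s = x}) E :=
      hE.mono fun s hs => by
        rcases Finset.mem_insert.1 hs.2 with h | h
        · exact Or.inr ⟨hs.1, h⟩
        · exact Or.inl ⟨hs.1, h⟩
    obtain ⟨E₁, E₂, h₁, h₂, ⟨e⟩⟩ := hE'.exists_biprod_iso
    obtain ⟨N, F, φ, hF, hφ, ⟨e'⟩⟩ := ih E₁ h₁
    -- The sequences are indexed by all of ℕ to avoid dependent indices; values from `N + 1` on are
    -- irrelevant.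
    refine ⟨N + 1, Function.update F N E₂, Function.update φ N x, fun i hi => ?_,
      fun i j hij hj => ?_, ⟨?_⟩⟩
    · rcases Nat.lt_succ_iff_lt_or_eq.1 hi with h | rfl
      · rw [Function.update_of_ne h.ne, Function.update_of_ne h.ne]
        exact ⟨Finset.mem_insert_of_mem (hF i h).1, (hF i h).2⟩
      · rw [Function.update_self, Function.update_self]
        exact ⟨Finset.mem_insert_self _ _, h₂⟩
    · have hi : i < N := lt_of_lt_of_le hij (Nat.lt_succ_iff.1 hj)
      rw [Function.update_of_ne hi.ne]
      rcases Nat.lt_succ_iff_lt_or_eq.1 hj with h | rfl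
      · rw [Function.update_of_ne h.ne]
        exact hφ i j hij h
      · rw [Function.update_self]
        exact hx _ (hF i hi).1
    · have h3 : ∀ n ≤ N, (Nat.rec (motive := fun _ => C) (0 : C)
          (fun i Y => Y ⊞ Function.update F N E₂ i) n : C) =
          Nat.rec (motive := fun _ => C) (0 : C) (fun i Y => Y ⊞ F i) n := by
        intro n hn
        induction n with
        | zero => rfl
        | succ n ih =>
          change ((Nat.rec (motive := fun _ => C) (0 : C)
            (fun i Y => Y ⊞ Function.update F N E₂ i) n : C) ⊞ Function.update F N E₂ n) = _
          rw [ih (by omega), Function.update_of_ne (by omega)]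
      exact biprod.mapIso (eqToIso (h3 N le_rfl) ≪≫ e') (eqToIso (by simp)) ≪≫ e

end IsFiniteSumOf

end FiniteSums

/-! ## The central charge -/

namespace HMF

open MvPolynomial

section Charge

variable {n : ℕ} {a : Fin n → ℤ} {d : ℤ} {W : MvPolynomial (Fin n) ℂ}

/-- The contribution of a summand to the central charge. -/
noncomputable def charge (d : ℤ) (s : ZMod 2) (t : ℤ) : ℂ :=
  (-1 : ℂ) ^ s.val * Complex.exp (2 * Real.pi * Complex.I * (t / d))

theorem centralCharge_eq (P : HMF a d W) :
    centralCharge P = ∑ i, charge d (P.par i) (P.deg i) := rfl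

/-- The exponential has period `d` and the sign depends on the parity alone, so regrading by the
rule `P^{s + 2m} = P^s(m d)` leaves only `(-1) ^ k`. -/
theorem charge_sub (hd : d ≠ 0) {s s' : ZMod 2} {t k m : ℤ}
    (h : (s.val : ℤ) + k = s'.val + 2 * m) :
    charge d s' (t - m * d) = (-1 : ℂ) ^ k * charge d s t := by
  have hd' : (d : ℂ) ≠ 0 := by exact_mod_cast hd
  have h1 : Complex.exp (2 * Real.pi * Complex.I * ((t - m * d : ℤ) / d)) =
      Complex.exp (2 * Real.pi * Complex.I * (t / d)) := by
    rw [Complex.exp_eq_exp_iff_exists_int]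
    refine ⟨-m, ?_⟩
    push_cast
    field_simp
    ring
  have h2 : (-1 : ℂ) ^ s'.val = (-1 : ℂ) ^ k * (-1 : ℂ) ^ s.val := by
    rw [← zpow_natCast, ← zpow_natCast, ← zpow_add₀ (by norm_num)]
    rw [show k + (s.val : ℤ) = s'.val + 2 * m by linarith, zpow_add₀ (by norm_num), zpow_mul]
    simp
  rw [charge, charge, h1, h2, mul_assoc]

theorem charge_add (t m : ℤ) (s : ZMod 2) :
    charge d s (t + m) = Complex.exp (2 * Real.pi * Complex.I * (m / d)) * charge d s t := by
  rw [charge, charge, mul_left_comm, ← Complex.exp_add]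
  congr 2
  push_cast
  ring

theorem centralCharge_shiftObj (hd : d ≠ 0) (k : ℤ) (P : HMF a d W) :
    centralCharge (shiftObj k P) = (-1 : ℂ) ^ k * centralCharge P := by
  rw [centralCharge_eq, centralCharge_eq, Finset.mul_sum]
  refine Finset.sum_congr rfl fun i _ => ?_
  have h1 := shiftIdx_spec (P.par i) k
  have h2 := charge_sub (t := P.deg i + shiftIdx (P.par i) k * d) hd h1
  rw [add_sub_cancel_right] at h2
  change charge d (P.par i + k) (P.deg i + shiftIdx (P.par i) k * d) = _
  rw [h2, ← mul_assoc, ← mul_zpow]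
  simp

theorem centralCharge_twistObj (m : ℤ) (P : HMF a d W) :
    centralCharge (twistObj m P) =
      Complex.exp (2 * Real.pi * Complex.I * (m / d)) * centralCharge P := by
  rw [centralCharge_eq, centralCharge_eq, Finset.mul_sum]
  exact Finset.sum_congr rfl fun i _ => charge_add _ _ _

/-- A constant entry of an odd map joins generators of opposite parity whose degrees agree up to a
multiple of `d`, and these contribute opposite charges. -/
theorem charge_eq_neg (hd : d ≠ 0) {P : GrFree} {f : Matrix P.ι P.ι (MvPolynomial (Fin n) ℂ)}
    (hf : IsHomog a d 1 P P f) {i j : P.ι} (h : constantCoeff (f j i) ≠ 0) :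
    charge d (P.par j) (P.deg j) = -charge d (P.par i) (P.deg i) := by
  by_cases h' : ∃ m : ℤ, ((P.par i).val : ℤ) + 1 = (P.par j).val + 2 * m
  · obtain ⟨m, hm⟩ := h'
    have h1 : P.deg j + m * d - P.deg i = 0 := by
      by_contra hD
      exact h (constantCoeff_eq_zero_of_isWeightedHomogeneous ((hf j i).1 m hm) hD)
    have h2 := charge_sub (t := P.deg i) hd hm
    rw [show P.deg i - m * d = P.deg j by linarith] at h2
    rw [h2]
    simp
  · push Not at h'
    rw [(hf j i).2 h', map_zero] at h
    exact (h rfl).elim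

/-- The charge is the trace of the diagonal matrix `D` of charges, which anticommutes with the
constant term of `p`. Since the identity is `p H + H p` on constant terms, the trace of `D p H + D H
p` cancels by cyclicity. -/
theorem centralCharge_of_isZero (hd : d ≠ 0) {P : HMF a d W} (hP : IsZero P) :
    centralCharge P = 0 := by
  obtain ⟨h, hh⟩ := isZero_iff.1 hP
  let D : Matrix P.ι P.ι ℂ := Matrix.diagonal fun i => charge d (P.par i) (P.deg i)
  let H : Matrix P.ι P.ι ℂ := h.map constantCoeff
  have h1 : (1 : Matrix P.ι P.ι ℂ) = const P * H + H * const P := by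
    have := congrArg (fun M : Matrix P.ι P.ι (MvPolynomial (Fin n) ℂ) => M.map constantCoeff) hh
    simp only [Matrix.map_add _ (map_add (constantCoeff (R := ℂ) (σ := Fin n))), Matrix.map_mul,
      Matrix.map_one _ (map_zero (constantCoeff (R := ℂ) (σ := Fin n)))
        (map_one (constantCoeff (R := ℂ) (σ := Fin n)))] at this
    exact this
  have h2 : D * const P = -(const P * D) := by
    ext1 j i
    rw [Matrix.diagonal_mul, Matrix.neg_apply, Matrix.mul_diagonal]
    by_cases h0 : const P j i = 0
    · rw [h0, mul_zero, zero_mul, neg_zero]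
    · rw [charge_eq_neg hd P.p_homog h0]
      ring
  have h3 : centralCharge P = D.trace := by
    rw [centralCharge_eq, Matrix.trace_diagonal]
  rw [h3, ← Matrix.mul_one D, h1, Matrix.mul_add, Matrix.trace_add, ← Matrix.mul_assoc, h2,
    Matrix.neg_mul, Matrix.trace_neg, Matrix.mul_assoc, Matrix.trace_mul_comm, ← Matrix.mul_assoc]
  simp

theorem centralCharge_cone (hd : d ≠ 0) {P Q : HMF a d W}
    (f : Matrix Q.ι P.ι (MvPolynomial (Fin n) ℂ)) (hf hc) :
    centralCharge (cone (P := P) (Q := Q) f hf hc) = centralCharge Q - centralCharge P := by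
  have h1 := centralCharge_shiftObj hd 1 P
  rw [zpow_one, neg_one_mul] at h1
  rw [sub_eq_add_neg, ← h1]
  exact Fintype.sum_sum_type _

/-- Isomorphic objects may have different ranks, so invariance is not formal: it holds because the
cone of an isomorphism is zero and its charge is the difference. -/
theorem centralCharge_eq_of_iso (hd : d ≠ 0) {P Q : HMF a d W} (e : P ≅ Q) :
    centralCharge P = centralCharge Q := by
  obtain ⟨f, hf, hc, h⟩ := exists_mk e.hom
  have : IsIso (coneTriangle f hf hc).mor₁ := by
    change IsIso (homMk f hf hc)
    rw [← h]
    infer_instance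
  have hT : coneTriangle f hf hc ∈ Pretriangulated.distinguishedTriangles :=
    ⟨P, Q, f, hf, hc, ⟨Iso.refl _⟩⟩
  have h0 := centralCharge_of_isZero hd ((Pretriangulated.Triangle.isZero₃_iff_isIso₁ _ hT).2 this)
  have h1 := centralCharge_cone hd f hf hc
  exact (sub_eq_zero.1 (h1.symm.trans h0)).symm

theorem centralCharge_of_distinguished (hd : d ≠ 0)
    {T : Pretriangulated.Triangle (HMF a d W)}
    (hT : T ∈ Pretriangulated.distinguishedTriangles) :
    centralCharge T.obj₂ = centralCharge T.obj₁ + centralCharge T.obj₃ := by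
  obtain ⟨P, Q, f, hf, hc, ⟨e⟩⟩ := hT
  have h1 := centralCharge_eq_of_iso hd (Pretriangulated.Triangle.π₁.mapIso e)
  have h2 := centralCharge_eq_of_iso hd (Pretriangulated.Triangle.π₂.mapIso e)
  have h3 := centralCharge_eq_of_iso hd (Pretriangulated.Triangle.π₃.mapIso e)
  have h4 := centralCharge_cone hd f hf hc
  change centralCharge T.obj₁ = centralCharge P at h1
  change centralCharge T.obj₂ = centralCharge Q at h2
  change centralCharge T.obj₃ = centralCharge (cone f hf hc) at h3
  rw [h1, h2, h3, h4]
  ring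

theorem centralCharge_biprod (hd : d ≠ 0) (P Q : HMF a d W) :
    centralCharge (P ⊞ Q) = centralCharge P + centralCharge Q :=
  centralCharge_of_distinguished hd
    (Pretriangulated.binaryBiproductTriangle_distinguished P Q)

/-- The central charge descends to the Grothendieck group. -/
noncomputable def chargeHom (a : Fin n → ℤ) {d : ℤ} (W : MvPolynomial (Fin n) ℂ) (hd : d ≠ 0) :
    K0 (HMF a d W) →+ ℂ :=
  QuotientAddGroup.lift _ (FreeAbelianGroup.lift centralCharge) (by
    rw [AddSubgroup.closure_le]
    rintro x ⟨T, hT, rfl⟩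
    change FreeAbelianGroup.lift centralCharge _ = 0
    rw [map_sub, map_sub, FreeAbelianGroup.lift_apply_of, FreeAbelianGroup.lift_apply_of,
      FreeAbelianGroup.lift_apply_of, centralCharge_of_distinguished hd hT]
    ring)

theorem chargeHom_of (hd : d ≠ 0) (E : HMF a d W) :
    chargeHom a W hd (K0.of E) = centralCharge E :=
  FreeAbelianGroup.lift_apply_of _ _

end Charge

end HMF

/-! ## Stability conditions -/

namespace HMF

open MvPolynomial

/-! ### The action of the grade shift, and the zero category -/

section Trivial

variable {n : ℕ} {a : Fin n → ℤ} {d : ℤ} {W : MvPolynomial (Fin n) ℂ}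

instance (m : ℤ) : (twistFun (a := a) (d := d) (W := W) m).Additive where
  map_add {P Q f g} := by
    obtain ⟨f, _, _, rfl⟩ := exists_mk f
    obtain ⟨g, _, _, rfl⟩ := exists_mk g
    rfl

theorem chargeHom_tau_inverse (hd : d ≠ 0) (E : HMF a d W) :
    chargeHom a W hd (K0.of (tau.inverse.obj E)) =
      Complex.exp (-(Complex.I * Real.pi * (2 / d))) * chargeHom a W hd (K0.of E) := by
  rw [chargeHom_of, chargeHom_of]
  refine (centralCharge_twistObj (-1) E).trans ?_
  congr 2
  push_cast
  ring

theorem eq_of_shift_eq {P Q : ObjectProperty (HMF a d W)}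
    (hQ : ∀ E F : HMF a d W, Nonempty (E ≅ F) → Q E → Q F)
    (h₁ : ∀ E, P E → Q (E⟦(1 : ℤ)⟧)) (h₂ : ∀ E, Q E → P (E⟦(-1 : ℤ)⟧)) :
    Q = P.map (shiftFunctor (HMF a d W) (1 : ℤ)) := by
  ext E
  constructor
  · intro hE
    exact ⟨_, h₂ E hE, ⟨shiftNegShift E 1⟩⟩
  · rintro ⟨F, hF, ⟨e⟩⟩
    exact hQ _ _ ⟨e⟩ (h₁ F hF)

theorem map_tau_eq {P Q : ObjectProperty (HMF a d W)}
    (hQ : ∀ E F : HMF a d W, Nonempty (E ≅ F) → Q E → Q F)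
    (h₁ : ∀ E, P E → Q (twistObj 1 E)) (h₂ : ∀ E, Q E → P (twistObj (-1) E)) :
    P.map tau.functor = Q := by
  ext E
  constructor
  · rintro ⟨F, hF, ⟨e⟩⟩
    exact hQ _ _ ⟨e⟩ (h₁ F hF)
  · intro hE
    exact ⟨_, h₂ E hE, ⟨tau.counitIso.app E⟩⟩

/-- If all factorizations are zero then there is a unique stability condition. -/
theorem exists_stability_of_isZero (hd : d ≠ 0) (h : ∀ E : HMF a d W, IsZero E) :
    ∃ σ : StabilityCondition (HMF a d W),
      (∀ E, σ.Z (K0.of E) = HMF.centralCharge E) ∧ σ.IsGepner HMF.tau (2 / d) := by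
  refine ⟨{ Z := chargeHom a W hd
            P := fun _ _ => True
            mem_of_iso := fun _ _ _ _ _ => trivial
            mem_of_isZero := fun _ _ _ => trivial
            biprod_mem := fun _ _ _ _ _ => trivial
            exists_Z_eq := fun _ E _ hE => (hE (h E)).elim
            P_add_one := fun _ => eq_of_shift_eq (fun _ _ _ _ => trivial) (fun _ _ => trivial)
              fun _ _ => trivial
            hom_eq_zero := fun _ _ _ E _ _ _ f => (h E).eq_of_src _ _
            exists_filtration := fun E hE => (hE (h E)).elim }, chargeHom_of hd,
    chargeHom_tau_inverse hd, fun _ => map_tau_eq (fun _ _ _ _ => trivial) (fun _ _ => trivial)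
      fun _ _ => trivial⟩

end Trivial

/-! ### The Gepner type stability condition for ε = 0 -/

section Gepner

variable {a : Fin 2 → ℤ} {d : ℤ} {W : MvPolynomial (Fin 2) ℂ}
  {u : Fin 2 → MvPolynomial (Fin 2) ℂ} (hu : ∀ i, IsWeightedHomogeneous a (u i) (a i))
  (hd : d = a 0 + a 1) (huW : W = u 0 * u 1)

theorem line_iso_twist (s : ℤ × ℤ) (m : ℤ) :
    Nonempty (line hu hd huW (s.1 + m, s.2) ≅ twistObj m (line hu hd huW s)) := by
  refine ⟨isoOfEq (line hu hd huW (s.1 + m, s.2)) (twistObj m (line hu hd huW s)).par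
    (twistObj m (line hu hd huW s)).deg (twistObj m (line hu hd huW s)).p
    (twistObj m (line hu hd huW s)).p_homog (twistObj m (line hu hd huW s)).p_mul_p rfl ?_ rfl⟩
  funext i
  change Fin 2 at i
  change (![s.1 + m - a 0, s.1 + m] : Fin 2 → ℤ) i + shiftIdx ((![0, 1] : Fin 2 → ZMod 2) i) s.2 * d =
    (![s.1 - a 0, s.1] : Fin 2 → ℤ) i + shiftIdx ((![0, 1] : Fin 2 → ZMod 2) i) s.2 * d + m
  fin_cases i <;> simp <;> ring

/-- The double shift `[2]` is the grade shift by `d`, because the index shift by 2 is 1 in both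
parities. -/
theorem line_iso_period (s : ℤ × ℤ) :
    Nonempty (line hu hd huW (s.1, s.2 + 2) ≅ line hu hd huW (s.1 + d, s.2)) := by
  have h2 : ((2 : ℤ) : ZMod 2) = 0 := rfl
  have hI : ∀ x : ZMod 2, shiftIdx x 2 = 1 := fun x => by
    have := shiftIdx_spec x 2
    rw [h2, add_zero] at this
    linarith
  refine ⟨isoOfEq (line hu hd huW (s.1, s.2 + 2)) (line hu hd huW (s.1 + d, s.2)).par
    (line hu hd huW (s.1 + d, s.2)).deg (line hu hd huW (s.1 + d, s.2)).p
    (line hu hd huW (s.1 + d, s.2)).p_homog (line hu hd huW (s.1 + d, s.2)).p_mul_p ?_ ?_ ?_⟩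
  · funext i
    change (![0, 1] : Fin 2 → ZMod 2) i + ((s.2 + 2 : ℤ) : ZMod 2) =
      (![0, 1] : Fin 2 → ZMod 2) i + (s.2 : ZMod 2)
    rw [Int.cast_add, h2, add_zero]
  · funext i
    change Fin 2 at i
    change (![s.1 - a 0, s.1] : Fin 2 → ℤ) i + shiftIdx ((![0, 1] : Fin 2 → ZMod 2) i) (s.2 + 2) * d =
      (![s.1 + d - a 0, s.1 + d] : Fin 2 → ℤ) i + shiftIdx ((![0, 1] : Fin 2 → ZMod 2) i) s.2 * d
    rw [shiftIdx_add, hI]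
    fin_cases i <;> simp <;> ring
  · rw [line_p, line_p, sgn, sgn, Int.negOnePow_add, Int.negOnePow_even 2 (by decide), mul_one]

/-- A grade shift by 1 turns the phase by `2 / d` and a cohomological shift by 1, which changes the
sign, turns it by 1. -/
theorem centralCharge_line (hd0 : d ≠ 0) (s : ℤ × ℤ) : centralCharge (line hu hd huW s) =
    Complex.exp (Complex.I * Real.pi * (s.2 + 2 * s.1 / d)) *
      centralCharge (rankOne (hu 0) (hu 1) hd huW 0) := by
  have h1 : centralCharge (rankOne (hu 0) (hu 1) hd huW s.1) =
      Complex.exp (2 * Real.pi * Complex.I * (s.1 / d)) *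
        centralCharge (rankOne (hu 0) (hu 1) hd huW 0) := by
    have h2 : ∀ j, centralCharge (rankOne (hu 0) (hu 1) hd huW j) =
        charge d 0 (j - a 0) + charge d 1 j := fun j =>
      Fin.sum_univ_two (fun i : Fin 2 => charge d ((![0, 1] : Fin 2 → ZMod 2) i)
        ((![j - a 0, j] : Fin 2 → ℤ) i))
    rw [h2, h2, mul_add, ← charge_add, ← charge_add]
    congr 2 <;> ring
  rw [centralCharge_shiftObj hd0, h1, ← mul_assoc]
  congr 1
  rw [← Complex.exp_pi_mul_I, ← Complex.exp_int_mul, ← Complex.exp_add]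
  congr 1
  ring

/-- The value is `exp(-2πi a 0 / d) - 1`, and `0 < a 0 < d`. -/
theorem centralCharge_rankOne_ne_zero (ha : ∀ i, 0 < a i) :
    centralCharge (rankOne (hu 0) (hu 1) hd huW 0) ≠ 0 := by
  have h1 := ha 0
  have h2 := ha 1
  have hd0 : (d : ℂ) ≠ 0 := by
    have : d ≠ 0 := by omega
    exact_mod_cast this
  have h3 : centralCharge (rankOne (hu 0) (hu 1) hd huW 0) =
      charge d 0 (0 - a 0) + charge d 1 0 :=
    Fin.sum_univ_two (fun i : Fin 2 => charge d ((![0, 1] : Fin 2 → ZMod 2) i)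
      ((![0 - a 0, 0] : Fin 2 → ℤ) i))
  have hv : (1 : ZMod 2).val = 1 := rfl
  rw [h3, charge, charge, hv]
  intro h
  simp only [ZMod.val_zero, pow_zero, one_mul, pow_one, Int.cast_zero, zero_div, mul_zero,
    Complex.exp_zero] at h
  rw [mul_one, add_neg_eq_zero, Complex.exp_eq_one_iff] at h
  obtain ⟨m, hm⟩ := h
  have hpi : (2 * Real.pi * Complex.I : ℂ) ≠ 0 := by
    simp [Real.pi_ne_zero, Complex.I_ne_zero]
  have h4 : ((0 - a 0 : ℤ) : ℂ) / d = m := mul_left_cancel₀ hpi (by rw [hm]; ring)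
  rw [div_eq_iff hd0] at h4
  have h5 : 0 - a 0 = m * d := by exact_mod_cast h4
  rcases lt_or_ge m 0 with h | h
  · nlinarith
  · nlinarith

/-- The index set of the summands of phase `φ`. -/
def phaseSet (d : ℤ) (φ₀ φ : ℝ) : Set (ℤ × ℤ) :=
  {t | 0 ≤ t.1 ∧ t.1 < d ∧ φ₀ + t.2 + 2 * t.1 / d = φ}

variable {hu hd huW}

theorem isFiniteSumOf_shift {φ₀ φ ψ : ℝ} (k : ℤ) (h : φ + k = ψ) {E : HMF a d W}
    (hE : IsFiniteSumOf (line hu hd huW) (phaseSet d φ₀ φ) E) :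
    IsFiniteSumOf (line hu hd huW) (phaseSet d φ₀ ψ) (E⟦k⟧) := by
  refine hE.map (shiftFunctor (HMF a d W) k) ?_
  rintro s ⟨h0, h1, h2⟩
  refine ⟨(s.1, s.2 + k), ⟨h0, h1, ?_⟩, line_iso_shift hu hd huW s k⟩
  rw [← h, ← h2]
  push_cast
  ring

/-- The grade shift sends `L(j)` to `L(j + 1)`. At `j = d - 1` the result is `L(0)[2]`, whose phase
is consistent because `2 * (d - 1) / d + 2 / d = 2`. -/
theorem isFiniteSumOf_twist_one (hd0 : 0 < d) {φ₀ φ ψ : ℝ} (h : φ + 2 / d = ψ) {E : HMF a d W}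
    (hE : IsFiniteSumOf (line hu hd huW) (phaseSet d φ₀ φ) E) :
    IsFiniteSumOf (line hu hd huW) (phaseSet d φ₀ ψ) (twistObj 1 E) := by
  have hd' : (d : ℝ) ≠ 0 := by exact_mod_cast hd0.ne'
  refine hE.map (twistFun 1) ?_
  rintro s ⟨h0, h1, h2⟩
  obtain ⟨e⟩ := line_iso_twist hu hd huW s 1
  rcases lt_or_eq_of_le (show s.1 + 1 ≤ d by omega) with h3 | h3
  · refine ⟨(s.1 + 1, s.2), ⟨by change 0 ≤ s.1 + 1; omega, h3, ?_⟩, ⟨e⟩⟩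
    rw [← h, ← h2]
    push_cast
    ring
  · obtain ⟨e'⟩ := line_iso_period hu hd huW (0, s.2)
    refine ⟨(0, s.2 + 2), ⟨le_rfl, hd0, ?_⟩, ⟨e' ≪≫ eqToIso ?_ ≪≫ e⟩⟩
    · have h4 : (s.1 : ℝ) = d - 1 := by rw [← h3]; push_cast; ring
      rw [← h, ← h2, h4]
      push_cast
      field_simp
      ring
    · rw [h3, zero_add]

/-- In this direction the wrap occurs at `j = 0`, where `L(-1)` is `L(d - 1)[-2]`. -/
theorem isFiniteSumOf_twist_neg_one (hd0 : 0 < d) {φ₀ φ ψ : ℝ} (h : ψ + 2 / d = φ) {E : HMF a d W}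
    (hE : IsFiniteSumOf (line hu hd huW) (phaseSet d φ₀ φ) E) :
    IsFiniteSumOf (line hu hd huW) (phaseSet d φ₀ ψ) (twistObj (-1) E) := by
  have hd' : (d : ℝ) ≠ 0 := by exact_mod_cast hd0.ne'
  obtain rfl : ψ = φ - 2 / d := by rw [← h]; ring
  refine hE.map (twistFun (-1)) ?_
  rintro s ⟨h0, h1, h2⟩
  obtain ⟨e⟩ := line_iso_twist hu hd huW s (-1)
  rcases lt_or_eq_of_le h0 with h3 | h3
  · refine ⟨(s.1 + -1, s.2), ⟨by change 0 ≤ s.1 + -1; omega, by change s.1 + -1 < d; omega, ?_⟩, ⟨e⟩⟩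
    rw [← h2]
    push_cast
    ring
  · obtain ⟨e'⟩ := line_iso_period hu hd huW (s.1 + -1, s.2 - 2)
    refine ⟨(d - 1, s.2 - 2), ⟨by change 0 ≤ d - 1; omega, by change d - 1 < d; omega, ?_⟩,
      ⟨eqToIso ?_ ≪≫ e'.symm ≪≫ eqToIso ?_ ≪≫ e⟩⟩
    · rw [← h2, ← h3]
      push_cast
      field_simp
      ring
    · rw [← h3, show (d - 1 : ℤ) = 0 + -1 + d by ring]
    · rw [sub_add_cancel]

/-- The stability condition whose semistable objects are the sums of factorizations of rank one of
equal phase. -/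
theorem exists_stability (ha : ∀ i, 0 < a i) (hb : Function.Bijective (aeval u :
      MvPolynomial (Fin 2) ℂ →ₐ[ℂ] MvPolynomial (Fin 2) ℂ))
    (hc : ∀ k, constantCoeff (u k) = 0) (hne : u 0 ≠ 0) {φ₀ r : ℝ} (hr : 0 < r)
    (hZ : centralCharge (rankOne (hu 0) (hu 1) hd huW 0) =
      r * Complex.exp (Complex.I * Real.pi * φ₀)) :
    ∃ σ : StabilityCondition (HMF a d W),
      (∀ E, σ.Z (K0.of E) = HMF.centralCharge E) ∧
      (∀ (φ : ℝ) (E : HMF a d W), σ.P φ E ↔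
        IsFiniteSumOf (line hu hd huW) (phaseSet d φ₀ φ) E) ∧
      σ.IsGepner HMF.tau (2 / d) := by
  have hd0 : 0 < d := by have := ha 0; have := ha 1; omega
  have hline : ∀ s : ℤ × ℤ, centralCharge (line hu hd huW s) =
      r * Complex.exp (Complex.I * Real.pi * ((φ₀ + s.2 + 2 * s.1 / d : ℝ) : ℂ)) := fun s => by
    rw [centralCharge_line hu hd huW hd0.ne', hZ, mul_left_comm, ← Complex.exp_add]
    congr 2
    push_cast
    ring
  refine ⟨{ Z := chargeHom a W hd0.ne'
            P := fun φ E => IsFiniteSumOf (line hu hd huW) (phaseSet d φ₀ φ) E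
            mem_of_iso := fun _ _ _ ⟨e⟩ h => h.of_iso e
            mem_of_isZero := fun _ _ h => IsFiniteSumOf.of_isZero h
            biprod_mem := fun _ _ _ h h' => h.biprod h'
            exists_Z_eq := ?_
            P_add_one := fun φ => ?_
            hom_eq_zero := ?_
            exists_filtration := ?_ }, chargeHom_of hd0.ne', fun _ _ => Iff.rfl,
    chargeHom_tau_inverse hd0.ne', fun φ => ?_⟩
  · intro φ E hE hE0
    rw [chargeHom_of]
    -- The empty sum has charge zero, so the induction carries the alternative `IsZero E`.
    refine Or.resolve_left (IsFiniteSumOf.induction (Q := fun E => IsZero E ∨ ∃ r : ℝ, 0 < r ∧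
      centralCharge E = r * Complex.exp (Complex.I * Real.pi * φ)) ?_ ?_ ?_ hE) hE0
    · rintro E F ⟨e⟩ (h | h)
      · exact Or.inl (h.of_iso e.symm)
      · rw [← centralCharge_eq_of_iso hd0.ne' e]
        exact Or.inr h
    · exact fun E h => Or.inl h
    · rintro s ⟨_, _, hs⟩ E h
      refine Or.inr ?_
      have h1 := hline s
      rw [hs] at h1
      rw [centralCharge_biprod hd0.ne', h1]
      rcases h with h | ⟨r', hr', h⟩
      · exact ⟨r, hr, by rw [centralCharge_of_isZero hd0.ne' h, add_zero]⟩
      · exact ⟨r + r', add_pos hr hr', by rw [h]; push_cast; ring⟩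
  · exact eq_of_shift_eq (fun _ _ ⟨e⟩ h => h.of_iso e)
      (fun E hE => isFiniteSumOf_shift 1 (by push_cast; ring) hE)
      (fun E hE => isFiniteSumOf_shift (-1) (by push_cast; ring) hE)
  · intro φ₁ φ₂ hφ E₁ E₂ h₁ h₂ f
    refine IsFiniteSumOf.hom_eq_zero ?_ h₁ h₂ f
    rintro s ⟨hs0, hs1, hs⟩ t ⟨ht0, ht1, ht⟩
    refine hom_line_line_eq_zero hu hd huW hb hc hne hd0 hs0 hs1 ht0 ht1 ?_
    rintro rfl
    exact hφ.ne (ht.symm.trans hs)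
  -- The filtration is by partial sums of a decomposition sorted by phase, and its triangles are
  -- split.
  · intro E _
    obtain ⟨I, _, t, ht, ⟨e⟩⟩ := exists_iso_biproduct hu hd huW ha hb hc hne E
    let ph : ℤ × ℤ → ℝ := fun s => φ₀ + s.2 + 2 * s.1 / d
    have h1 : IsFiniteSumOf (line hu hd huW) {s | s ∈ {s : ℤ × ℤ | 0 ≤ s.1 ∧ s.1 < d} ∧
        ph s ∈ Finset.univ.image fun i => ph (t i)} E :=
      IsFiniteSumOf.of_fintype t (fun i => ⟨ht i, Finset.mem_image_of_mem _ (Finset.mem_univ i)⟩) e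
    obtain ⟨N, F, φ, hF, hφ, ⟨e'⟩⟩ := IsFiniteSumOf.exists_filtration _ E h1
    refine ⟨N, fun i => Nat.rec (motive := fun _ => HMF a d W) _ (fun i Y => Y ⊞ F i) i.val,
      fun i => F i, fun i => φ i, isZero_zero _, ⟨e'⟩, fun i j hij => hφ i j hij j.2,
      fun i => ?_, fun i => ?_⟩
    · refine (hF i i.2).2.mono ?_
      rintro s ⟨⟨h0, h1⟩, h2⟩
      exact ⟨h0, h1, h2⟩
    · exact ⟨_, _, _, Pretriangulated.binaryBiproductTriangle_distinguished
        (Nat.rec (motive := fun _ => HMF a d W) _ (fun i Y => Y ⊞ F i) i.val) (F i)⟩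
  · have h1 : ((2 / d : ℂ)).re = 2 / d := by
      rw [show (2 / d : ℂ) = ((2 / d : ℝ) : ℂ) by push_cast; rfl, Complex.ofReal_re]
    rw [h1]
    exact map_tau_eq (fun _ _ ⟨e⟩ h => h.of_iso e)
      (fun E hE => isFiniteSumOf_twist_one hd0 rfl hE)
      (fun E hE => isFiniteSumOf_twist_neg_one hd0 rfl hE)

/-- The projector onto the first part of a decomposition is a scalar. If the scalar is zero, the
first part vanishes; if not, the projector is invertible and idempotent, hence the identity, and the
second part vanishes. -/
theorem indecomposable_line (hb : Function.Bijective (aeval u :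
      MvPolynomial (Fin 2) ℂ →ₐ[ℂ] MvPolynomial (Fin 2) ℂ))
    (hc : ∀ k, constantCoeff (u k) = 0) (hne : u 0 ≠ 0) (s : ℤ × ℤ) :
    Indecomposable (line hu hd huW s) := by
  refine ⟨not_isZero_line hu hd huW hb hc hne s, fun Y Z e => ?_⟩
  obtain ⟨c, h⟩ := exists_eq_homScalar hu hd huW hb hc hne
    (e.hom ≫ biprod.fst ≫ biprod.inl ≫ e.inv)
  by_cases h0 : c = 0
  · left
    rw [h0, homScalar_zero] at h
    rw [IsZero.iff_id_eq_zero]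
    calc 𝟙 Y = biprod.inl ≫ e.inv ≫ (e.hom ≫ biprod.fst ≫ biprod.inl ≫ e.inv) ≫ e.hom ≫
        biprod.fst := by simp
      _ = 0 := by rw [h]; simp
  · right
    have h1 : e.hom ≫ biprod.fst ≫ biprod.inl ≫ e.inv = 𝟙 _ := by
      calc e.hom ≫ biprod.fst ≫ biprod.inl ≫ e.inv
          = (homScalar _ c⁻¹ ≫ homScalar _ c) ≫ (e.hom ≫ biprod.fst ≫ biprod.inl ≫ e.inv) := by
            rw [homScalar_comp, inv_mul_cancel₀ h0, homScalar_one, Category.id_comp]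
        _ = homScalar _ c⁻¹ ≫ homScalar _ c := by rw [← h]; simp
        _ = 𝟙 _ := by rw [homScalar_comp, inv_mul_cancel₀ h0, homScalar_one]
    rw [IsZero.iff_id_eq_zero]
    calc 𝟙 Z = biprod.inr ≫ e.inv ≫ 𝟙 _ ≫ e.hom ≫ biprod.snd := by simp
      _ = 0 := by rw [← h1]; simp

end Gepner

end HMF

/-! ### The theorem -/

theorem mainTheorem7 (a : Fin 2 → ℤ) (ha : ∀ i, 0 < a i) (d : ℤ) (hd : 0 < d)
    (W : MvPolynomial (Fin 2) ℂ) (hW : MvPolynomial.IsWeightedHomogeneous a W d)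
    (hsing : ∀ x : Fin 2 → ℂ, MvPolynomial.eval x W = 0 →
      (∀ i, MvPolynomial.eval x (MvPolynomial.pderiv i W) = 0) → x = 0)
    (hε : 0 ≤ a 0 + a 1 - d) :
    -- there is a Gepner type stability condition with central charge `Z_G`
    (∃ σ : StabilityCondition (HMF a d W),
      (∀ E, σ.Z (K0.of E) = HMF.centralCharge E) ∧ σ.IsGepner HMF.tau (2 / d)) ∧
    -- the case `ε > 0`
    (0 < a 0 + a 1 - d → ∀ E : HMF a d W, IsZero E) ∧
    -- the case `ε = 0`
    (∀ h : d = a 0 + a 1,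
      (∃ u : Fin 2 → MvPolynomial (Fin 2) ℂ,
        (∀ i, MvPolynomial.IsWeightedHomogeneous a (u i) (a i)) ∧
        Function.Bijective (MvPolynomial.aeval u :
          MvPolynomial (Fin 2) ℂ →ₐ[ℂ] MvPolynomial (Fin 2) ℂ) ∧
        W = u 0 * u 1) ∧
      ∀ (u : Fin 2 → MvPolynomial (Fin 2) ℂ)
        (hu : ∀ i, MvPolynomial.IsWeightedHomogeneous a (u i) (a i)) (huW : W = u 0 * u 1)
        (L : ℤ → HMF a d W) (_ : ∀ j, L j = HMF.rankOne (hu 0) (hu 1) h huW j),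
        -- every object is a finite direct sum of objects `L(j)[k]`
        (∀ E : HMF a d W, IsFiniteSumOf (fun t : ℤ × ℤ => (L t.1)⟦t.2⟧)
          {t | 0 ≤ t.1 ∧ t.1 < d} E) ∧
        -- the indecomposable objects are the objects `L(j)[k]`
        (∀ E : HMF a d W, Indecomposable E ↔
          ∃ j k : ℤ, 0 ≤ j ∧ j < d ∧ Nonempty (E ≅ (L j)⟦k⟧)) ∧
        -- they are mutually orthogonal
        (∀ j k j' k' : ℤ, 0 ≤ j → j < d → 0 ≤ j' → j' < d → (j, k) ≠ (j', k') →
          ∀ f : (L j)⟦k⟧ ⟶ (L j')⟦k'⟧, f = 0) ∧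
        -- their phases define a Gepner type stability condition
        (∃ φ₀ r : ℝ, 0 < r ∧
          HMF.centralCharge (L 0) = r * Complex.exp (Complex.I * Real.pi * φ₀)) ∧
        (∀ φ₀ r : ℝ, 0 < r →
          HMF.centralCharge (L 0) = r * Complex.exp (Complex.I * Real.pi * φ₀) →
          ∃ σ : StabilityCondition (HMF a d W),
            (∀ E, σ.Z (K0.of E) = HMF.centralCharge E) ∧
            (∀ (φ : ℝ) (E : HMF a d W), σ.P φ E ↔
              IsFiniteSumOf (fun t : ℤ × ℤ => (L t.1)⟦t.2⟧)
                {t | 0 ≤ t.1 ∧ t.1 < d ∧ φ₀ + t.2 + 2 * t.1 / d = φ} E) ∧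
            σ.IsGepner HMF.tau (2 / d))) := by
  have ha01 := ha 0
  have ha11 := ha 1
  have hpos : 0 < a 0 + a 1 - d → ∀ E : HMF a d W, IsZero E := fun h => by
    obtain ⟨i, c, hc, hi⟩ := HMF.exists_pderiv_eq_C ha hd hW hsing (by linarith)
    exact HMF.isZero_of_pderiv hc hi
  have hcoord : ∀ u : Fin 2 → MvPolynomial (Fin 2) ℂ,
      (∀ i, MvPolynomial.IsWeightedHomogeneous a (u i) (a i)) → W = u 0 * u 1 →
      Function.Bijective (MvPolynomial.aeval u :
        MvPolynomial (Fin 2) ℂ →ₐ[ℂ] MvPolynomial (Fin 2) ℂ) ∧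
      (∀ k, MvPolynomial.constantCoeff (u k) = 0) ∧ u 0 ≠ 0 := fun u hu huW =>
    ⟨HMF.aeval_bijective ha hsing hu huW,
      fun k => HMF.constantCoeff_eq_zero_of_isWeightedHomogeneous (hu k) (ha k).ne', fun h =>
      HMF.ne_zero_of_isolated hsing (by rw [huW, h, zero_mul])⟩
  have hphase : ∀ z : ℂ, z ≠ 0 →
      ∃ φ₀ r : ℝ, 0 < r ∧ z = r * Complex.exp (Complex.I * Real.pi * φ₀) := fun z hz => by
    refine ⟨Complex.arg z / Real.pi, ‖z‖, norm_pos_iff.2 hz, ?_⟩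
    conv_lhs => rw [← Complex.norm_mul_exp_arg_mul_I z]
    congr 2
    have : (Real.pi : ℂ) ≠ 0 := by exact_mod_cast Real.pi_ne_zero
    push_cast
    field_simp
  refine ⟨?_, hpos, fun h => ⟨?_, ?_⟩⟩
  · rcases hε.lt_or_eq with h | h
    · exact HMF.exists_stability_of_isZero hd.ne' (hpos h)
    · have h' : d = a 0 + a 1 := by linarith
      obtain ⟨u, hu, huW⟩ := HMF.exists_factorization ha (h' ▸ hW)
      obtain ⟨hb, hc, hne⟩ := hcoord u hu huW
      obtain ⟨φ₀, r, hr, hZ⟩ := hphase _ (HMF.centralCharge_rankOne_ne_zero hu h' huW ha)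
      obtain ⟨σ, h₁, -, h₂⟩ := HMF.exists_stability ha hb hc hne hr hZ
      exact ⟨σ, h₁, h₂⟩
  · obtain ⟨u, hu, huW⟩ := HMF.exists_factorization ha (h ▸ hW)
    exact ⟨u, hu, (hcoord u hu huW).1, huW⟩
  · intro u hu huW L hL
    obtain rfl : L = fun j => HMF.rankOne (hu 0) (hu 1) h huW j := funext hL
    obtain ⟨hb, hc, hne⟩ := hcoord u hu huW
    have hsum : ∀ E : HMF a d W,
        IsFiniteSumOf (HMF.line hu h huW) {t | 0 ≤ t.1 ∧ t.1 < d} E := fun E => by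
      obtain ⟨I, _, t, ht, ⟨e⟩⟩ := HMF.exists_iso_biproduct hu h huW ha hb hc hne E
      exact IsFiniteSumOf.of_fintype t ht e
    refine ⟨hsum, fun E => ⟨fun hE => ?_, ?_⟩, ?_,
      hphase _ (HMF.centralCharge_rankOne_ne_zero hu h huW ha), fun φ₀ r hr hZ => ?_⟩
    · obtain ⟨s, ⟨h0, h1⟩, e⟩ := IsFiniteSumOf.exists_iso_of_indecomposable
        (fun s _ => HMF.not_isZero_line hu h huW hb hc hne s) hE (hsum E)
      exact ⟨s.1, s.2, h0, h1, e⟩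
    · rintro ⟨j, k, -, -, ⟨e⟩⟩
      obtain ⟨h0, h1⟩ := HMF.indecomposable_line (hu := hu) (hd := h) (huW := huW) hb hc hne (j, k)
      exact ⟨fun hE => h0 (hE.of_iso e.symm), fun Y Z e' => h1 Y Z (e.symm ≪≫ e')⟩
    · intro j k j' k' hj0 hj1 hj0' hj1' hne' f
      exact HMF.hom_line_line_eq_zero hu h huW hb hc hne hd (s := (j, k)) (t := (j', k'))
        hj0 hj1 hj0' hj1' hne' f
    · exact HMF.exists_stability ha hb hc hne hr hZ
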